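/- **Theorem (SMC variance bound for the Potts model).** For $k\ge 0$ let $\eta_k$ be the 3-colour mean-field Potts distribution on $\{1,2,3\}^k$ at the critical temperature $\tilde\beta_c=2\log 2$, $$\eta_k(\sigma)\propto\exp\big(k\tilde\beta_c(s_1(\sigma)^2+s_2(\sigma)^2+s_3(\sigma)^2)\big),$$ where $s_c(\sigma)$ is the ratio of spins of colour $c$ in $\sigma$. For $M\ge 1$ and $0\le k\le M$ let $\mu_k$ (the interpolation to independence sequence) be the distribution on $\Omega=\{1,2,3\}^M$ under which $(\sigma_1,\dots,\sigma_k)$ has law $\eta_k$ and $\sigma_{k+1},\dots,\sigma_M$ are i.i.d. uniform on $\{1,2,3\}$, independent of the first $k$ spins; so $\mu_M=\eta_M$. Put $g_{k,k+1}=\mu_{k+1}/\mu_k$. For $k\ge 1$ let $P_k$ be the Markov kernel on $\Omega$ which performs one Glauber step for $\eta_k$ on $(\sigma_1,\dots,\sigma_k)$ (one of these $k$ spins is chosen uniformly and redrawn from its conditional law under $\eta_k$ given the other $k-1$) and replaces $\sigma_{k+1},\dots,\sigma_M$ by independent uniform spins. For $C_1>0$ let $t_k=\lceil C_1k\log(k)^2\rceil$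 and $K_k=P_k^{t_k}$. The SMC sampler with $N$ particles starts with $N$ independent draws from $\mu_0$. To pass from stage $k$ to stage $k+1$, $0\le k<M$, it draws $N$ particles independently from the current ones with probabilities proportional to $g_{k,k+1}$ (multinomial resampling) and then moves each of them independently by $K_{k+1}$. Let $\mu_M^N(f)$ be the average of $f:\Omega\to\mathbb R$ over the $N$ particles obtained at stage $M$. There are absolute constants $C_1,C_2,C_3>0$ such that for every $M\ge 1$: 1. for every $f:\Omega\to\mathbb R$, $\sqrt N\,(\mu_M^N(f)-\mu_M(f))$ converges in distribution, as $N\to\infty$, to $\mathcal N(0,V_M(f))$ with $$V_M(f)=\sum_{k=0}^{M}\big\|G_{k,k+1}K_{k+1}G_{k+1,k+2}K_{k+2}\cdots G_{M-1,M}K_M\,(f-\mu_M(f))\big\|_{L^2(\mu_k)}^2,$$ where $G_{k,k+1}$ is multiplication by $g_{k,k+1}$ (the term $k=M$ is $\mathrm{Var}_{\mu_M}(f)$), and this asymptotic variance satisfies $$V_M(f)\le C_2\,M\,\|f\|_\infty^2;$$ 2. there is a number of particles $N\ge 1$, depending on $M$ only, such that $V_M(f)/N\le 1$ for every $f$ with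 $\|f\|_\infty\le 1$ and such that the total number of Markov chain steps satisfies $N\sum_{k=1}^M t_k\le C_3\,M^3\log(M)^2$. -/

import Mathlib

open MeasureTheory ProbabilityTheory Filter Topology
open scoped ENNReal NNReal

noncomputable section

namespace PottsSMC

/-! ### Sequential Monte Carlo on a finite state space -/

/-- The joint law of independent draws, the `i`-th one from `p i`. -/
def indep {ι E : Type} [Fintype ι] [DecidableEq ι] [Fintype E] (p : ι → PMF E) : PMF (ι → E) :=
  PMF.ofFintype (fun x => ∏ i, p i (x i)) (by
    rw [← Fintype.prod_sum (fun i a => p i a)]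
    refine Finset.prod_eq_one fun i _ => ?_
    rw [← tsum_fintype (L := SummationFilter.unconditional E)]
    exact (p i).tsum_coe)

/-- Run `t` steps of the Markov kernel `P`. -/
def iterKernel {E : Type} (P : E → PMF E) : ℕ → E → PMF E
  | 0, x => PMF.pure x
  | t + 1, x => (P x).bind (iterKernel P t)

/-- Multinomial resampling: draw one of the particles `x i`, the `i`-th one with probability
`w (x i) / ∑ j, w (x j)`. -/
def resampleOne {E : Type} (w : E → ℝ≥0∞) (hw0 : ∀ x, w x ≠ 0) (hw : ∀ x, w x ≠ ∞)
    {N : ℕ} [NeZero N] (x : Fin N → E) : PMF E :=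
  (PMF.normalize (fun i => w (x i))
    (fun h => hw0 _ (ENNReal.tsum_eq_zero.mp h 0))
    (by rw [tsum_fintype]; exact ENNReal.sum_ne_top.mpr fun i _ => hw _)).map x

section Sampler

variable {E : Type} [Fintype E]

/-- The density `g_{k,k+1} = dμ_{k+1} / dμ_k` (all the `μ k` will have full support). -/
def density (μ : ℕ → PMF E) (k : ℕ) (x : E) : ℝ≥0∞ := μ (k + 1) x / μ k x

/-- The law of the population of `N` particles of the SMC sampler at stage `k`: `N` independent
draws from `μ 0` at stage `0`; from stage `k` to stage `k + 1`, the particles are resampled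
(multinomially, with weights `g_{k,k+1}`) and are then moved independently by the kernel
`K (k + 1)`. -/
def particles (μ : ℕ → PMF E) (hμ : ∀ k x, μ k x ≠ 0) (K : ℕ → E → PMF E)
    (N : ℕ) [NeZero N] : ℕ → PMF (Fin N → E)
  | 0 => indep fun _ => μ 0
  | k + 1 =>
    ((particles μ hμ K N k).bind fun x =>
      indep fun _ : Fin N => resampleOne (density μ k)
        (fun _ => ENNReal.div_ne_zero.mpr ⟨hμ _ _, PMF.apply_ne_top _ _⟩)
        (fun _ => ENNReal.div_ne_top (PMF.apply_ne_top _ _) (hμ _ _)) x).bind fun y =>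
      indep fun i => K (k + 1) (y i)

/-- The expectation `p(f)`. -/
def mean (p : PMF E) (f : E → ℝ) : ℝ := ∑ x, (p x).toReal * f x

/-- The empirical average `(1 / N) ∑ i, f (x i)` of `f` over the particles. -/
def empirical {N : ℕ} (f : E → ℝ) (x : Fin N → E) : ℝ := (∑ i, f (x i)) / N

/-- The function `G_{k,k+1} K_{k+1} ⋯ G_{k+m-1,k+m} K_{k+m} φ`, where `G_{k,k+1}` is
multiplication by `g_{k,k+1}` and `K φ (x) = ∑ y, K(x, y) φ(y)`. -/
def semigroup (μ : ℕ → PMF E) (K : ℕ → E → PMF E) (φ : E → ℝ) : ℕ → ℕ → E → ℝ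
  | _, 0 => φ
  | k, m + 1 => fun x =>
      (density μ k x).toReal * mean (K (k + 1) x) (semigroup μ K φ (k + 1) m)

/-- `V_n(f) = ∑_{k=0}^n ‖G_{k,k+1} K_{k+1} ⋯ G_{n-1,n} K_n φ‖²_{L²(μ_k)}` with `φ = f - μ_n(f)`. -/
def asympVar (μ : ℕ → PMF E) (K : ℕ → E → PMF E) (n : ℕ) (f : E → ℝ) : ℝ :=
  ∑ k ∈ Finset.range (n + 1),
    mean (μ k) fun x => (semigroup μ K (fun y => f y - mean (μ n) f) k (n - k) x) ^ 2

/-- The central limit theorem for the SMC average of `f` at stage `n`: in distribution,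
`√N (μ^N_n(f) - μ_n(f)) → Normal(0, V)` as the number of particles `N` tends to infinity
(the number of particles is written as `N + 1`). -/
def HasCLT [MeasurableSpace E] (μ : ℕ → PMF E) (hμ : ∀ k x, μ k x ≠ 0) (K : ℕ → E → PMF E)
    (n : ℕ) (f : E → ℝ) (V : ℝ≥0) : Prop :=
  TendstoInDistribution
    (fun (N : ℕ) (x : Fin (N + 1) → E) =>
      √((N : ℝ) + 1) * (empirical f x - mean (μ n) f))
    atTop (id : ℝ → ℝ)
    (fun N => (particles μ hμ K (N + 1) n).toMeasure) (gaussianReal 0 V)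

end Sampler

/-! ### The mean-field Potts model with three colours -/

/-- Configurations of `M` spins with three colours. -/
abbrev Spins (M : ℕ) : Type := Fin M → Fin 3

/-- The ratio `s_c(σ)` of spins of colour `c`. -/
def ratio {M : ℕ} (σ : Spins M) (c : Fin 3) : ℝ :=
  ((Finset.univ.filter fun i => σ i = c).card : ℝ) / M

/-- The unnormalised Gibbs weight `exp (M β (s_1² + s_2² + s_3²))`. -/
def gibbsWeight (β : ℝ) {M : ℕ} (σ : Spins M) : ℝ :=
  Real.exp (M * β * ∑ c, ratio σ c ^ 2)

/-- The mean-field Potts distribution on `M` spins. -/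
def potts (β : ℝ) (M : ℕ) : PMF (Spins M) :=
  PMF.normalize (fun σ => ENNReal.ofReal (gibbsWeight β σ))
    (fun h => (ENNReal.ofReal_pos.mpr (Real.exp_pos _)).ne'
      (ENNReal.tsum_eq_zero.mp h fun _ => 0))
    (by rw [tsum_fintype]; exact ENNReal.sum_ne_top.mpr fun _ _ => ENNReal.ofReal_ne_top)

theorem potts_ne_zero (β : ℝ) (M : ℕ) (σ : Spins M) : potts β M σ ≠ 0 := by
  rw [← PMF.mem_support_iff, potts, PMF.mem_support_normalize_iff]
  exact (ENNReal.ofReal_pos.mpr (Real.exp_pos _)).ne'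

/-- The critical temperature `2 log 2`. -/
def betaC : ℝ := 2 * Real.log 2

/-- One step of the Glauber dynamics of the Potts model on `k ≥ 1` spins: choose a spin
uniformly and draw it from its conditional distribution given all the other spins. -/
def glauber (β : ℝ) (k : ℕ) [NeZero k] (σ : Spins k) : PMF (Spins k) :=
  (PMF.uniformOfFintype (Fin k)).bind fun i =>
    (potts β k).filter {τ | ∀ j, j ≠ i → τ j = σ j}
      ⟨σ, fun _ _ => rfl, (PMF.mem_support_iff _ _).mpr (potts_ne_zero β k σ)⟩

/-! ### Interpolation to independence (used for `k ≤ M` only) -/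

/-- The first `k` spins of `σ` (the value `0` is never used when `k ≤ M`). -/
def head {M : ℕ} (k : ℕ) (σ : Spins M) : Spins k :=
  fun i => if h : (i : ℕ) < M then σ ⟨i, h⟩ else 0

/-- The configuration whose first `k` spins are those of `a` and whose other spins are those
of `b`. -/
def glue {M k : ℕ} (a : Spins k) (b : Spins M) : Spins M :=
  fun i => if h : (i : ℕ) < k then a ⟨i, h⟩ else b i

/-- Given the law `p` of the first `k` spins, the law of all `M` spins when the other ones are
independent of them, independent of each other and uniform. -/
def extend {k : ℕ} (M : ℕ) (p : PMF (Spins k)) : PMF (Spins M) :=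
  p.bind fun a => (PMF.uniformOfFintype (Spins M)).map fun b => glue a b

/-- The `k`-th distribution `μ_k` of the interpolation to independence sequence. -/
def interp (β : ℝ) (M k : ℕ) : PMF (Spins M) := extend M (potts β k)

theorem interp_ne_zero (β : ℝ) (M k : ℕ) (σ : Spins M) : interp β M k σ ≠ 0 := by
  rw [← PMF.mem_support_iff, interp, extend, PMF.mem_support_bind_iff]
  refine ⟨head k σ, (PMF.mem_support_iff _ _).mpr (potts_ne_zero β k _), ?_⟩
  rw [PMF.mem_support_map_iff]
  refine ⟨σ, by simp, ?_⟩
  funext i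
  simp [glue, head]

/-- The kernel `P_k` for `k ≥ 1`: one Glauber step for the first `k` spins, and the other spins
are replaced by independent uniform ones. -/
def move (β : ℝ) (M k : ℕ) [NeZero k] (σ : Spins M) : PMF (Spins M) :=
  extend M (glauber β k (head k σ))

/-- The number `t_k = ⌈C k (log k)²⌉` of Markov chain steps at stage `k`. -/
def numSteps (C : ℝ) (k : ℕ) : ℕ := ⌈C * k * Real.log k ^ 2⌉₊

/-- The kernel `K_k = P_k ^ t_k`. At stage `0`, where `t_0 = 0`, it is the identity; the sampler
does not use it. -/
def stageKernel (β C : ℝ) (M : ℕ) : ℕ → Spins M → PMF (Spins M)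
  | 0 => PMF.pure
  | k + 1 => iterKernel (move β M (k + 1)) (numSteps C (k + 1))

/-- The total number of Markov chain steps `N ∑_{k=1}^M t_k` performed by a run with `N`
particles. -/
def totalSteps (C : ℝ) (M N : ℕ) : ℕ := N * ∑ k ∈ Finset.Icc 1 M, numSteps C k

end PottsSMC

end

/-! Central limit theorem. Given the population at stage `k`, the next population is i.i.d. from
`nextLaw`. So the characteristic function of the fluctuations splits into the N-th power of a
one-particle characteristic function, asymptotically Gaussian, and a phase carrying the fluctuation
of the conditional mean. That conditional mean is a ratio of two particle averages whose denominator
tends to 1; linearising it turns the phase into the fluctuation of `pull` of the centred function at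
stage `k`. Induction (`exists_norm_expect_particles_sub_le`) gives an error of order N^(-1/2), and
`asympVar_succ` is the matching variance recursion.

Variance bound. Positivity reduces every term to the second moment of u_k, the semigroup applied to
the constant 1, and stationarity gives u_k mean 1 under μ_k. Since g_{k,k+1} ≤ 64, it is enough that
the kernel of a stage contracts second moments up to a multiple of the squared first moment: then E
u_k² ≤ 64 B + (1/2) E u_{k+1}², which stays bounded uniformly in `k` and `M`. No spectral gap is
needed, so the coexistence of phases at the critical temperature does no harm. Iterating the Glauber
operator reduces the contraction to a super-Poincaré inequality, uniform in the number of spins: E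
w² ≤ A D(w) + B (E|w|)², with `dform` as D (`exists_superPoincare`).

Super-Poincaré inequality. Three facts carry it. (1) A ground state (Lyapunov) argument bounds E w²
by the Dirichlet form except where the colour ratios lie within O(k^(-1/2)) of a critical point of
the mean-field free energy (`mean_sq_mul_defect_le`). The critical points are found exactly: the
symmetric point x = 0, the saddles x = 1/4 and the ordered points x = 1/2 on the symmetry axes;
nondegeneracy and compactness make the defect control the squared distance to them. (2) Near a point
y, completing the square compares the Gibbs measure with a product measure times `mixWeight`, and
Efron–Stein for the product measure gives a local Poincaré inequality. What is left is the squared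
mean of w under that product measure. (3) At x = 0 and x = 1/2 the weights coincide, because the
temperature is critical, and are bounded below uniformly in `k`; the squared mean is then at most a
constant times (E|w|)². At a saddle, moving the product measure by K/√k along the unstable axis
costs a bounded chi-square factor and gains exp(K²/100) in weight, so for `K` large the saddle terms
are absorbed into E w² (`saddle_le`). -/

namespace PottsSMC

/-! ### Expectations on finite spaces -/

section Expect

variable {E F : Type} [Fintype E] [Fintype F] {V : Type*} [NormedAddCommGroup V] [NormedSpace ℝ V]

/-- The expectation of a vector-valued function on a finite space. -/
noncomputable def expect (p : PMF E) (f : E → V) : V := ∑ x, (p x).toReal • f x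

theorem mean_eq_expect (p : PMF E) (f : E → ℝ) : mean p f = expect p f := by
  simp [mean, expect]

theorem sum_toReal (p : PMF E) : ∑ x, (p x).toReal = 1 := by
  rw [← ENNReal.toReal_sum fun x _ => PMF.apply_ne_top _ _,
    ← tsum_fintype (L := SummationFilter.unconditional E), p.tsum_coe, ENNReal.toReal_one]

theorem expect_const (p : PMF E) (c : V) : expect p (fun _ => c) = c := by
  simp [expect, ← Finset.sum_smul, sum_toReal]

theorem expect_pure [DecidableEq E] (a : E) (f : E → V) : expect (PMF.pure a) f = f a := by
  simp [expect, PMF.pure_apply, ite_smul, apply_ite ENNReal.toReal]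

theorem toReal_bind_apply {F : Type} (p : PMF E) (κ : E → PMF F) (y : F) :
    (p.bind κ y).toReal = ∑ x, (p x).toReal * (κ x y).toReal := by
  rw [PMF.bind_apply, tsum_fintype, ENNReal.toReal_sum]
  · simp
  · exact fun x _ => ENNReal.mul_ne_top (PMF.apply_ne_top _ _) (PMF.apply_ne_top _ _)

theorem expect_bind (p : PMF E) (κ : E → PMF F) (f : F → V) :
    expect (p.bind κ) f = expect p fun x => expect (κ x) f := by
  simp only [expect, toReal_bind_apply, Finset.sum_smul, Finset.smul_sum, mul_smul]
  exact Finset.sum_comm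

theorem expect_map (p : PMF E) (g : E → F) (f : F → V) :
    expect (p.map g) f = expect p fun x => f (g x) := by
  classical
  rw [PMF.map, expect_bind]
  exact congrArg _ (funext fun x => expect_pure _ _)

theorem expect_add (p : PMF E) (f g : E → V) :
    expect p (fun x => f x + g x) = expect p f + expect p g := by
  simp [expect, Finset.sum_add_distrib]

theorem expect_sub (p : PMF E) (f g : E → V) :
    expect p (fun x => f x - g x) = expect p f - expect p g := by
  simp [expect, Finset.sum_sub_distrib, smul_sub]

theorem expect_sum (p : PMF E) {ι : Type*} (s : Finset ι) (f : ι → E → V) :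
    expect p (fun x => ∑ i ∈ s, f i x) = ∑ i ∈ s, expect p (f i) := by
  simp only [expect, Finset.smul_sum]
  exact Finset.sum_comm

theorem norm_expect_le (p : PMF E) (f : E → V) : ‖expect p f‖ ≤ mean p fun x => ‖f x‖ := by
  refine (norm_sum_le _ _).trans (le_of_eq (Finset.sum_congr rfl fun x _ => ?_))
  rw [norm_smul, Real.norm_of_nonneg ENNReal.toReal_nonneg]

theorem expect_mul_const (p : PMF E) (f : E → ℂ) (c : ℂ) :
    expect p (fun x => f x * c) = expect p f * c := by
  simp [expect, Finset.sum_mul, mul_assoc]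

theorem mean_const (p : PMF E) (c : ℝ) : mean p (fun _ => c) = c := by
  rw [mean_eq_expect, expect_const]

theorem mean_bind (p : PMF E) (κ : E → PMF F) (f : F → ℝ) :
    mean (p.bind κ) f = mean p fun x => mean (κ x) f := by
  simp only [mean_eq_expect, expect_bind]

theorem mean_map (p : PMF E) (g : E → F) (f : F → ℝ) :
    mean (p.map g) f = mean p fun x => f (g x) := by
  simp only [mean_eq_expect, expect_map]

theorem mean_pure (a : E) (f : E → ℝ) : mean (PMF.pure a) f = f a := by
  classical
  rw [mean_eq_expect, expect_pure]

theorem mean_add (p : PMF E) (f g : E → ℝ) :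
    mean p (fun x => f x + g x) = mean p f + mean p g := by
  simp only [mean_eq_expect, expect_add]

theorem mean_sub (p : PMF E) (f g : E → ℝ) :
    mean p (fun x => f x - g x) = mean p f - mean p g := by
  simp only [mean_eq_expect, expect_sub]

theorem mean_const_mul (p : PMF E) (f : E → ℝ) (c : ℝ) :
    mean p (fun x => c * f x) = c * mean p f := by
  simp only [mean, Finset.mul_sum]
  exact Finset.sum_congr rfl fun _ _ => by ring

theorem mean_mul_const (p : PMF E) (f : E → ℝ) (c : ℝ) :
    mean p (fun x => f x * c) = mean p f * c := by
  simp only [mean, Finset.sum_mul, mul_assoc]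

theorem mean_sum (p : PMF E) {ι : Type*} (s : Finset ι) (f : ι → E → ℝ) :
    mean p (fun x => ∑ i ∈ s, f i x) = ∑ i ∈ s, mean p (f i) := by
  simp only [mean_eq_expect, expect_sum]

theorem mean_mono (p : PMF E) {f g : E → ℝ} (h : ∀ x, f x ≤ g x) : mean p f ≤ mean p g :=
  Finset.sum_le_sum fun x _ => mul_le_mul_of_nonneg_left (h x) ENNReal.toReal_nonneg

theorem mean_nonneg (p : PMF E) {f : E → ℝ} (h : ∀ x, 0 ≤ f x) : 0 ≤ mean p f :=
  Finset.sum_nonneg fun x _ => mul_nonneg ENNReal.toReal_nonneg (h x)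

theorem mean_le_of_le (p : PMF E) {f : E → ℝ} {c : ℝ} (h : ∀ x, f x ≤ c) : mean p f ≤ c :=
  (mean_mono p h).trans_eq (mean_const p c)

theorem abs_mean_le (p : PMF E) (f : E → ℝ) : |mean p f| ≤ mean p fun x => |f x| := by
  simpa [mean_eq_expect] using norm_expect_le p f

theorem mean_sq_sub_mean (p : PMF E) (f : E → ℝ) :
    mean p (fun x => (f x - mean p f) ^ 2) = mean p (fun x => f x ^ 2) - mean p f ^ 2 := by
  have : ∀ x, (f x - mean p f) ^ 2 = f x ^ 2 - 2 * mean p f * f x + mean p f ^ 2 :=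
    fun x => by ring
  simp only [this, mean_add, mean_sub, mean_const_mul, mean_const]
  ring

theorem sq_mean_le (p : PMF E) (f : E → ℝ) : mean p f ^ 2 ≤ mean p fun x => f x ^ 2 := by
  have := mean_nonneg p (f := fun x => (f x - mean p f) ^ 2) fun x => sq_nonneg _
  rw [mean_sq_sub_mean] at this
  linarith

/-- The Cauchy–Schwarz inequality. -/
theorem sq_mean_mul_le (p : PMF E) (f g : E → ℝ) :
    mean p (fun x => f x * g x) ^ 2 ≤ mean p (fun x => f x ^ 2) * mean p (fun x => g x ^ 2) := by
  have := Finset.sum_mul_sq_le_sq_mul_sq Finset.univ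
    (fun x => √(p x).toReal * f x) (fun x => √(p x).toReal * g x)
  have h : ∀ x, √(p x).toReal * √(p x).toReal = (p x).toReal :=
    fun x => Real.mul_self_sqrt ENNReal.toReal_nonneg
  simp only [mul_pow, Real.sq_sqrt (ENNReal.toReal_nonneg)] at this
  refine le_of_eq_of_le ?_ this
  simp only [mean]
  congr 1
  exact Finset.sum_congr rfl fun x _ => by linear_combination (-(f x * g x)) * h x

end Expect

/-! ### Independent draws -/

section Indep

variable {ι E : Type} [Fintype ι] [DecidableEq ι] [Fintype E]

theorem toReal_indep (p : ι → PMF E) (x : ι → E) :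
    (indep p x).toReal = ∏ i, (p i (x i)).toReal := by
  simp [indep, ENNReal.toReal_prod]

theorem expect_indep_prod (p : ι → PMF E) (f : ι → E → ℂ) :
    expect (indep p) (fun x => ∏ i, f i (x i)) = ∏ i, expect (p i) (f i) := by
  simp only [expect, toReal_indep, Fintype.prod_sum, Complex.real_smul, Complex.ofReal_prod,
    Finset.prod_mul_distrib]

theorem mean_indep_prod (p : ι → PMF E) (f : ι → E → ℝ) :
    mean (indep p) (fun x => ∏ i, f i (x i)) = ∏ i, mean (p i) (f i) := by
  simp only [mean, toReal_indep, Fintype.prod_sum, Finset.prod_mul_distrib]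

theorem mean_indep_apply (p : ι → PMF E) (i : ι) (f : E → ℝ) :
    mean (indep p) (fun x => f (x i)) = mean (p i) f := by
  have := mean_indep_prod p fun j a => if j = i then f a else 1
  simp only [Finset.prod_ite_eq', Finset.mem_univ, if_true] at this
  rw [this, Finset.prod_eq_single i]
  · simp
  · intro j _ hj
    simp [hj, mean_const]
  · simp

theorem mean_indep_apply_mul (p : ι → PMF E) {i j : ι} (hij : i ≠ j) (f g : E → ℝ) :
    mean (indep p) (fun x => f (x i) * g (x j)) = mean (p i) f * mean (p j) g := by
  have := mean_indep_prod p fun l a => (if l = i then f a else 1) * (if l = j then g a else 1)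
  simp only [Finset.prod_mul_distrib, Finset.prod_ite_eq', Finset.mem_univ, if_true] at this
  rw [this, ← Finset.mul_prod_erase _ _ (Finset.mem_univ i),
    ← Finset.mul_prod_erase _ _ (Finset.mem_erase.mpr ⟨hij.symm, Finset.mem_univ j⟩),
    Finset.prod_eq_one]
  · simp [hij, hij.symm]
  · intro l hl
    simp only [Finset.mem_erase, Finset.mem_univ, and_true] at hl
    simp [hl.1, hl.2, mean_const]

/-- A product of sums is a sum of products. This merges resampling and moving into one i.i.d. draw
given the current population. -/
theorem indep_bind_indep (p : ι → PMF E) (κ : E → PMF E) :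
    ((indep p).bind fun y => indep fun i => κ (y i)) = indep fun i => (p i).bind κ := by
  ext x
  simp only [PMF.bind_apply, tsum_fintype, indep, PMF.ofFintype_apply, Fintype.prod_sum,
    Finset.prod_mul_distrib]

/-- The variance of a sum of independent terms. -/
theorem mean_indep_sum_sq (q : PMF E) (f : E → ℝ) (hf : mean q f = 0) :
    mean (indep fun _ : ι => q) (fun x => (∑ i, f (x i)) ^ 2) =
      Fintype.card ι * mean q (fun a => f a ^ 2) := by
  simp only [sq, Finset.sum_mul_sum, mean_sum]
  have : ∀ i : ι, ∑ j, mean (indep fun _ : ι => q) (fun x => f (x i) * f (x j)) =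
      mean q (fun a => f a * f a) := by
    intro i
    rw [Finset.sum_eq_single i]
    · exact mean_indep_apply (fun _ => q) i fun a => f a * f a
    · intro j _ hj
      rw [mean_indep_apply_mul _ hj.symm, hf, zero_mul]
    · simp
  simp [this]

theorem mean_indep_empirical_sq {N : ℕ} [NeZero N] (q : PMF E) (f : E → ℝ) :
    mean (indep fun _ : Fin N => q) (fun x => (empirical f x - mean q f) ^ 2) =
      mean q (fun a => (f a - mean q f) ^ 2) / N := by
  have hN : (N : ℝ) ≠ 0 := Nat.cast_ne_zero.mpr (NeZero.ne N)
  have h := mean_indep_sum_sq (ι := Fin N) q (fun a => f a - mean q f)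
    (by rw [mean_sub, mean_const, sub_self])
  have h2 : ∀ x : Fin N → E, (empirical f x - mean q f) ^ 2 =
      (1 / (N : ℝ) ^ 2) * (∑ i, (f (x i) - mean q f)) ^ 2 := by
    intro x
    simp only [empirical, Finset.sum_sub_distrib, Finset.sum_const, Finset.card_univ,
      Fintype.card_fin, nsmul_eq_mul]
    field_simp
  simp only [h2, mean_const_mul, h, Fintype.card_fin]
  field_simp

end Indep

/-! ### Characteristic functions of sums of independent draws -/

section CharFun

variable {E : Type} [Fintype E]

theorem norm_pow_sub_pow_le_mul {a b : ℂ} (ha : ‖a‖ ≤ 1) (hb : ‖b‖ ≤ 1) (n : ℕ) :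
    ‖a ^ n - b ^ n‖ ≤ n * ‖a - b‖ := by
  induction n with
  | zero => simp
  | succ n ih =>
    have h : a ^ (n + 1) - b ^ (n + 1) = a ^ n * (a - b) + (a ^ n - b ^ n) * b := by ring
    rw [h]
    refine (norm_add_le _ _).trans ?_
    rw [norm_mul, norm_mul, norm_pow]
    have h1 : ‖a‖ ^ n * ‖a - b‖ ≤ 1 * ‖a - b‖ :=
      mul_le_mul_of_nonneg_right (pow_le_one₀ (norm_nonneg _) ha) (norm_nonneg _)
    have h2 : ‖a ^ n - b ^ n‖ * ‖b‖ ≤ (n * ‖a - b‖) * 1 :=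
      mul_le_mul ih hb (norm_nonneg _) (by positivity)
    push_cast
    linarith

theorem norm_exp_mul_I_sub_le (a b : ℝ) :
    ‖Complex.exp (a * Complex.I) - Complex.exp (b * Complex.I)‖ ≤ |a - b| := by
  have h : Complex.exp (a * Complex.I) - Complex.exp (b * Complex.I) =
      Complex.exp (b * Complex.I) * (Complex.exp (Complex.I * ((a - b : ℝ) : ℂ)) - 1) := by
    rw [mul_sub, ← Complex.exp_add, mul_one]
    congr 2
    push_cast
    ring
  rw [h, norm_mul, Complex.norm_exp_ofReal_mul_I, one_mul]
  exact Real.norm_exp_I_mul_ofReal_sub_one_le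

theorem norm_expect_exp_le (q : PMF E) (f : E → ℝ) :
    ‖expect q fun x => Complex.exp (f x * Complex.I)‖ ≤ 1 :=
  (norm_expect_le _ _).trans (mean_le_of_le _ fun _ => (Complex.norm_exp_ofReal_mul_I _).le)

/-- Second-order Taylor expansion of the exponential; the linear term disappears because `f` is
centred under `q`. -/
theorem norm_expect_exp_sub_le (q : PMF E) (f : E → ℝ) {B s : ℝ} (hB : ∀ x, |f x| ≤ B)
    (h0 : mean q f = 0) :
    ‖(expect q fun x => Complex.exp ((s * f x : ℝ) * Complex.I)) -
      ((1 - s ^ 2 * mean q (fun x => f x ^ 2) / 2 : ℝ) : ℂ)‖ ≤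
      (|s| * B) ^ 3 * Real.exp (|s| * B) := by
  have h1 : (expect q fun x => Complex.exp ((s * f x : ℝ) * Complex.I)) -
      ((1 - s ^ 2 * mean q (fun x => f x ^ 2) / 2 : ℝ) : ℂ) =
      expect q fun x => Complex.exp ((s * f x : ℝ) * Complex.I) -
        ∑ m ∈ Finset.range 3, ((s * f x : ℝ) * Complex.I) ^ m / (m.factorial : ℂ) := by
    rw [expect_sub]
    congr 1
    have h2 : ∀ x, ∑ m ∈ Finset.range 3, ((s * f x : ℝ) * Complex.I) ^ m / (m.factorial : ℂ) =
        ((1 - s ^ 2 / 2 * f x ^ 2 : ℝ) : ℂ) + ((s * f x : ℝ) : ℂ) * Complex.I := by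
      intro x
      simp only [Finset.sum_range_succ, Finset.sum_range_zero, Nat.factorial, mul_pow,
        Complex.I_sq]
      push_cast
      ring
    have h3 : ∀ g : E → ℝ, expect q (fun x => ((g x : ℝ) : ℂ)) = ((mean q g : ℝ) : ℂ) := by
      intro g
      simp [expect, mean]
    simp only [h2]
    rw [expect_add, expect_mul_const, h3, h3, mean_sub, mean_const, mean_const_mul,
      mean_const_mul, h0]
    push_cast
    ring
  rw [h1]
  refine (norm_expect_le _ _).trans (mean_le_of_le _ fun x => ?_)
  refine (Complex.norm_exp_sub_sum_le_norm_mul_exp _ _).trans ?_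
  have h4 : ‖((s * f x : ℝ) : ℂ) * Complex.I‖ ≤ |s| * B := by
    rw [norm_mul, Complex.norm_I, mul_one, Complex.norm_real, Real.norm_eq_abs, abs_mul]
    exact mul_le_mul_of_nonneg_left (hB x) (abs_nonneg _)
  have h5 := norm_nonneg (((s * f x : ℝ) : ℂ) * Complex.I)
  have h6 := pow_nonneg (h5.trans h4) 3
  gcongr

/-- Quantitative CLT for i.i.d. terms: both sides are N-th powers of numbers in the unit disc, so
their distance is at most N times that of the bases. The target variance `v` need not be the
variance under `q`, since `q` will be the random law `nextLaw` while `v` is its deterministic limit.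
-/
theorem norm_expect_exp_pow_sub_le (q : PMF E) (f : E → ℝ) {B t v : ℝ} (hB : ∀ x, |f x| ≤ B)
    (hB0 : 0 ≤ B) (h0 : mean q f = 0) (hv : 0 ≤ v) (N : ℕ) [NeZero N] :
    ‖(expect q fun x => Complex.exp ((t / √N * f x : ℝ) * Complex.I)) ^ N -
      ((Real.exp (-(t ^ 2 * v / 2)) : ℝ) : ℂ)‖ ≤
      t ^ 2 / 2 * |mean q (fun x => f x ^ 2) - v| +
        ((|t| * B) ^ 3 * Real.exp (|t| * B) +
          (t ^ 2 * v / 2) ^ 2 * Real.exp (t ^ 2 * v / 2)) / √N := by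
  set m := mean q fun x => f x ^ 2
  set s := t / √N with hs
  have hN : (1 : ℝ) ≤ N := Nat.one_le_cast.mpr (Nat.one_le_iff_ne_zero.mpr (NeZero.ne N))
  have hN1 : 1 ≤ √(N : ℝ) := Real.one_le_sqrt.mpr hN
  have hNN : √(N : ℝ) * √(N : ℝ) = N := Real.mul_self_sqrt (by linarith)
  have hsN : s ^ 2 * N = t ^ 2 := by
    rw [hs, div_pow, Real.sq_sqrt (by linarith)]
    field_simp
  have hst : |s| ≤ |t| := by
    rw [hs, abs_div, abs_of_nonneg (Real.sqrt_nonneg _)]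
    exact div_le_self (abs_nonneg _) hN1
  have hst2 : s ^ 2 ≤ t ^ 2 := sq_le_sq.mpr hst
  set b : ℂ := ((Real.exp (-(s ^ 2 * v / 2)) : ℝ) : ℂ) with hb
  have hbN : ((Real.exp (-(t ^ 2 * v / 2)) : ℝ) : ℂ) = b ^ N := by
    rw [hb, ← Complex.ofReal_pow, ← Real.exp_nat_mul, ← hsN]
    congr 3
    ring
  rw [hbN]
  have hb1 : ‖b‖ ≤ 1 := by
    rw [hb, Complex.norm_real, Real.norm_of_nonneg (Real.exp_pos _).le]
    exact Real.exp_le_one_iff.mpr (by have := mul_nonneg (sq_nonneg s) hv; linarith)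
  refine (norm_pow_sub_pow_le_mul (norm_expect_exp_le q _) hb1 N).trans ?_
  have e1 := norm_expect_exp_sub_le q f (s := s) hB h0
  have e2 : ‖b - ((1 - s ^ 2 * v / 2 : ℝ) : ℂ)‖ ≤
      (s ^ 2 * v / 2) ^ 2 * Real.exp (s ^ 2 * v / 2) := by
    have := Complex.norm_exp_sub_sum_le_norm_mul_exp ((-(s ^ 2 * v / 2) : ℝ) : ℂ) 2
    rw [Complex.norm_real, Real.norm_eq_abs, abs_neg,
      abs_of_nonneg (by have := mul_nonneg (sq_nonneg s) hv; linarith)] at this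
    refine le_of_eq_of_le ?_ this
    rw [hb]
    congr 1
    simp [Finset.sum_range_succ, Complex.ofReal_exp]
    ring
  have e3 : ‖((1 - s ^ 2 * m / 2 : ℝ) : ℂ) - ((1 - s ^ 2 * v / 2 : ℝ) : ℂ)‖ ≤
      s ^ 2 / 2 * |m - v| := by
    rw [← Complex.ofReal_sub, Complex.norm_real, Real.norm_eq_abs]
    have : 1 - s ^ 2 * m / 2 - (1 - s ^ 2 * v / 2) = -(s ^ 2 / 2 * (m - v)) := by ring
    rw [this, abs_neg, abs_mul, abs_of_nonneg (by positivity)]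
  have e4 : ‖(expect q fun x => Complex.exp ((s * f x : ℝ) * Complex.I)) - b‖ ≤
      (|s| * B) ^ 3 * Real.exp (|s| * B) + s ^ 2 / 2 * |m - v| +
        (s ^ 2 * v / 2) ^ 2 * Real.exp (s ^ 2 * v / 2) := by
    rw [norm_sub_rev] at e2
    refine le_trans ?_ (add_le_add (add_le_add e1 e3) e2)
    refine le_trans (le_of_eq ?_) (norm_add₃_le)
    congr 1
    ring
  refine (mul_le_mul_of_nonneg_left e4 (by positivity)).trans ?_
  have g1 : (N : ℝ) * ((|s| * B) ^ 3 * Real.exp (|s| * B)) ≤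
      (|t| * B) ^ 3 * Real.exp (|t| * B) / √N := by
    have : (N : ℝ) * ((|s| * B) ^ 3 * Real.exp (|s| * B)) =
        (|t| * B) ^ 3 * Real.exp (|s| * B) / √N := by
      have aux : ∀ r n e : ℝ, r ≠ 0 → r * r = n →
          n * ((|t| / r * B) ^ 3 * e) = (|t| * B) ^ 3 * e / r := by
        rintro r n e hr rfl
        field_simp
      rw [hs, abs_div, abs_of_nonneg (Real.sqrt_nonneg _)]
      exact aux _ _ _ (by positivity) hNN
    rw [this]
    gcongr
  have g2 : (N : ℝ) * ((s ^ 2 * v / 2) ^ 2 * Real.exp (s ^ 2 * v / 2)) ≤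
      (t ^ 2 * v / 2) ^ 2 * Real.exp (t ^ 2 * v / 2) / √N := by
    have h1 : (N : ℝ) * ((s ^ 2 * v / 2) ^ 2 * Real.exp (s ^ 2 * v / 2)) =
        (t ^ 2 * v / 2) ^ 2 * Real.exp (s ^ 2 * v / 2) / N := by
      rw [← hsN]
      field_simp
    rw [h1]
    have h2 : √(N : ℝ) ≤ N := by nlinarith
    gcongr
  have g3 : (N : ℝ) * (s ^ 2 / 2 * |m - v|) = t ^ 2 / 2 * |m - v| := by
    rw [← hsN]; ring
  rw [add_div]
  linarith

end CharFun

/-! ### The central limit theorem for the particle system -/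

section CLT

variable {E : Type}

theorem empirical_const {N : ℕ} [NeZero N] (c : ℝ) (x : Fin N → E) :
    empirical (fun _ => c) x = c := by
  have : (N : ℝ) ≠ 0 := Nat.cast_ne_zero.mpr (NeZero.ne N)
  simp [empirical, this]

theorem empirical_mono {N : ℕ} {f g : E → ℝ} (h : ∀ a, f a ≤ g a) (x : Fin N → E) :
    empirical f x ≤ empirical g x :=
  div_le_div_of_nonneg_right (Finset.sum_le_sum fun _ _ => h _) (Nat.cast_nonneg _)

theorem toReal_density_mul {μ : ℕ → PMF E} (hμ : ∀ k x, μ k x ≠ 0) (k : ℕ) (x : E) :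
    (μ k x).toReal * (density μ k x).toReal = (μ (k + 1) x).toReal := by
  rw [← ENNReal.toReal_mul, density, ENNReal.mul_div_cancel (hμ _ _) (PMF.apply_ne_top _ _)]

theorem toReal_density_pos {μ : ℕ → PMF E} (hμ : ∀ k x, μ k x ≠ 0) (k : ℕ) (x : E) :
    0 < (density μ k x).toReal :=
  ENNReal.toReal_pos (ENNReal.div_ne_zero.mpr ⟨hμ _ _, PMF.apply_ne_top _ _⟩)
    (ENNReal.div_ne_top (PMF.apply_ne_top _ _) (hμ _ _))

variable [Fintype E]

theorem mean_resampleOne (w : E → ℝ≥0∞) (hw0 : ∀ x, w x ≠ 0) (hw : ∀ x, w x ≠ ∞)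
    {N : ℕ} [NeZero N] (x : Fin N → E) (f : E → ℝ) :
    mean (resampleOne w hw0 hw x) f =
      empirical (fun a => (w a).toReal * f a) x / empirical (fun a => (w a).toReal) x := by
  have hN : (N : ℝ) ≠ 0 := Nat.cast_ne_zero.mpr (NeZero.ne N)
  rw [resampleOne, mean_map]
  simp only [mean, PMF.normalize_apply, tsum_fintype, ENNReal.toReal_mul, ENNReal.toReal_inv,
    ENNReal.toReal_sum fun i _ => hw (x i), empirical]
  rw [div_div_div_cancel_right₀ hN, Finset.sum_div]
  exact Finset.sum_congr rfl fun _ _ => by ring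

variable {μ : ℕ → PMF E} (hμ : ∀ k x, μ k x ≠ 0) (K : ℕ → E → PMF E)

/-- The law of one particle of the next stage given the current population. -/
noncomputable def nextLaw (k : ℕ) {N : ℕ} [NeZero N] (x : Fin N → E) : PMF E :=
  (resampleOne (density μ k)
    (fun _ => ENNReal.div_ne_zero.mpr ⟨hμ _ _, PMF.apply_ne_top _ _⟩)
    (fun _ => ENNReal.div_ne_top (PMF.apply_ne_top _ _) (hμ _ _)) x).bind (K (k + 1))

theorem particles_succ (N : ℕ) [NeZero N] (k : ℕ) :
    particles μ hμ K N (k + 1) =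
      (particles μ hμ K N k).bind fun x => indep fun _ => nextLaw hμ K k x := by
  rw [particles, PMF.bind_bind]
  simp only [indep_bind_indep, nextLaw]

/-- The function `G_{k,k+1} K_{k+1} f`. -/
noncomputable def pull (μ : ℕ → PMF E) (K : ℕ → E → PMF E) (k : ℕ) (f : E → ℝ) (x : E) : ℝ :=
  (density μ k x).toReal * mean (K (k + 1) x) f

theorem mean_nextLaw (k : ℕ) {N : ℕ} [NeZero N] (x : Fin N → E) (f : E → ℝ) :
    mean (nextLaw hμ K k x) f =
      empirical (pull μ K k f) x / empirical (fun a => (density μ k a).toReal) x := by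
  rw [nextLaw, mean_bind]
  exact mean_resampleOne _ _ _ x _

include hμ in
theorem mean_density_mul (k : ℕ) (f : E → ℝ) :
    mean (μ k) (fun x => (density μ k x).toReal * f x) = mean (μ (k + 1)) f := by
  simp only [mean, ← mul_assoc, toReal_density_mul hμ]

include hμ in
theorem mean_density (k : ℕ) : mean (μ k) (fun x => (density μ k x).toReal) = 1 := by
  have := mean_density_mul hμ k fun _ => 1
  simpa [mean_const] using this

include hμ in
theorem exists_le_density (k : ℕ) : ∃ c > 0, ∀ x, c ≤ (density μ k x).toReal := by
  obtain ⟨a⟩ : Nonempty E := (μ 0).support_nonempty.to_subtype.map (↑)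
  obtain ⟨x, -, hx⟩ := Finset.exists_min_image Finset.univ (fun x => (density μ k x).toReal)
    ⟨a, Finset.mem_univ _⟩
  exact ⟨_, toReal_density_pos hμ k x, fun y => hx y (Finset.mem_univ _)⟩

theorem exists_abs_le (f : E → ℝ) : ∃ B, 0 ≤ B ∧ ∀ x, |f x| ≤ B :=
  ⟨∑ x, |f x|, by positivity,
    fun x => Finset.single_le_sum (f := fun x => |f x|) (fun _ _ => abs_nonneg _)
      (Finset.mem_univ x)⟩

variable {M : ℕ}
  (hK : ∀ k < M, ∀ f, mean (μ (k + 1)) (fun x => mean (K (k + 1) x) f) = mean (μ (k + 1)) f)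

include hμ hK in
theorem mean_pull {k : ℕ} (hk : k < M) (f : E → ℝ) :
    mean (μ k) (pull μ K k f) = mean (μ (k + 1)) f := by
  unfold pull
  rw [mean_density_mul hμ, hK k hk]

/-- Centring inside the ratio: when `m` is the limiting mean, the numerator is a particle average
with limit 0, hence small by the induction on stages. -/
theorem mean_nextLaw_sub (k : ℕ) {N : ℕ} [NeZero N] (x : Fin N → E) (f : E → ℝ) (m : ℝ) :
    mean (nextLaw hμ K k x) f - m = empirical (pull μ K k fun y => f y - m) x /
      empirical (fun a => (density μ k a).toReal) x := by
  rw [← mean_nextLaw hμ K, mean_sub, mean_const]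

/-- Mean square convergence of the mean of the conditional law, given the same for particles. -/
theorem mean_nextLaw_sq_le {k : ℕ} {c : ℝ} (hc : 0 < c)
    (hcd : ∀ x, c ≤ (density μ k x).toReal) {N : ℕ} [NeZero N] (x : Fin N → E) (f : E → ℝ)
    (m : ℝ) :
    (mean (nextLaw hμ K k x) f - m) ^ 2 ≤
      1 / c ^ 2 * empirical (pull μ K k fun y => f y - m) x ^ 2 := by
  have h1 : c ≤ empirical (fun a => (density μ k a).toReal) x :=
    (empirical_const c x).symm.trans_le (empirical_mono hcd x)
  rw [mean_nextLaw_sub, div_pow, div_mul_eq_mul_div, one_mul]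
  gcongr

include hK in
/-- Mean square convergence of the particle averages. -/
theorem exists_mean_particles_sq_le {n : ℕ} (hn : n ≤ M) (f : E → ℝ) :
    ∃ C, 0 ≤ C ∧ ∀ (N : ℕ) [NeZero N],
      mean (particles μ hμ K N n) (fun x => (empirical f x - mean (μ n) f) ^ 2) ≤ C / N := by
  induction n generalizing f with
  | zero =>
    refine ⟨mean (μ 0) (fun a => (f a - mean (μ 0) f) ^ 2), mean_nonneg _ fun _ => sq_nonneg _,
      fun N _ => ?_⟩
    rw [particles, mean_indep_empirical_sq]
  | succ k ih =>
    obtain ⟨c, hc, hcd⟩ := exists_le_density hμ k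
    obtain ⟨B, hB0, hB⟩ := exists_abs_le f
    obtain ⟨C, hC0, hC⟩ := ih (Nat.le_of_succ_le hn) (pull μ K k fun y => f y - mean (μ (k + 1)) f)
    refine ⟨2 * B ^ 2 + 2 * (1 / c ^ 2 * C), by positivity, fun N _ => ?_⟩
    have hC' := hC N
    rw [mean_pull hμ K hK hn, mean_sub, mean_const, sub_self] at hC'
    simp only [sub_zero] at hC'
    rw [particles_succ, mean_bind]
    -- The squared error is split into the sampling error given the population, of order 1/N, and
    -- the bias of the conditional mean, controlled at the previous stage.
    have step : ∀ x : Fin N → E, mean (indep fun _ : Fin N => nextLaw hμ K k x)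
        (fun y => (empirical f y - mean (μ (k + 1)) f) ^ 2) ≤
        2 * B ^ 2 / N + 2 * (1 / c ^ 2) *
          empirical (pull μ K k fun y => f y - mean (μ (k + 1)) f) x ^ 2 := by
      intro x
      set q := nextLaw hμ K k x
      have h1 : ∀ y : Fin N → E, (empirical f y - mean (μ (k + 1)) f) ^ 2 ≤
          2 * (empirical f y - mean q f) ^ 2 + 2 * (mean q f - mean (μ (k + 1)) f) ^ 2 := by
        intro y
        nlinarith [sq_nonneg (empirical f y - mean q f - (mean q f - mean (μ (k + 1)) f))]
      refine (mean_mono _ h1).trans ?_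
      rw [mean_add, mean_const, mean_const_mul, mean_indep_empirical_sq, mean_sq_sub_mean]
      have h2 : mean q (fun a => f a ^ 2) ≤ B ^ 2 :=
        mean_le_of_le _ fun a => sq_le_sq' (neg_le_of_abs_le (hB a)) (le_of_abs_le (hB a))
      have h3 := mean_nextLaw_sq_le hμ K hc hcd x f (mean (μ (k + 1)) f)
      have h4 : 2 * ((mean q (fun a => f a ^ 2) - mean q f ^ 2) / N) ≤ 2 * B ^ 2 / N := by
        rw [← mul_div_assoc]
        gcongr
        linarith [sq_nonneg (mean q f)]
      linarith
    refine (mean_mono _ step).trans ?_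
    rw [mean_add, mean_const, mean_const_mul, add_div]
    have := mul_le_mul_of_nonneg_left hC' (by positivity : (0 : ℝ) ≤ 2 * (1 / c ^ 2))
    refine add_le_add le_rfl (this.trans_eq (by ring))

end CLT

/-! ### Fluctuations: the variance recursion and convergence of characteristic functions -/

section CLT

variable {E : Type} [Fintype E]

/-- The semigroup is defined by peeling off its first factor, whereas the induction on the final
stage must peel off the last one. -/
theorem semigroup_succ_last (μ : ℕ → PMF E) (K : ℕ → E → PMF E) (φ : E → ℝ) (k m : ℕ) :
    semigroup μ K φ k (m + 1) = semigroup μ K (pull μ K (k + m) φ) k m := by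
  induction m generalizing k with
  | zero => rfl
  | succ m ih =>
    rw [semigroup, ih (k + 1), semigroup, show k + 1 + m = k + (m + 1) by ring]

theorem expect_indep_exp {N : ℕ} [NeZero N] (q : PMF E) (f : E → ℝ) (t m : ℝ) :
    expect (indep fun _ : Fin N => q)
      (fun y => Complex.exp ((t * (√N * (empirical f y - m)) : ℝ) * Complex.I)) =
      (expect q fun a => Complex.exp ((t / √N * (f a - mean q f) : ℝ) * Complex.I)) ^ N *
        Complex.exp ((t * (√N * (mean q f - m)) : ℝ) * Complex.I) := by
  have hN : (1 : ℝ) ≤ N := Nat.one_le_cast.mpr (Nat.one_le_iff_ne_zero.mpr (NeZero.ne N))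
  have hs : √(N : ℝ) * √(N : ℝ) = N := Real.mul_self_sqrt (by linarith)
  have hs0 : √(N : ℝ) ≠ 0 := by positivity
  have h1 : ∀ y : Fin N → E, t * (√N * (empirical f y - m)) =
      ∑ i, t / √N * (f (y i) - mean q f) + t * (√N * (mean q f - m)) := by
    intro y
    have aux : ∀ r n S c : ℝ, r ≠ 0 → r * r = n →
        t * (r * (S / n - m)) = t / r * (S - n * c) + t * (r * (c - m)) := by
      rintro r n S c hr rfl
      field_simp
      ring
    rw [← Finset.mul_sum, Finset.sum_sub_distrib, Finset.sum_const, Finset.card_univ,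
      Fintype.card_fin, nsmul_eq_mul, empirical]
    exact aux _ _ _ _ hs0 hs
  have h2 : ∀ y : Fin N → E, Complex.exp ((t * (√N * (empirical f y - m)) : ℝ) * Complex.I) =
      (∏ i, Complex.exp ((t / √N * (f (y i) - mean q f) : ℝ) * Complex.I)) *
        Complex.exp ((t * (√N * (mean q f - m)) : ℝ) * Complex.I) := by
    intro y
    rw [h1, ← Complex.exp_sum, ← Complex.exp_add, Complex.ofReal_add, add_mul,
      Complex.ofReal_sum, Finset.sum_mul]
  simp only [h2]
  rw [expect_mul_const, expect_indep_prod (fun _ : Fin N => q)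
    (fun _ a => Complex.exp ((t / √N * (f a - mean q f) : ℝ) * Complex.I))]
  simp

variable {μ : ℕ → PMF E} (hμ : ∀ k x, μ k x ≠ 0) (K : ℕ → E → PMF E)

theorem asympVar_nonneg (n : ℕ) (f : E → ℝ) : 0 ≤ asympVar μ K n f :=
  Finset.sum_nonneg fun _ _ => mean_nonneg _ fun _ => sq_nonneg _

variable {M : ℕ}
  (hK : ∀ k < M, ∀ f, mean (μ (k + 1)) (fun x => mean (K (k + 1) x) f) = mean (μ (k + 1)) f)

include hμ hK in
-- The top term is the fresh sampling variance. The others form the asymptotic variance of the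
-- pulled back function, which is already centred by stationarity.
theorem asympVar_succ {n : ℕ} (hn : n < M) (f : E → ℝ) :
    asympVar μ K (n + 1) f = mean (μ (n + 1)) (fun x => (f x - mean (μ (n + 1)) f) ^ 2) +
      asympVar μ K n (pull μ K n fun y => f y - mean (μ (n + 1)) f) := by
  have h0 : mean (μ n) (pull μ K n fun y => f y - mean (μ (n + 1)) f) = 0 := by
    rw [mean_pull hμ K hK hn, mean_sub, mean_const, sub_self]
  simp only [asympVar, h0, sub_zero]
  rw [Finset.sum_range_succ, add_comm]
  congr 1
  · simp [semigroup]
  · refine Finset.sum_congr rfl fun k hk => ?_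
    have hk' : k ≤ n := Nat.lt_succ_iff.mp (Finset.mem_range.mp hk)
    rw [show n + 1 - k = n - k + 1 by omega, semigroup_succ_last,
      show k + (n - k) = n by omega]

include hK in
/-- Convergence in mean of the averages of the conditional law. -/
theorem exists_mean_abs_nextLaw_sub_le {k : ℕ} (hk : k < M) (f : E → ℝ) :
    ∃ C, 0 ≤ C ∧ ∀ (N : ℕ) [NeZero N], mean (particles μ hμ K N k)
      (fun x => |mean (nextLaw hμ K k x) f - mean (μ (k + 1)) f|) ≤ C / √N := by
  obtain ⟨c, hc, hcd⟩ := exists_le_density hμ k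
  obtain ⟨C, hC0, hC⟩ := exists_mean_particles_sq_le hμ K hK hk.le
    (pull μ K k fun y => f y - mean (μ (k + 1)) f)
  refine ⟨√(1 / c ^ 2 * C), Real.sqrt_nonneg _, fun N _ => ?_⟩
  have hC' := hC N
  rw [mean_pull hμ K hK hk, mean_sub, mean_const, sub_self] at hC'
  simp only [sub_zero] at hC'
  rw [← Real.sqrt_div (by positivity)]
  refine Real.le_sqrt_of_sq_le ((sq_mean_le _ _).trans ?_)
  have h : ∀ x : Fin N → E, |mean (nextLaw hμ K k x) f - mean (μ (k + 1)) f| ^ 2 ≤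
      1 / c ^ 2 * empirical (pull μ K k fun y => f y - mean (μ (k + 1)) f) x ^ 2 := fun x => by
    rw [sq_abs]
    exact mean_nextLaw_sq_le hμ K hc hcd x f _
  refine (mean_mono _ h).trans ?_
  rw [mean_const_mul, mul_div_assoc]
  gcongr

include hK in
/-- Convergence in mean of the variance of the conditional law. -/
theorem exists_mean_abs_var_nextLaw_sub_le {k : ℕ} (hk : k < M) (f : E → ℝ) :
    ∃ C, 0 ≤ C ∧ ∀ (N : ℕ) [NeZero N], mean (particles μ hμ K N k)
      (fun x => |mean (nextLaw hμ K k x) (fun a => (f a - mean (nextLaw hμ K k x) f) ^ 2) -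
        mean (μ (k + 1)) (fun a => (f a - mean (μ (k + 1)) f) ^ 2)|) ≤ C / √N := by
  obtain ⟨B, hB0, hB⟩ := exists_abs_le f
  obtain ⟨C₁, hC₁0, hC₁⟩ := exists_mean_abs_nextLaw_sub_le hμ K hK hk f
  obtain ⟨C₂, hC₂0, hC₂⟩ := exists_mean_abs_nextLaw_sub_le hμ K hK hk fun a => f a ^ 2
  refine ⟨C₂ + 2 * B * C₁, by positivity, fun N _ => ?_⟩
  have hm : ∀ p : PMF E, |mean p f| ≤ B := fun p =>
    (abs_mean_le p f).trans (mean_le_of_le p hB)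
  have h : ∀ x : Fin N → E,
      |mean (nextLaw hμ K k x) (fun a => (f a - mean (nextLaw hμ K k x) f) ^ 2) -
        mean (μ (k + 1)) (fun a => (f a - mean (μ (k + 1)) f) ^ 2)| ≤
      |mean (nextLaw hμ K k x) (fun a => f a ^ 2) - mean (μ (k + 1)) fun a => f a ^ 2| +
        2 * B * |mean (nextLaw hμ K k x) f - mean (μ (k + 1)) f| := by
    intro x
    set a := mean (nextLaw hμ K k x) f
    set b := mean (μ (k + 1)) f
    rw [mean_sq_sub_mean, mean_sq_sub_mean]
    have h1 : |a ^ 2 - b ^ 2| ≤ 2 * B * |a - b| := by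
      rw [show a ^ 2 - b ^ 2 = (a + b) * (a - b) by ring, abs_mul]
      refine mul_le_mul_of_nonneg_right ((abs_add_le a b).trans ?_) (abs_nonneg _)
      linarith [hm (nextLaw hμ K k x), hm (μ (k + 1))]
    refine le_trans (le_of_eq ?_) ((abs_sub _ (a ^ 2 - b ^ 2)).trans (add_le_add le_rfl h1))
    congr 1
    ring
  refine (mean_mono _ h).trans ?_
  rw [mean_add, mean_const_mul, add_div, mul_div_assoc]
  exact add_le_add (hC₂ N) (mul_le_mul_of_nonneg_left (hC₁ N) (by positivity))

include hK in
/-- The fluctuations of the mean of the conditional law are those of the particle average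
of the pulled back function. -/
theorem exists_mean_abs_fluct_sub_le {k : ℕ} (hk : k < M) (f : E → ℝ) (t : ℝ) :
    ∃ C, 0 ≤ C ∧ ∀ (N : ℕ) [NeZero N], mean (particles μ hμ K N k)
      (fun x => |t * (√N * (mean (nextLaw hμ K k x) f - mean (μ (k + 1)) f)) -
        t * (√N * empirical (pull μ K k fun y => f y - mean (μ (k + 1)) f) x)|) ≤ C / √N := by
  obtain ⟨c, hc, hcd⟩ := exists_le_density hμ k
  set h := pull μ K k fun y => f y - mean (μ (k + 1)) f with hh
  set g : E → ℝ := fun a => (density μ k a).toReal with hg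
  obtain ⟨C₁, hC₁0, hC₁⟩ := exists_mean_particles_sq_le hμ K hK hk.le h
  obtain ⟨C₂, hC₂0, hC₂⟩ := exists_mean_particles_sq_le hμ K hK hk.le g
  have h0 : mean (μ k) h = 0 := by rw [hh, mean_pull hμ K hK hk, mean_sub, mean_const, sub_self]
  have g1 : mean (μ k) g = 1 := mean_density hμ k
  rw [h0] at hC₁
  rw [g1] at hC₂
  simp only [sub_zero] at hC₁
  refine ⟨|t| / (2 * c) * (C₁ + C₂), by positivity, fun N _ => ?_⟩
  have hN : (1 : ℝ) ≤ N := Nat.one_le_cast.mpr (Nat.one_le_iff_ne_zero.mpr (NeZero.ne N))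
  have hs : √(N : ℝ) * √(N : ℝ) = N := Real.mul_self_sqrt (by linarith)
  have hs0 : √(N : ℝ) ≠ 0 := by positivity
  have step : ∀ x : Fin N → E,
      |t * (√N * (mean (nextLaw hμ K k x) f - mean (μ (k + 1)) f)) -
        t * (√N * empirical h x)| ≤
      (|t| * √N / (2 * c)) * (empirical h x ^ 2 + (empirical g x - 1) ^ 2) := by
    intro x
    rw [mean_nextLaw_sub, ← hh, ← hg]
    set a := empirical h x
    set b := empirical g x
    have hb : c ≤ b := (empirical_const c x).symm.trans_le (empirical_mono hcd x)
    have hb0 : 0 < b := hc.trans_le hb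
    -- The linearisation error is a product of two quantities of order N^(-1/2), so it is still of
    -- order N^(-1/2) after multiplication by √N.
    have e : t * (√N * (a / b)) - t * (√N * a) = t * √N * (a * (1 - b) / b) := by
      field_simp
    rw [e, abs_mul, abs_mul, abs_of_nonneg (Real.sqrt_nonneg _), abs_div, abs_of_pos hb0,
      abs_mul, div_mul_eq_mul_div, mul_div_assoc (|t| * √N)]
    refine mul_le_mul_of_nonneg_left ?_ (by positivity)
    have h2 : |a| * |1 - b| ≤ (a ^ 2 + (b - 1) ^ 2) / 2 := by
      rw [← sq_abs a, ← sq_abs (b - 1), abs_sub_comm b 1]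
      nlinarith [sq_nonneg (|a| - |1 - b|)]
    calc |a| * |1 - b| / b ≤ (a ^ 2 + (b - 1) ^ 2) / 2 / c := by gcongr
      _ = (a ^ 2 + (b - 1) ^ 2) / (2 * c) := by rw [div_div]
  refine (mean_mono _ step).trans ?_
  rw [mean_const_mul, mean_add]
  have := mul_le_mul_of_nonneg_left (add_le_add (hC₁ N) (hC₂ N))
    (by positivity : (0 : ℝ) ≤ |t| * √N / (2 * c))
  refine this.trans (le_of_eq ?_)
  have aux : ∀ r n : ℝ, r ≠ 0 → r * r = n →
      |t| * r / (2 * c) * (C₁ / n + C₂ / n) = |t| / (2 * c) * (C₁ + C₂) / r := by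
    rintro r n hr rfl
    field_simp
  exact aux _ _ hs0 hs

include hK in
/-- The characteristic function of the fluctuations of the particle averages. -/
theorem exists_norm_expect_particles_sub_le {n : ℕ} (hk : n ≤ M) (f : E → ℝ) (t : ℝ) :
    ∃ C, 0 ≤ C ∧ ∀ (N : ℕ) [NeZero N],
      ‖expect (particles μ hμ K N n) (fun x =>
          Complex.exp ((t * (√N * (empirical f x - mean (μ n) f)) : ℝ) * Complex.I)) -
        ((Real.exp (-(t ^ 2 * asympVar μ K n f / 2)) : ℝ) : ℂ)‖ ≤ C / √N := by
  induction n generalizing f with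
  | zero =>
    obtain ⟨B, hB0, hB⟩ := exists_abs_le fun a => f a - mean (μ 0) f
    set v := mean (μ 0) fun a => (f a - mean (μ 0) f) ^ 2 with hv
    have hv0 : 0 ≤ v := mean_nonneg _ fun _ => sq_nonneg _
    refine ⟨(|t| * B) ^ 3 * Real.exp (|t| * B) +
      (t ^ 2 * v / 2) ^ 2 * Real.exp (t ^ 2 * v / 2), by positivity, fun N _ => ?_⟩
    have hV : asympVar μ K 0 f = v := by simp [asympVar, semigroup, hv]
    have := norm_expect_exp_pow_sub_le (μ 0) (fun a => f a - mean (μ 0) f) (t := t) hB hB0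
      (by rw [mean_sub, mean_const, sub_self]) hv0 N
    rw [← hv, sub_self, abs_zero, mul_zero, zero_add] at this
    rw [particles, expect_indep_exp, hV]
    simpa using this
  | succ k ih =>
    set m := mean (μ (k + 1)) f with hm
    set v := mean (μ (k + 1)) fun a => (f a - m) ^ 2 with hv
    set h := pull μ K k fun y => f y - m with hh
    have hv0 : 0 ≤ v := mean_nonneg _ fun _ => sq_nonneg _
    have h0 : mean (μ k) h = 0 := by rw [hh, mean_pull hμ K hK hk, mean_sub, mean_const, sub_self]
    obtain ⟨B, hB0, hB⟩ := exists_abs_le f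
    obtain ⟨C₁, hC₁0, hC₁⟩ := ih (Nat.le_of_succ_le hk) h
    obtain ⟨C₂, hC₂0, hC₂⟩ := exists_mean_abs_fluct_sub_le hμ K hK hk f t
    obtain ⟨C₃, hC₃0, hC₃⟩ := exists_mean_abs_var_nextLaw_sub_le hμ K hK hk f
    set D := (|t| * (2 * B)) ^ 3 * Real.exp (|t| * (2 * B)) +
      (t ^ 2 * v / 2) ^ 2 * Real.exp (t ^ 2 * v / 2) with hD
    refine ⟨t ^ 2 / 2 * C₃ + D + C₂ + C₁, by positivity, fun N _ => ?_⟩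
    have hC₁' := hC₁ N
    rw [h0] at hC₁'
    simp only [sub_zero] at hC₁'
    set V := asympVar μ K k h with hV
    set bv : ℂ := ((Real.exp (-(t ^ 2 * v / 2)) : ℝ) : ℂ) with hbv
    set bV : ℂ := ((Real.exp (-(t ^ 2 * V / 2)) : ℝ) : ℂ) with hbV
    have hbv1 : ‖bv‖ ≤ 1 := by
      rw [hbv, Complex.norm_real, Real.norm_of_nonneg (Real.exp_pos _).le]
      exact Real.exp_le_one_iff.mpr (by have := mul_nonneg (sq_nonneg t) hv0; linarith)
    have hsplit : ((Real.exp (-(t ^ 2 * asympVar μ K (k + 1) f / 2)) : ℝ) : ℂ) = bV * bv := by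
      rw [asympVar_succ hμ K hK hk, hbv, hbV, ← Complex.ofReal_mul, ← Real.exp_add]
      congr 2
      ring
    rw [hsplit, particles_succ, expect_bind]
    simp only [expect_indep_exp]
    set P := particles μ hμ K N k
    set a : (Fin N → E) → ℂ := fun x => (expect (nextLaw hμ K k x) fun b =>
      Complex.exp ((t / √N * (f b - mean (nextLaw hμ K k x) f) : ℝ) * Complex.I)) ^ N with ha
    set e : (Fin N → E) → ℂ := fun x =>
      Complex.exp ((t * (√N * (mean (nextLaw hμ K k x) f - m)) : ℝ) * Complex.I) with he
    set e' : (Fin N → E) → ℂ := fun x =>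
      Complex.exp ((t * (√N * empirical h x) : ℝ) * Complex.I) with he'
    have p1 : ‖expect P (fun x => (a x - bv) * e x)‖ ≤ (t ^ 2 / 2 * C₃ + D) / √N := by
      refine (norm_expect_le _ _).trans ?_
      have : ∀ x : Fin N → E, ‖(a x - bv) * e x‖ ≤ t ^ 2 / 2 *
          |mean (nextLaw hμ K k x) (fun b => (f b - mean (nextLaw hμ K k x) f) ^ 2) - v| +
          D / √N := by
        intro x
        rw [norm_mul, he, Complex.norm_exp_ofReal_mul_I, mul_one]
        refine norm_expect_exp_pow_sub_le _ (fun b => f b - mean (nextLaw hμ K k x) f)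
          (B := 2 * B) (t := t) (fun b => ?_) (by positivity)
          (by rw [mean_sub, mean_const, sub_self]) hv0 N
        have h1 := (abs_mean_le (nextLaw hμ K k x) f).trans (mean_le_of_le _ hB)
        have h2 := hB b
        exact (abs_sub _ _).trans (by linarith)
      refine (mean_mono _ this).trans ?_
      rw [mean_add, mean_const, mean_const_mul]
      refine (add_le_add (mul_le_mul_of_nonneg_left (hC₃ N)
        (div_nonneg (sq_nonneg t) zero_le_two)) le_rfl).trans_eq ?_
      rw [add_div _ D, mul_div_assoc (t ^ 2 / 2) C₃]
    have p2 : ‖expect P (fun x => e x - e' x)‖ ≤ C₂ / √N := by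
      refine (norm_expect_le _ _).trans ((mean_mono _ fun x => ?_).trans (hC₂ N))
      exact norm_exp_mul_I_sub_le _ _
    -- Three successive replacements: the conditional characteristic function by its Gaussian limit,
    -- the true phase by its linearisation, and the expected phase by its limit from the induction
    -- hypothesis.
    have key : (expect P fun x => a x * e x) - bV * bv =
        expect P (fun x => (a x - bv) * e x) + expect P (fun x => e x - e' x) * bv +
          (expect P e' - bV) * bv := by
      rw [sub_mul, expect_sub, sub_mul, ← expect_mul_const P e bv]
      simp only [sub_mul]
      rw [expect_sub]
      simp only [mul_comm bv]
      ring
    rw [key]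
    refine norm_add₃_le.trans ?_
    rw [norm_mul, norm_mul]
    have q2 := mul_le_mul p2 hbv1 (norm_nonneg _) (div_nonneg hC₂0 (Real.sqrt_nonneg _))
    have q3 := mul_le_mul hC₁' hbv1 (norm_nonneg _) (div_nonneg hC₁0 (Real.sqrt_nonneg _))
    rw [mul_one] at q2 q3
    simp only [add_div] at p1 ⊢
    linarith

include hK in
/-- The central limit theorem for the SMC sampler. -/
theorem hasCLT [MeasurableSpace E] [DiscreteMeasurableSpace E] {n : ℕ} (hn : n ≤ M)
    (f : E → ℝ) : HasCLT μ hμ K n f (asympVar μ K n f).toNNReal where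
  forall_aemeasurable N := Measurable.of_discrete.aemeasurable
  aemeasurable_limit := aemeasurable_id
  tendsto := by
    refine ProbabilityMeasure.tendsto_iff_tendsto_charFun.2 fun t => ?_
    obtain ⟨C, -, hC⟩ := exists_norm_expect_particles_sub_le hμ K hK hn f t
    have h1 : ∀ N : ℕ, charFun ((particles μ hμ K (N + 1) n).toMeasure.map
        fun x => √((N : ℝ) + 1) * (empirical f x - mean (μ n) f)) t =
        expect (particles μ hμ K (N + 1) n) fun x => Complex.exp
          ((t * (√((N + 1 : ℕ) : ℝ) * (empirical f x - mean (μ n) f)) : ℝ) * Complex.I) := by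
      intro N
      rw [charFun_apply_real, integral_map Measurable.of_discrete.aemeasurable
        (by fun_prop), PMF.integral_eq_sum]
      simp only [expect]
      push_cast
      rfl
    have h2 : charFun ((gaussianReal 0 (asympVar μ K n f).toNNReal).map id) t =
        ((Real.exp (-(t ^ 2 * asympVar μ K n f / 2)) : ℝ) : ℂ) := by
      rw [Measure.map_id, charFun_gaussianReal, Real.coe_toNNReal _ (asympVar_nonneg K n f),
        Complex.ofReal_exp]
      push_cast
      congr 1
      ring
    refine (tendsto_congr h1).mpr ?_
    change Tendsto _ atTop (𝓝 (charFun ((gaussianReal 0 (asympVar μ K n f).toNNReal).map id) t))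
    rw [h2, tendsto_iff_norm_sub_tendsto_zero]
    refine squeeze_zero (fun _ => norm_nonneg _) (fun N => hC (N + 1)) ?_
    refine Tendsto.div_atTop tendsto_const_nhds (Real.tendsto_sqrt_atTop.comp ?_)
    exact tendsto_natCast_atTop_atTop.comp (tendsto_add_atTop_nat 1)

end CLT

/-! ### Critical points of the mean-field Potts model at the critical temperature -/

section Critical

theorem betaC_gt : 1.386 < betaC := by
  have := Real.log_two_gt_d9
  unfold betaC
  linarith

theorem betaC_lt : betaC < 1.3864 := by
  have := Real.log_two_lt_d9
  unfold betaC
  linarith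

/-- The critical temperature enters as an exact value here and in `exp_betaC`: these identities put
the critical points at x = 1/4 and x = 1/2 and equalise the free energies of the wells. -/
theorem exp_betaC_half : Real.exp (betaC / 2) = 2 := by
  rw [betaC, mul_div_cancel_left₀ _ two_ne_zero, Real.exp_log two_pos]

theorem exp_betaC : Real.exp betaC = 4 := by
  rw [show betaC = betaC / 2 + betaC / 2 by ring, Real.exp_add, exp_betaC_half]
  norm_num

/-- The function which takes the same value at the three coordinates of a critical point. -/
noncomputable def tilt (s : ℝ) : ℝ := s * Real.exp (-(2 * betaC * s))

theorem hasDerivAt_tilt (s : ℝ) :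
    HasDerivAt tilt ((1 - 2 * betaC * s) * Real.exp (-(2 * betaC * s))) s := by
  have h1 : HasDerivAt (fun s : ℝ => -(2 * betaC * s)) (-(2 * betaC)) s := by
    simpa using ((hasDerivAt_id s).const_mul (2 * betaC)).fun_neg
  convert! (hasDerivAt_id s).mul h1.exp using 1
  simp
  ring

theorem continuous_tilt : Continuous tilt :=
  continuous_iff_continuousAt.mpr fun s => (hasDerivAt_tilt s).continuousAt

/-- The critical points: the colour `c` has proportion `(1 + 2 x) / 3`, the other ones have
proportion `(1 - x) / 3`. -/
noncomputable def crit (c : Fin 3) (x : ℝ) (a : Fin 3) : ℝ :=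
  if a = c then (1 + 2 * x) / 3 else (1 - x) / 3

theorem sum_crit (c : Fin 3) (x : ℝ) : ∑ a, crit c x a = 1 := by
  fin_cases c <;> simp [Fin.sum_univ_three, crit] <;> ring

/-- By Rolle, two distinct points of equal height lie on opposite sides of the only zero 1/(2β) of
the derivative of `tilt`. -/
theorem mul_neg_of_tilt_eq {s t : ℝ} (h : tilt s = tilt t) (hst : s ≠ t) :
    (1 - 2 * betaC * s) * (1 - 2 * betaC * t) < 0 := by
  wlog hlt : s < t generalizing s t
  · rw [mul_comm]
    exact this h.symm hst.symm (lt_of_le_of_ne (not_lt.mp hlt) hst.symm)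
  obtain ⟨ξ, hξ, h0⟩ := exists_hasDerivAt_eq_zero hlt continuous_tilt.continuousOn h
    fun x _ => hasDerivAt_tilt x
  have h1 : 1 - 2 * betaC * ξ = 0 :=
    (mul_eq_zero.mp h0).resolve_right (Real.exp_pos _).ne'
  have hb := betaC_gt
  have h2 : 0 < 1 - 2 * betaC * s := by nlinarith [hξ.1]
  have h3 : 1 - 2 * betaC * t < 0 := by nlinarith [hξ.2]
  exact mul_neg_of_pos_of_neg h2 h3

/-- Three points cannot be pairwise on opposite sides of 1/(2β). Hence a critical point has two
equal coordinates and lies on a symmetry axis. -/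
theorem eq_of_tilt_eq {r s t : ℝ} (h1 : tilt r = tilt s) (h2 : tilt s = tilt t) :
    r = s ∨ s = t ∨ r = t := by
  by_contra! h
  have a := mul_neg_of_tilt_eq h1 h.1
  have b := mul_neg_of_tilt_eq h2 h.2.1
  have c := mul_neg_of_tilt_eq (h1.trans h2) h.2.2
  have := mul_pos_of_neg_of_neg a b
  nlinarith [sq_nonneg (1 - 2 * betaC * s)]

/-- The solutions of the mean-field equation on the symmetry axes. -/
theorem eq_of_meanField {x : ℝ} (h1 : -(1 / 2) < x) (h2 : x < 1)
    (h : (1 + 2 * x) = (1 - x) * Real.exp (2 * betaC * x)) : x = 0 ∨ x = 1 / 4 ∨ x = 1 / 2 := by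
  set G : ℝ → ℝ := fun x => 2 * betaC * x + Real.log (1 - x) - Real.log (1 + 2 * x) with hG
  have hb := betaC_gt
  have hb' := betaC_lt
  have zero_of : ∀ y : ℝ, -(1 / 2) < y → y < 1 →
      (1 + 2 * y) = (1 - y) * Real.exp (2 * betaC * y) → G y = 0 := by
    intro y hy1 hy2 hy
    have : Real.log (1 + 2 * y) = Real.log (1 - y) + 2 * betaC * y := by
      rw [hy, Real.log_mul (by linarith) (Real.exp_pos _).ne', Real.log_exp]
    simp only [hG, this]
    ring
  -- After clearing denominators, the zeros of the derivative of `G` are roots of a quadratic;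
  -- counting these roots bounds the number of zeros of `G`.
  have rolle : ∀ y z : ℝ, -(1 / 2) < y → y < z → z < 1 → G y = 0 → G z = 0 →
      ∃ ξ, y < ξ ∧ ξ < z ∧ 2 * betaC * (1 + ξ - 2 * ξ ^ 2) = 3 := by
    intro y z hy hyz hz hGy hGz
    have hd : ∀ w, -(1 / 2) < w → w < 1 →
        HasDerivAt G (2 * betaC + -1 / (1 - w) - 2 / (1 + 2 * w)) w := by
      intro w hw1 hw2
      have d1 : HasDerivAt (fun x : ℝ => 2 * betaC * x) (2 * betaC) w := by
        simpa using (hasDerivAt_id w).const_mul (2 * betaC)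
      have d2 : HasDerivAt (fun x : ℝ => 1 - x) (-1) w := by
        simpa using (hasDerivAt_id w).const_sub 1
      have d3 : HasDerivAt (fun x : ℝ => 1 + 2 * x) 2 w := by
        simpa using ((hasDerivAt_id w).const_mul 2).const_add 1
      exact (d1.add (d2.log (by linarith))).sub (d3.log (by linarith))
    obtain ⟨ξ, hξ, h0⟩ := exists_hasDerivAt_eq_zero hyz
      (fun w hw => (hd w (by linarith [hw.1]) (by linarith [hw.2])).continuousAt.continuousWithinAt)
      (hGy.trans hGz.symm) fun w hw => hd w (by linarith [hw.1]) (by linarith [hw.2])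
    refine ⟨ξ, hξ.1, hξ.2, ?_⟩
    have e1 : (1 - ξ) ≠ 0 := by linarith [hξ.2]
    have e2 : (1 + 2 * ξ) ≠ 0 := by linarith [hξ.1]
    field_simp at h0
    linarith
  have z0 : G 0 = 0 := zero_of 0 (by norm_num) (by norm_num) (by simp)
  have z1 : G (1 / 4) = 0 := zero_of _ (by norm_num) (by norm_num) (by
    rw [show 2 * betaC * (1 / 4) = betaC / 2 by ring, exp_betaC_half]
    norm_num)
  have z2 : G (1 / 2) = 0 := zero_of _ (by norm_num) (by norm_num) (by
    rw [show 2 * betaC * (1 / 2) = betaC by ring, exp_betaC]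
    norm_num)
  have zx : G x = 0 := zero_of x h1 h2 h
  by_contra! hne
  -- A quadratic has no three roots, which excludes a fourth zero of `G` between 0 and 1/2.
  have three : ∀ a b c : ℝ, a < b → b < c → 2 * betaC * (1 + a - 2 * a ^ 2) = 3 →
      2 * betaC * (1 + b - 2 * b ^ 2) = 3 → 2 * betaC * (1 + c - 2 * c ^ 2) = 3 → False := by
    intro a b c hab hbc ha hb1 hc
    have k1 : betaC * ((b - a) * (1 - 2 * (a + b))) = 0 := by linear_combination (hb1 - ha) / 2
    have k2 : betaC * ((c - b) * (1 - 2 * (b + c))) = 0 := by linear_combination (hc - hb1) / 2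
    have l1 : 1 - 2 * (a + b) = 0 := by
      rcases mul_eq_zero.mp k1 with h | h
      · linarith
      · exact (mul_eq_zero.mp h).resolve_left (by linarith)
    have l2 : 1 - 2 * (b + c) = 0 := by
      rcases mul_eq_zero.mp k2 with h | h
      · linarith
      · exact (mul_eq_zero.mp h).resolve_left (by linarith)
    linarith
  -- As 2β < 3, a root satisfies ξ (1 - 2ξ) > 0; this excludes zeros of `G` outside the interval [0,
  -- 1/2].
  have out : ∀ ξ : ℝ, 2 * betaC * (1 + ξ - 2 * ξ ^ 2) = 3 → 0 < ξ ∧ ξ < 1 / 2 := by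
    intro ξ hξ
    constructor <;> by_contra! hc <;> nlinarith
  rcases lt_or_gt_of_ne hne.1 with hx | hx
  · obtain ⟨ξ, -, h3, h4⟩ := rolle x 0 h1 hx (by norm_num) zx z0
    linarith [(out ξ h4).1]
  rcases lt_or_gt_of_ne hne.2.2 with hx' | hx'
  · rcases lt_or_gt_of_ne hne.2.1 with hy | hy
    · obtain ⟨a, -, a2, a3⟩ := rolle 0 x (by norm_num) hx h2 z0 zx
      obtain ⟨b, b1, b2, b3⟩ := rolle x (1 / 4) h1 hy (by norm_num) zx z1
      obtain ⟨c, c1, -, c3⟩ := rolle (1 / 4) (1 / 2) (by norm_num) (by norm_num) (by norm_num) z1 z2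
      exact three a b c (by linarith) (by linarith) a3 b3 c3
    · obtain ⟨a, -, a2, a3⟩ := rolle 0 (1 / 4) (by norm_num) (by norm_num) (by norm_num) z0 z1
      obtain ⟨b, b1, b2, b3⟩ := rolle (1 / 4) x (by norm_num) hy h2 z1 zx
      obtain ⟨c, c1, -, c3⟩ := rolle x (1 / 2) h1 hx' (by norm_num) zx z2
      exact three a b c (by linarith) (by linarith) a3 b3 c3
  · obtain ⟨ξ, h3, -, h4⟩ := rolle (1 / 2) x (by norm_num) hx' h2 z2 zx
    linarith [(out ξ h4).2]

/-- Two coordinates agree, and the difference between the third one and their common value solves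
the mean-field equation on an axis. Positivity of the coordinates is not assumed: it follows from
the equation and the sum being 1. -/
theorem exists_eq_crit {s : Fin 3 → ℝ} (hs1 : ∑ a, s a = 1)
    (h : ∀ a b, tilt (s a) = tilt (s b)) :
    ∃ c, ∃ x ∈ ({0, 1 / 4, 1 / 2} : Set ℝ), s = crit c x := by
  have main : ∀ a b : ℝ, tilt a = tilt b → a + 2 * b = 1 →
      (a - b) ∈ ({0, 1 / 4, 1 / 2} : Set ℝ) := by
    intro a b hab hsum
    have hab' : a = b * Real.exp (2 * betaC * (a - b)) := by
      have h1 : Real.exp (2 * betaC * (a - b)) =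
          Real.exp (2 * betaC * a) * Real.exp (-(2 * betaC * b)) := by
        rw [← Real.exp_add]; congr 1; ring
      have h2 : Real.exp (-(2 * betaC * a)) * Real.exp (2 * betaC * a) = 1 := by
        rw [← Real.exp_add]; simp
      rw [h1]
      simp only [tilt] at hab
      linear_combination (Real.exp (2 * betaC * a)) * hab - a * h2
    have hpos : 0 < b := by
      by_contra! hb
      nlinarith [Real.exp_pos (2 * betaC * (a - b))]
    have hpos' : 0 < a := by
      rw [hab']
      positivity
    have := eq_of_meanField (x := a - b) (by linarith) (by linarith)
      (by linear_combination 3 * hab' + (Real.exp (2 * betaC * (a - b)) - 1) * hsum)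
    simpa using this
  rw [Fin.sum_univ_three] at hs1
  rcases eq_of_tilt_eq (h 0 1) (h 1 2) with e | e | e
  · refine ⟨2, s 2 - s 1, main _ _ (h 2 1) (by linarith), funext fun a => ?_⟩
    fin_cases a <;> simp [crit] <;> linarith
  · refine ⟨0, s 0 - s 1, main _ _ (h 0 1) (by linarith), funext fun a => ?_⟩
    fin_cases a <;> simp [crit] <;> linarith
  · refine ⟨1, s 1 - s 0, main _ _ (h 1 0) (by linarith), funext fun a => ?_⟩
    fin_cases a <;> simp [crit] <;> linarith

/-- The sum of the squared differences of the tilts of the coordinates. -/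
noncomputable def defect (s : Fin 3 → ℝ) : ℝ := ∑ a, ∑ b, (tilt (s a) - tilt (s b)) ^ 2

theorem sq_le_defect (s : Fin 3 → ℝ) (a b : Fin 3) :
    (tilt (s a) - tilt (s b)) ^ 2 ≤ defect s :=
  (Finset.single_le_sum (f := fun b => (tilt (s a) - tilt (s b)) ^ 2)
    (fun _ _ => sq_nonneg _) (Finset.mem_univ b)).trans
    (Finset.single_le_sum (f := fun a => ∑ b, (tilt (s a) - tilt (s b)) ^ 2)
      (fun _ _ => Finset.sum_nonneg fun _ _ => sq_nonneg _) (Finset.mem_univ a))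

theorem defect_nonneg (s : Fin 3 → ℝ) : 0 ≤ defect s :=
  Finset.sum_nonneg fun _ _ => Finset.sum_nonneg fun _ _ => sq_nonneg _

theorem continuous_defect : Continuous defect := by
  unfold defect
  exact continuous_finsetSum _ fun a _ => continuous_finsetSum _ fun b _ =>
    ((continuous_tilt.comp (continuous_apply a)).sub
      (continuous_tilt.comp (continuous_apply b))).pow 2

theorem tilt_crit (c : Fin 3) {x : ℝ} (hx : x ∈ ({0, 1 / 4, 1 / 2} : Set ℝ)) (a b : Fin 3) :
    tilt (crit c x a) = tilt (crit c x b) := by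
  have key : tilt ((1 + 2 * x) / 3) = tilt ((1 - x) / 3) := by
    have e : Real.exp (-(2 * betaC * ((1 - x) / 3))) =
        Real.exp (-(2 * betaC * ((1 + 2 * x) / 3))) * Real.exp (2 * betaC * x) := by
      rw [← Real.exp_add]; congr 1; ring
    simp only [tilt, e]
    rcases hx with rfl | rfl | rfl
    · simp
    · rw [show 2 * betaC * (1 / 4) = betaC / 2 by ring, exp_betaC_half]; ring
    · rw [show 2 * betaC * (1 / 2) = betaC by ring, exp_betaC]; ring
  unfold crit
  split_ifs <;> simp [key]

/-- Nondegeneracy of the critical points. -/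
theorem nondegenerate {x : ℝ} (hx : x ∈ ({0, 1 / 4, 1 / 2} : Set ℝ)) :
    deriv tilt ((1 - x) / 3) ≠ 0 ∧
      2 * deriv tilt ((1 + 2 * x) / 3) + deriv tilt ((1 - x) / 3) ≠ 0 := by
  have hb := betaC_gt
  have hb' := betaC_lt
  have e : Real.exp (-(2 * betaC * ((1 - x) / 3))) =
      Real.exp (-(2 * betaC * ((1 + 2 * x) / 3))) * Real.exp (2 * betaC * x) := by
    rw [← Real.exp_add]; congr 1; ring
  have hp := Real.exp_pos (-(2 * betaC * ((1 + 2 * x) / 3)))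
  rw [(hasDerivAt_tilt _).deriv, (hasDerivAt_tilt _).deriv, e]
  generalize Real.exp (-(2 * betaC * ((1 + 2 * x) / 3))) = p at *
  rcases hx with rfl | rfl | rfl
  · simp only [mul_zero, Real.exp_zero]
    constructor <;> apply ne_of_gt <;> nlinarith
  · rw [show 2 * betaC * (1 / 4) = betaC / 2 by ring, exp_betaC_half]
    refine ⟨ne_of_gt (by nlinarith), ne_of_lt (by nlinarith)⟩
  · rw [show 2 * betaC * (1 / 2) = betaC by ring, exp_betaC]
    refine ⟨ne_of_gt (by nlinarith), ne_of_gt (by nlinarith)⟩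

/-- Inverse function heuristics: the map `Θ`, made of the tilt differences and the constraint on the
sum, vanishes at the critical point and has injective derivative there. So the distance is O(‖Θ‖),
and ‖Θ‖² is at most the defect on the simplex. The two conditions of `nondegenerate` are exactly
what kills the kernel. -/
theorem exists_dist_le_near_crit (c : Fin 3) {x : ℝ} (hx : x ∈ ({0, 1 / 4, 1 / 2} : Set ℝ)) :
    ∃ C, ∀ᶠ s in 𝓝 (crit c x), ∑ a, s a = 1 →
      ∑ a, (s a - crit c x a) ^ 2 ≤ C * defect s := by
  set z := crit c x with hz
  set Θ : (Fin 3 → ℝ) → Fin 3 → ℝ := fun s a =>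
    if a = c then ∑ b, s b - 1 else tilt (s a) - tilt (s c) with hΘ
  let L : (Fin 3 → ℝ) →L[ℝ] Fin 3 → ℝ := ContinuousLinearMap.pi fun a =>
    if a = c then ∑ b, ContinuousLinearMap.proj (R := ℝ) (φ := fun _ : Fin 3 => ℝ) b
    else deriv tilt (z a) • ContinuousLinearMap.proj (R := ℝ) (φ := fun _ : Fin 3 => ℝ) a -
      deriv tilt (z c) • ContinuousLinearMap.proj (R := ℝ) (φ := fun _ : Fin 3 => ℝ) c
  have hderiv : HasFDerivAt Θ L z := by
    rw [hasFDerivAt_pi']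
    intro a
    have hcoord : ∀ b, HasFDerivAt (fun s : Fin 3 → ℝ => tilt (s b))
        (deriv tilt (z b) • ContinuousLinearMap.proj (R := ℝ) (φ := fun _ : Fin 3 => ℝ) b) z :=
      fun b => HasDerivAt.comp_hasFDerivAt (h₂ := tilt) (f := fun s : Fin 3 → ℝ => s b) z
        (hasDerivAt_tilt (z b)).differentiableAt.hasDerivAt (hasFDerivAt_apply b z)
    by_cases h : a = c
    · have : HasFDerivAt (fun s : Fin 3 → ℝ => ∑ b, s b - 1)
          (∑ b, ContinuousLinearMap.proj (R := ℝ) (φ := fun _ : Fin 3 => ℝ) b) z :=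
        (HasFDerivAt.fun_sum fun b _ => hasFDerivAt_apply b z).sub_const 1
      simpa [hΘ, L, h, ContinuousLinearMap.proj_pi] using this
    · simpa [hΘ, L, h, ContinuousLinearMap.proj_pi] using (hcoord a).fun_sub (hcoord c)
  obtain ⟨nd1, nd2⟩ := nondegenerate hx
  have hinj : LinearMap.ker (L : (Fin 3 → ℝ) →ₗ[ℝ] Fin 3 → ℝ) = ⊥ := by
    rw [LinearMap.ker_eq_bot']
    intro d hd
    have hzc : z c = (1 + 2 * x) / 3 := by simp [hz, crit]
    have hza : ∀ a, a ≠ c → z a = (1 - x) / 3 := fun a ha => by simp [hz, crit, ha]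
    set p := deriv tilt ((1 - x) / 3)
    set q := deriv tilt ((1 + 2 * x) / 3)
    have h1 : ∑ b, d b = 0 := by
      simpa [L] using congrFun hd c
    have h2 : ∀ a, a ≠ c → p * d a = q * d c := by
      intro a ha
      have := congrFun hd a
      simp only [L, ContinuousLinearMap.coe_coe, ContinuousLinearMap.pi_apply, ha, if_false,
        hzc, hza a ha] at this
      simpa [sub_eq_zero] using this
    have h3 : p * d c + 2 * (q * d c) = 0 := by
      have e : ∑ b, p * d b = 0 := by rw [← Finset.mul_sum, h1, mul_zero]
      rw [← Finset.add_sum_erase _ _ (Finset.mem_univ c),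
        Finset.sum_congr rfl fun a ha => h2 a (Finset.ne_of_mem_erase ha)] at e
      simpa [Finset.card_erase_of_mem] using e
    have h4 : d c = 0 := by
      have : (2 * q + p) * d c = 0 := by linear_combination h3
      exact (mul_eq_zero.mp this).resolve_left nd2
    funext a
    by_cases ha : a = c
    · rw [ha, h4]; rfl
    · have := h2 a ha
      rw [h4, mul_zero] at this
      exact (mul_eq_zero.mp this).resolve_left nd1
  obtain ⟨K, -, hK⟩ := LinearMap.exists_antilipschitzWith _ hinj
  obtain ⟨C, hC⟩ := (HasFDerivAtFilter.isTheta_sub hderiv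
    (hK.isInducing L.continuous)).isBigO_symm.bound
  rw [prod_pure, eventually_map] at hC
  refine ⟨3 * C ^ 2, hC.mono fun s hs hs1 => ?_⟩
  have hΘz : Θ z = 0 := by
    funext a
    by_cases h : a = c
    · simp [hΘ, h, hz, sum_crit]
    · simp [hΘ, h, hz, tilt_crit c hx a c]
  rw [hΘz, sub_zero] at hs
  have hΘs : ‖Θ s‖ ≤ √(defect s) := by
    rw [pi_norm_le_iff_of_nonneg (Real.sqrt_nonneg _)]
    intro a
    by_cases h : a = c
    · simp [hΘ, h, hs1]
    · simp only [hΘ, h, if_false, Real.norm_eq_abs]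
      exact Real.abs_le_sqrt (sq_le_defect s a c)
  have hsq : ∀ a, (s a - z a) ^ 2 ≤ C ^ 2 * defect s := by
    intro a
    have h1 : |s a - z a| ≤ ‖s - z‖ := by
      simpa using norm_le_pi_norm (s - z) a
    have h2 : |s a - z a| ≤ |C| * √(defect s) :=
      h1.trans (hs.trans (mul_le_mul (le_abs_self C) hΘs (norm_nonneg _) (abs_nonneg C)))
    calc (s a - z a) ^ 2 = |s a - z a| ^ 2 := (sq_abs _).symm
      _ ≤ (|C| * √(defect s)) ^ 2 := by gcongr
      _ = C ^ 2 * defect s := by rw [mul_pow, sq_abs, Real.sq_sqrt (defect_nonneg s)]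
  calc ∑ a, (s a - z a) ^ 2 ≤ ∑ _a : Fin 3, C ^ 2 * defect s :=
        Finset.sum_le_sum fun a _ => hsq a
    _ = 3 * C ^ 2 * defect s := by simp; ring

/-- The distance to the critical points is controlled by the defect. -/
theorem exists_dist_crit_le : ∃ C, 0 < C ∧ ∀ s : Fin 3 → ℝ, (∀ a, 0 ≤ s a) → ∑ a, s a = 1 →
    ∃ c, ∃ x ∈ ({0, 1 / 4, 1 / 2} : Set ℝ),
      ∑ a, (s a - crit c x a) ^ 2 ≤ C * defect s := by
  have hcomp : IsCompact (stdSimplex ℝ (Fin 3)) := isCompact_stdSimplex ℝ (Fin 3)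
  obtain ⟨C, hC⟩ : ∃ C : ℝ, ∀ s ∈ stdSimplex ℝ (Fin 3), ∃ c, ∃ x ∈ ({0, 1 / 4, 1 / 2} : Set ℝ),
      ∑ a, (s a - crit c x a) ^ 2 ≤ C * defect s := by
    refine hcomp.induction_on (p := fun T => ∃ C : ℝ, ∀ s ∈ T, ∃ c,
      ∃ x ∈ ({0, 1 / 4, 1 / 2} : Set ℝ), ∑ a, (s a - crit c x a) ^ 2 ≤ C * defect s) ?_ ?_ ?_ ?_
    · exact ⟨0, fun s hs => hs.elim⟩
    · rintro S T hST ⟨C, hC⟩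
      exact ⟨C, fun s hs => hC s (hST hs)⟩
    · rintro S T ⟨C₁, h₁⟩ ⟨C₂, h₂⟩
      refine ⟨max C₁ C₂, fun s hs => ?_⟩
      rcases hs with hs | hs
      · obtain ⟨c, x, hx, h⟩ := h₁ s hs
        exact ⟨c, x, hx, h.trans
          (mul_le_mul_of_nonneg_right (le_max_left _ _) (defect_nonneg s))⟩
      · obtain ⟨c, x, hx, h⟩ := h₂ s hs
        exact ⟨c, x, hx, h.trans
          (mul_le_mul_of_nonneg_right (le_max_right _ _) (defect_nonneg s))⟩
    · intro s hs
      by_cases h0 : defect s = 0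
      · have heq : ∀ a b, tilt (s a) = tilt (s b) := by
          intro a b
          have := sq_le_defect s a b
          rw [h0] at this
          exact sub_eq_zero.mp (pow_eq_zero_iff two_ne_zero |>.mp
            (le_antisymm this (sq_nonneg _)))
        obtain ⟨c, x, hx, rfl⟩ := exists_eq_crit hs.2 heq
        obtain ⟨C, hC⟩ := exists_dist_le_near_crit c hx
        exact ⟨_, inter_mem_nhdsWithin _ hC, C, fun s hs => ⟨c, x, hx, hs.2 hs.1.2⟩⟩
      · have hpos : 0 < defect s := lt_of_le_of_ne (defect_nonneg s) (Ne.symm h0)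
        -- Near a non-critical point the defect is bounded below, so any fixed critical point
        -- serves, here `crit 0 0`.
        have hev : ∀ᶠ t in 𝓝 s, defect s / 2 < defect t ∧ ∑ a, (t a - crit 0 0 a) ^ 2 <
            ∑ a, (s a - crit 0 0 a) ^ 2 + 1 :=
          (continuous_defect.continuousAt.eventually_const_lt (by linarith)).and
            ((by fun_prop : Continuous fun t : Fin 3 → ℝ =>
              ∑ a, (t a - crit 0 0 a) ^ 2).continuousAt.eventually_lt_const (by linarith))
        refine ⟨_, mem_nhdsWithin_of_mem_nhds hev,
          (∑ a, (s a - crit 0 0 a) ^ 2 + 1) / (defect s / 2), fun t ht => ⟨0, 0, by simp, ?_⟩⟩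
        have hA : 0 ≤ ∑ a, (s a - crit 0 0 a) ^ 2 := Finset.sum_nonneg fun _ _ => sq_nonneg _
        refine ht.2.le.trans ?_
        rw [div_mul_eq_mul_div, le_div_iff₀ (by linarith)]
        exact mul_le_mul_of_nonneg_left ht.1.le (by linarith)
  refine ⟨max C 1, by positivity, fun s h0 h1 => ?_⟩
  obtain ⟨c, x, hx, h⟩ := hC s ⟨h0, h1⟩
  exact ⟨c, x, hx, h.trans (mul_le_mul_of_nonneg_right (le_max_left _ _) (defect_nonneg s))⟩

end Critical

/-! ### The ground state estimate for the Glauber Dirichlet form -/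

section Lyapunov

variable {k : ℕ}

theorem ratio_eq_sum (σ : Spins k) (c : Fin 3) :
    ratio σ c = (∑ j, if σ j = c then (1 : ℝ) else 0) / k := by
  rw [ratio, Finset.sum_boole]

theorem ratio_nonneg (σ : Spins k) (c : Fin 3) : 0 ≤ ratio σ c := by
  unfold ratio
  positivity

/-- A sum over the spins of a function of their colours. -/
theorem sum_comp_eq (σ : Spins k) (F : Fin 3 → ℝ) :
    ∑ i, F (σ i) = k * ∑ a, ratio σ a * F a := by
  rcases Nat.eq_zero_or_pos k with rfl | hk
  · simp
  have hk' : (k : ℝ) ≠ 0 := by positivity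
  have h1 : ∀ a, ratio σ a * F a = (∑ i, if σ i = a then F a else 0) / k := by
    intro a
    rw [ratio_eq_sum, div_mul_eq_mul_div, Finset.sum_mul]
    simp
  simp only [h1]
  rw [← Finset.sum_div, Finset.sum_comm]
  simp
  field_simp

theorem sum_ratio [NeZero k] (σ : Spins k) : ∑ c, ratio σ c = 1 := by
  have h := sum_comp_eq σ fun _ => 1
  have hk : (k : ℝ) ≠ 0 := Nat.cast_ne_zero.mpr (NeZero.ne k)
  simp only [Finset.sum_const, Finset.card_univ, Fintype.card_fin, nsmul_eq_mul, mul_one] at h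
  exact (mul_left_cancel₀ hk (by rw [mul_one]; exact h)).symm

theorem ratio_le_one (σ : Spins k) (c : Fin 3) : ratio σ c ≤ 1 := by
  rcases Nat.eq_zero_or_pos k with rfl | hk
  · simp [ratio]
  · have : NeZero k := ⟨hk.ne'⟩
    exact (Finset.single_le_sum (fun a _ => ratio_nonneg σ a) (Finset.mem_univ c)).trans_eq
      (sum_ratio σ)

/-- The number of spins of colour `c` other than the spin `i`, divided by `k`. -/
noncomputable def others (σ : Spins k) (i : Fin k) (c : Fin 3) : ℝ :=
  ratio σ c - if σ i = c then 1 / (k : ℝ) else 0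

theorem others_eq_sum (σ : Spins k) (i : Fin k) (c : Fin 3) :
    others σ i c = (∑ j ∈ Finset.univ.erase i, if σ j = c then (1 : ℝ) else 0) / k := by
  rw [others, ratio_eq_sum, ← Finset.add_sum_erase _ _ (Finset.mem_univ i), add_div]
  split_ifs <;> simp

theorem others_update (σ : Spins k) (i : Fin k) (b c : Fin 3) :
    others (Function.update σ i b) i c = others σ i c := by
  simp only [others_eq_sum]
  congr 1
  refine Finset.sum_congr rfl fun j hj => ?_
  rw [Function.update_of_ne (Finset.ne_of_mem_erase hj)]

theorem others_le_one (σ : Spins k) (i : Fin k) (c : Fin 3) : others σ i c ≤ 1 := by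
  have := ratio_le_one σ c
  unfold others
  split_ifs
  · have : (0 : ℝ) ≤ 1 / k := by positivity
    linarith
  · linarith

theorem others_nonneg (σ : Spins k) (i : Fin k) (c : Fin 3) : 0 ≤ others σ i c := by
  rw [others_eq_sum]
  refine div_nonneg (Finset.sum_nonneg fun _ _ => ?_) (Nat.cast_nonneg _)
  split_ifs <;> norm_num

/-- The part of the Gibbs weight which does not depend on the spin `i`. -/
noncomputable def restWeight (σ : Spins k) (i : Fin k) : ℝ :=
  Real.exp (k * betaC * (∑ c, others σ i c ^ 2 + 1 / (k : ℝ) ^ 2))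

theorem restWeight_update (σ : Spins k) (i : Fin k) (b : Fin 3) :
    restWeight (Function.update σ i b) i = restWeight σ i := by
  simp only [restWeight, others_update]

/-- Expanding the squares isolates the dependence on the spin `i`: its conditional law given the
others has weights exp(2β · `others`), and these weights lie between 1 and 16. -/
theorem gibbsWeight_eq [NeZero k] (σ : Spins k) (i : Fin k) :
    gibbsWeight betaC σ = restWeight σ i * Real.exp (2 * betaC * others σ i (σ i)) := by
  have hk : (k : ℝ) ≠ 0 := Nat.cast_ne_zero.mpr (NeZero.ne k)
  rw [restWeight, ← Real.exp_add, gibbsWeight]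
  congr 1
  have h : ∀ c, ratio σ c = others σ i c + if σ i = c then 1 / (k : ℝ) else 0 := fun c => by
    rw [others]; ring
  have h2 : ∑ c, ratio σ c ^ 2 =
      ∑ c, others σ i c ^ 2 + 2 / k * others σ i (σ i) + 1 / (k : ℝ) ^ 2 := by
    have : ∀ c, ratio σ c ^ 2 = others σ i c ^ 2 +
        ((if σ i = c then 2 / k * others σ i c else 0) + if σ i = c then 1 / (k : ℝ) ^ 2 else 0) := by
      intro c
      rw [h c]
      split_ifs
      · field_simp; ring
      · ring
    simp only [this, Finset.sum_add_distrib, Finset.sum_ite_eq, Finset.mem_univ, if_true]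
    ring
  rw [h2]
  field_simp
  ring

/-- The partition function. -/
noncomputable def partition (k : ℕ) : ℝ := ∑ σ : Spins k, gibbsWeight betaC σ

theorem partition_pos (k : ℕ) : 0 < partition k :=
  Finset.sum_pos (fun _ _ => Real.exp_pos _) ⟨fun _ => 0, Finset.mem_univ _⟩

theorem toReal_potts (σ : Spins k) :
    (potts betaC k σ).toReal = gibbsWeight betaC σ / partition k := by
  rw [potts, PMF.normalize_apply, tsum_fintype, ENNReal.toReal_mul, ENNReal.toReal_inv,
    ENNReal.toReal_sum fun _ _ => ENNReal.ofReal_ne_top, div_eq_mul_inv]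
  simp only [ENNReal.toReal_ofReal (Real.exp_pos _).le, gibbsWeight, partition]

/-- Exchanging the old and the new colour of the spin `i`. -/
theorem sum_update_comm (i : Fin k) (H : Spins k → Fin 3 → ℝ) :
    ∑ σ : Spins k, ∑ b, H (Function.update σ i b) (σ i) = ∑ σ : Spins k, ∑ b, H σ b := by
  let e : Spins k × Fin 3 → Spins k × Fin 3 := fun p => (Function.update p.1 i p.2, p.1 i)
  have he : Function.Involutive e := fun p => by simp [e]
  rw [← Fintype.sum_prod_type', ← Fintype.sum_prod_type']
  exact Equiv.sum_comp he.toPerm fun p => H p.1 p.2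

/-- A Dirichlet form comparable to that of the Glauber dynamics. -/
noncomputable def dform (w : Spins k → ℝ) : ℝ :=
  mean (potts betaC k) fun σ => ∑ i, ∑ b, (w σ - w (Function.update σ i b)) ^ 2

/-- The difference of the two sides is the square e^(-φ) (e^φ x - y)². -/
theorem ground_state_pointwise (x y φ : ℝ) :
    (1 - Real.exp φ) * x ^ 2 + (1 - Real.exp (-φ)) * y ^ 2 ≤ (x - y) ^ 2 := by
  have h1 : Real.exp φ * Real.exp (-φ) = 1 := by rw [← Real.exp_add]; simp
  have h2 := Real.exp_pos φ
  have h3 := Real.exp_pos (-φ)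
  have : 0 ≤ Real.exp (-φ) * (Real.exp φ * x - y) ^ 2 := by positivity
  nlinarith

theorem exp_two_betaC : Real.exp (2 * betaC) = 16 := by
  rw [two_mul, Real.exp_add, exp_betaC]
  norm_num

theorem exp_two_betaC_mul_le {x : ℝ} (hx : x ≤ 1) : Real.exp (2 * betaC * x) ≤ 16 := by
  rw [← exp_two_betaC]
  have := betaC_gt
  exact Real.exp_le_exp.mpr (by nlinarith)

/-- The ground state representation with an antisymmetric function `φ` on the edges. -/
theorem ground_state [NeZero k] (w : Spins k → ℝ) (φ : Spins k → Fin k → Fin 3 → ℝ)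
    (hφ : ∀ σ i b, φ (Function.update σ i b) i (σ i) = -φ σ i b) :
    mean (potts betaC k) (fun σ => w σ ^ 2 *
      ∑ i, ∑ b, Real.exp (2 * betaC * others σ i b) * (1 - Real.exp (φ σ i b))) ≤
      8 * dform w := by
  set κ : Spins k → Fin k → Fin 3 → ℝ := fun σ i b =>
    (potts betaC k σ).toReal * Real.exp (2 * betaC * others σ i b) with hκ
  -- Detailed balance for the unnormalised heat bath rates exp(2β · `others`).
  have hsymm : ∀ σ i b, κ (Function.update σ i b) i (σ i) = κ σ i b := by
    intro σ i b
    simp only [hκ, toReal_potts, gibbsWeight_eq _ i, others_update, restWeight_update,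
      Function.update_self]
    ring
  have hκ0 : ∀ σ i b, 0 ≤ κ σ i b := fun σ i b =>
    mul_nonneg ENNReal.toReal_nonneg (Real.exp_pos _).le
  have h1 : ∑ i, ∑ σ, ∑ b, κ σ i b * (w σ - w (Function.update σ i b)) ^ 2 ≤ 16 * dform w := by
    rw [Finset.sum_comm, dform, mean, Finset.mul_sum]
    refine Finset.sum_le_sum fun σ _ => ?_
    simp only [Finset.mul_sum]
    refine Finset.sum_le_sum fun i _ => Finset.sum_le_sum fun b _ => ?_
    have := exp_two_betaC_mul_le (others_le_one σ i b)
    have h0 : 0 ≤ (potts betaC k σ).toReal := ENNReal.toReal_nonneg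
    calc κ σ i b * (w σ - w (Function.update σ i b)) ^ 2
        ≤ (potts betaC k σ).toReal * 16 * (w σ - w (Function.update σ i b)) ^ 2 := by
          simp only [hκ]; gcongr
      _ = _ := by ring
  have h2 : ∑ i, ∑ σ, ∑ b, κ σ i b * ((1 - Real.exp (φ σ i b)) * w σ ^ 2) +
      ∑ i, ∑ σ, ∑ b, κ σ i b * ((1 - Real.exp (φ σ i b)) * w σ ^ 2) ≤
      ∑ i, ∑ σ, ∑ b, κ σ i b * (w σ - w (Function.update σ i b)) ^ 2 := by
    rw [← Finset.sum_add_distrib]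
    refine Finset.sum_le_sum fun i _ => ?_
    -- Each edge is counted once from either end, which pairs `φ` with `-φ` as the pointwise
    -- inequality requires. This doubling turns the factor 16 into 8.
    nth_rewrite 2 [← sum_update_comm i]
    rw [← Finset.sum_add_distrib]
    refine Finset.sum_le_sum fun σ _ => ?_
    rw [← Finset.sum_add_distrib]
    refine Finset.sum_le_sum fun b _ => ?_
    rw [hsymm, hφ, ← mul_add]
    exact mul_le_mul_of_nonneg_left (ground_state_pointwise _ _ _) (hκ0 _ _ _)
  have h3 : mean (potts betaC k) (fun σ => w σ ^ 2 *
      ∑ i, ∑ b, Real.exp (2 * betaC * others σ i b) * (1 - Real.exp (φ σ i b))) =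
      ∑ i, ∑ σ, ∑ b, κ σ i b * ((1 - Real.exp (φ σ i b)) * w σ ^ 2) := by
    rw [Finset.sum_comm, mean]
    refine Finset.sum_congr rfl fun σ _ => ?_
    simp only [Finset.mul_sum]
    refine Finset.sum_congr rfl fun i _ => Finset.sum_congr rfl fun b _ => ?_
    simp only [hκ]
    ring
  rw [h3]
  linarith

theorem abs_tilt_le {s : ℝ} (h0 : 0 ≤ s) (h1 : s ≤ 1) : |tilt s| ≤ 1 := by
  have hb := betaC_gt
  have h2 : Real.exp (-(2 * betaC * s)) ≤ 1 := Real.exp_le_one_iff.mpr (by nlinarith)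
  have h3 := Real.exp_pos (-(2 * betaC * s))
  rw [tilt, abs_of_nonneg (by positivity)]
  nlinarith

theorem abs_tilt_sub_le {s t : ℝ} (hs : s ∈ Set.Icc (0 : ℝ) 1) (ht : t ∈ Set.Icc (0 : ℝ) 1) :
    |tilt s - tilt t| ≤ 4 * |s - t| := by
  have := Convex.norm_image_sub_le_of_norm_hasDerivWithin_le (f := tilt) (C := 4)
    (s := Set.Icc (0 : ℝ) 1) (fun x _ => (hasDerivAt_tilt x).hasDerivWithinAt) (fun x hx => ?_)
    (convex_Icc 0 1) ht hs
  · simpa [Real.norm_eq_abs] using this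
  · have hb := betaC_gt
    have hb' := betaC_lt
    have h2 : Real.exp (-(2 * betaC * x)) ≤ 1 := Real.exp_le_one_iff.mpr (by nlinarith [hx.1])
    have h3 := Real.exp_pos (-(2 * betaC * x))
    have h4 : |1 - 2 * betaC * x| ≤ 4 := abs_le.mpr ⟨by nlinarith [hx.1, hx.2], by nlinarith [hx.1]⟩
    rw [norm_mul, Real.norm_eq_abs, Real.norm_of_nonneg h3.le]
    nlinarith [abs_nonneg (1 - 2 * betaC * x)]

theorem neg_sub_sq_le_one_sub_exp {x : ℝ} (hx : |x| ≤ 1) : -x - x ^ 2 ≤ 1 - Real.exp x := by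
  have := Real.norm_exp_sub_one_sub_id_le (x := x) (by simpa using hx)
  rw [Real.norm_eq_abs, Real.norm_eq_abs, sq_abs] at this
  linarith [le_of_abs_le this]

/-- The drift estimate, as an inequality between real numbers. -/
theorem drift_le {s : Fin 3 → ℝ} (hs : ∀ a, s a ∈ Set.Icc (0 : ℝ) 1) :
    1 / 256 * defect s ≤ -(1 / 128 * ∑ a, s a * ∑ b, Real.exp (2 * betaC * s b) *
      (tilt (s b) - tilt (s a))) := by
  have hu : ∀ a, 1 ≤ Real.exp (2 * betaC * s a) := fun a =>
    Real.one_le_exp (by have := betaC_gt; have := (hs a).1; positivity)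
  have hv : ∀ a, s a = Real.exp (2 * betaC * s a) * tilt (s a) := fun a => by
    have : Real.exp (2 * betaC * s a) * Real.exp (-(2 * betaC * s a)) = 1 := by
      rw [← Real.exp_add]; simp
    rw [tilt]
    linear_combination (-(s a)) * this
  set u : Fin 3 → ℝ := fun a => Real.exp (2 * betaC * s a)
  set v : Fin 3 → ℝ := fun a => tilt (s a)
  -- Since s = u v, exchanging `a` and `b` turns the drift into a sum of squares; using tilt
  -- differences as edge function is what makes this happen.
  have h1 : -∑ a, s a * ∑ b, u b * (v b - v a) = 1 / 2 * ∑ a, ∑ b, u a * u b * (v a - v b) ^ 2 := by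
    simp only [Fin.sum_univ_three]
    linear_combination -(u 0 * (v 0 - v 0) + u 1 * (v 1 - v 0) + u 2 * (v 2 - v 0)) * hv 0 -
      (u 0 * (v 0 - v 1) + u 1 * (v 1 - v 1) + u 2 * (v 2 - v 1)) * hv 1 -
      (u 0 * (v 0 - v 2) + u 1 * (v 1 - v 2) + u 2 * (v 2 - v 2)) * hv 2
  have h3 : defect s ≤ ∑ a, ∑ b, u a * u b * (v a - v b) ^ 2 := by
    refine Finset.sum_le_sum fun a _ => Finset.sum_le_sum fun b _ => ?_
    have : 1 ≤ u a * u b := one_le_mul_of_one_le_of_one_le (hu a) (hu b)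
    exact le_mul_of_one_le_left (sq_nonneg _) this
  linarith

/-- The coefficients of the antisymmetric function used in the ground state representation. -/
theorem edge_le {s t u δ ε h : ℝ} (hu : u ∈ Set.Icc (0 : ℝ) 16)
    (hε : |ε| ≤ 4 * h) (hδ : |δ + ε| ≤ 2) (hst : s - t = δ + ε) :
    -(1 / 128 * (u * δ)) - 1 / 2 * h - 1 / 2 * h ^ 2 - 1 / 512 * δ ^ 2 ≤
      u * (1 - Real.exp (1 / 128 * (s - t))) := by
  have h1 := neg_sub_sq_le_one_sub_exp (x := 1 / 128 * (s - t)) (by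
    rw [hst, abs_mul, abs_of_nonneg (by norm_num)]; linarith)
  have h2 := mul_le_mul_of_nonneg_left h1 hu.1
  refine le_trans ?_ h2
  rw [hst]
  have e1 := abs_le.mp hε
  have e2 : u * ε ≤ 64 * h := by nlinarith [hu.1, hu.2]
  have e3 : ε ^ 2 ≤ 16 * h ^ 2 := by nlinarith
  have e4 : u * (δ + ε) ^ 2 ≤ 32 * δ ^ 2 + 512 * h ^ 2 := by
    have : (δ + ε) ^ 2 ≤ 2 * δ ^ 2 + 2 * ε ^ 2 := by nlinarith [sq_nonneg (δ - ε)]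
    nlinarith [hu.1, hu.2, sq_nonneg (δ + ε)]
  nlinarith

/-- To first order the edge sum is `k` times the drift, at least k · defect / 256. The factor 1/128
makes the quadratic error of the exponential at most half of that. Replacing `others` by `ratio`
costs O(1/k) per edge, hence O(1) in total, which the 9 covers. -/
theorem le_sum_edges [NeZero k] (σ : Spins k) :
    1 / 512 * (k * defect (ratio σ)) - 9 ≤ ∑ i, ∑ b, Real.exp (2 * betaC * others σ i b) *
      (1 - Real.exp (1 / 128 * (tilt (others σ i b) - tilt (others σ i (σ i))))) := by
  have hk1 : (1 : ℝ) ≤ k := Nat.one_le_cast.mpr (Nat.one_le_iff_ne_zero.mpr (NeZero.ne k))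
  have hk0 : (0 : ℝ) < k := by linarith
  set s := ratio σ with hs
  have hs01 : ∀ a, s a ∈ Set.Icc (0 : ℝ) 1 := fun a => ⟨ratio_nonneg σ a, ratio_le_one σ a⟩
  have step : ∀ i, ∑ b, (-(1 / 128 * (Real.exp (2 * betaC * s b) * (tilt (s b) - tilt (s (σ i))))) -
      1 / 2 * (1 / k) - 1 / 2 * (1 / (k : ℝ)) ^ 2 - 1 / 512 * (tilt (s b) - tilt (s (σ i))) ^ 2) ≤
      ∑ b, Real.exp (2 * betaC * others σ i b) *
        (1 - Real.exp (1 / 128 * (tilt (others σ i b) - tilt (others σ i (σ i))))) := by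
    intro i
    refine Finset.sum_le_sum fun b _ => ?_
    by_cases hb : σ i = b
    · subst hb
      have : (0 : ℝ) ≤ 1 / k := by positivity
      simp only [sub_self, mul_zero, Real.exp_zero]
      nlinarith
    · have ho : others σ i b = s b := by simp [others, hb, hs]
      have ho' : others σ i (σ i) = s (σ i) - 1 / k := by simp [others, hs]
      have hm : others σ i (σ i) ∈ Set.Icc (0 : ℝ) 1 := ⟨others_nonneg _ _ _, others_le_one _ _ _⟩
      rw [ho]
      refine edge_le (s := tilt (s b)) (t := tilt (others σ i (σ i)))
        (ε := tilt (s (σ i)) - tilt (others σ i (σ i)))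
        ⟨(Real.exp_pos _).le, exp_two_betaC_mul_le (hs01 b).2⟩ ?_ ?_ (by ring)
      · refine (abs_tilt_sub_le (hs01 _) hm).trans (le_of_eq ?_)
        rw [ho', sub_sub_cancel, abs_of_nonneg (by positivity)]
      · have e1 := abs_tilt_le (hs01 b).1 (hs01 b).2
        have e2 := abs_tilt_le hm.1 hm.2
        rw [show tilt (s b) - tilt (s (σ i)) + (tilt (s (σ i)) - tilt (others σ i (σ i))) =
          tilt (s b) - tilt (others σ i (σ i)) by ring]
        exact (abs_sub _ _).trans (by linarith)
  refine le_trans ?_ (Finset.sum_le_sum fun i _ => step i)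
  rw [sum_comp_eq σ fun a => ∑ b, (-(1 / 128 * (Real.exp (2 * betaC * s b) *
      (tilt (s b) - tilt (s a)))) - 1 / 2 * (1 / k) - 1 / 2 * (1 / (k : ℝ)) ^ 2 -
        1 / 512 * (tilt (s b) - tilt (s a)) ^ 2), ← hs]
  have e1 := drift_le hs01
  have e2 : ∑ a, s a * ∑ b, (tilt (s b) - tilt (s a)) ^ 2 ≤ defect s := by
    rw [defect]
    refine Finset.sum_le_sum fun a _ => ?_
    have h0 : 0 ≤ ∑ b, (tilt (s b) - tilt (s a)) ^ 2 := Finset.sum_nonneg fun _ _ => sq_nonneg _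
    refine (mul_le_of_le_one_left h0 (hs01 a).2).trans (le_of_eq ?_)
    exact Finset.sum_congr rfl fun b _ => by ring
  have e3 : ∑ a, s a = 1 := sum_ratio σ
  have e4 : ∑ a, s a * ∑ b, (-(1 / 128 * (Real.exp (2 * betaC * s b) *
      (tilt (s b) - tilt (s a)))) - 1 / 2 * (1 / k) - 1 / 2 * (1 / (k : ℝ)) ^ 2 -
        1 / 512 * (tilt (s b) - tilt (s a)) ^ 2) =
      -(1 / 128 * ∑ a, s a * ∑ b, Real.exp (2 * betaC * s b) * (tilt (s b) - tilt (s a))) -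
        1 / 512 * ∑ a, s a * ∑ b, (tilt (s b) - tilt (s a)) ^ 2 -
        3 * (1 / 2 * (1 / k) + 1 / 2 * (1 / (k : ℝ)) ^ 2) * ∑ a, s a := by
    simp only [Finset.sum_sub_distrib, Finset.sum_neg_distrib, ← Finset.mul_sum,
      Fin.sum_univ_three]
    ring
  rw [e4, e3]
  have e5 : (k : ℝ) * (3 * (1 / 2 * (1 / k) + 1 / 2 * (1 / (k : ℝ)) ^ 2) * 1) ≤ 9 := by
    have : (k : ℝ) * (3 * (1 / 2 * (1 / k) + 1 / 2 * (1 / (k : ℝ)) ^ 2) * 1) =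
        3 / 2 + 3 / 2 * (1 / k) := by field_simp
    rw [this]
    have : 1 / (k : ℝ) ≤ 1 := (div_le_one hk0).mpr hk1
    linarith
  have e6 : 1 / 512 * defect s ≤
      -(1 / 128 * ∑ a, s a * ∑ b, Real.exp (2 * betaC * s b) * (tilt (s b) - tilt (s a))) -
        1 / 512 * ∑ a, s a * ∑ b, (tilt (s b) - tilt (s a)) ^ 2 := by linarith
  have e7 := mul_le_mul_of_nonneg_left e6 hk0.le
  linarith

/-- The Lyapunov estimate: away from the critical points, the square of a function is controlled
by the Dirichlet form. -/
theorem mean_sq_mul_defect_le [NeZero k] (w : Spins k → ℝ) :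
    mean (potts betaC k) (fun σ => w σ ^ 2 * (1 / 512 * (k * defect (ratio σ)) - 9)) ≤
      8 * dform w := by
  refine (mean_mono _ fun σ => ?_).trans (ground_state w
    (fun σ i b => 1 / 128 * (tilt (others σ i b) - tilt (others σ i (σ i)))) fun σ i b => ?_)
  · exact mul_le_mul_of_nonneg_left (le_sum_edges σ) (sq_nonneg _)
  · simp only [others_update, Function.update_self]
    ring

end Lyapunov

/-! ### Product measures -/

section Product

variable {E : Type} [Fintype E]

theorem mean_indep_succ (r : PMF E) (k : ℕ) (F : (Fin (k + 1) → E) → ℝ) :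
    mean (indep fun _ : Fin (k + 1) => r) F =
      mean r fun a => mean (indep fun _ : Fin k => r) fun τ => F (Fin.cons a τ) := by
  simp only [mean, toReal_indep, Finset.mul_sum]
  rw [← (Fin.consEquiv fun _ : Fin (k + 1) => E).sum_comp, Fintype.sum_prod_type]
  refine Finset.sum_congr rfl fun a _ => Finset.sum_congr rfl fun τ _ => ?_
  simp [Fin.prod_univ_succ, Fin.consEquiv, mul_assoc]

theorem mean_comm {F : Type} [Fintype F] (p : PMF E) (q : PMF F) (f : E → F → ℝ) :
    mean p (fun x => mean q (f x)) = mean q fun y => mean p fun x => f x y := by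
  simp only [mean, Finset.mul_sum]
  rw [Finset.sum_comm]
  exact Finset.sum_congr rfl fun _ _ => Finset.sum_congr rfl fun _ _ => by ring

/-- The Efron–Stein inequality (with a factor two). -/
theorem efronStein (r : PMF E) (k : ℕ) (w : (Fin k → E) → ℝ) :
    mean (indep fun _ : Fin k => r) (fun σ => w σ ^ 2) -
        mean (indep fun _ : Fin k => r) w ^ 2 ≤
      mean (indep fun _ : Fin k => r) fun σ =>
        ∑ i, mean r fun b => (w σ - w (Function.update σ i b)) ^ 2 := by
  induction k with
  | zero =>
    have h : ∀ f : (Fin 0 → E) → ℝ, mean (indep fun _ : Fin 0 => r) f = f default := by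
      intro f
      exact (congrArg _ (funext fun x => congrArg f (Subsingleton.elim _ _))).trans
        (mean_const _ (f default))
    rw [h, h, h]
    simp
  | succ k ih =>
    set p := indep fun _ : Fin k => r
    have h0 : mean (indep fun _ : Fin (k + 1) => r) (fun σ =>
        ∑ i, mean r fun b => (w σ - w (Function.update σ i b)) ^ 2) =
        (mean r fun a => mean p fun τ => mean r fun b => (w (Fin.cons a τ) - w (Fin.cons b τ)) ^ 2) +
        mean r fun a => mean p fun τ => ∑ i, mean r fun b =>
          (w (Fin.cons a τ) - w (Fin.cons a (Function.update τ i b))) ^ 2 := by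
      rw [mean_indep_succ, ← mean_add]
      congr 1
      funext a
      rw [← mean_add]
      congr 1
      funext τ
      rw [Fin.sum_univ_succ]
      simp only [Fin.update_cons_zero, Fin.cons_update]
    rw [h0, mean_indep_succ, mean_indep_succ]
    -- The variance is the mean conditional variance given the first coordinate, treated by
    -- induction, plus the variance of `g`, treated by Jensen.
    set g : E → ℝ := fun a => mean p fun τ => w (Fin.cons a τ) with hg
    have h1 : mean r (fun a => mean p fun τ => w (Fin.cons a τ) ^ 2) - mean r (fun a => g a ^ 2) ≤
        mean r fun a => mean p fun τ => ∑ i, mean r fun b =>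
          (w (Fin.cons a τ) - w (Fin.cons a (Function.update τ i b))) ^ 2 := by
      rw [← mean_sub]
      exact mean_mono _ fun a => ih fun τ => w (Fin.cons a τ)
    have h2 : mean r (fun a => g a ^ 2) - mean r g ^ 2 ≤
        mean r fun a => mean r fun b => (g a - g b) ^ 2 := by
      have e : ∀ a b, (g a - g b) ^ 2 = g a ^ 2 - 2 * g a * g b + g b ^ 2 := fun a b => by ring
      simp only [e, mean_add, mean_sub, mean_const, mean_const_mul, mean_mul_const]
      have := sq_mean_le r g
      nlinarith
    have h3 : (mean r fun a => mean r fun b => (g a - g b) ^ 2) ≤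
        mean r fun a => mean p fun τ => mean r fun b =>
          (w (Fin.cons a τ) - w (Fin.cons b τ)) ^ 2 := by
      refine mean_mono _ fun a => ?_
      rw [mean_comm]
      refine mean_mono _ fun b => ?_
      simp only [hg]
      rw [← mean_sub]
      exact sq_mean_le _ _
    linarith

/-- Comparison of the means under two laws. -/
theorem sq_mean_sub_le (p p' : PMF E) (hp : ∀ x, p x ≠ 0) (w : E → ℝ) :
    (mean p' w - mean p w) ^ 2 ≤ (∑ x, (p' x).toReal ^ 2 / (p x).toReal) *
      (mean p (fun x => w x ^ 2) - mean p w ^ 2) := by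
  have hp0 : ∀ x, 0 < (p x).toReal := fun x =>
    ENNReal.toReal_pos (hp x) (PMF.apply_ne_top _ _)
  rw [← mean_sq_sub_mean]
  -- A change of measure followed by Cauchy–Schwarz; the resulting chi-square distance is the sum in
  -- the statement minus 1.
  have h1 : mean p' w - mean p w =
      mean p fun x => ((p' x).toReal / (p x).toReal - 1) * (w x - mean p w) := by
    have e : ∀ x, ((p' x).toReal / (p x).toReal - 1) * (w x - mean p w) =
        (p' x).toReal / (p x).toReal * (w x - mean p w) - (w x - mean p w) := fun x => by ring
    simp only [e]
    rw [mean_sub, mean_sub p w, mean_const, sub_self, sub_zero]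
    have e2 : (mean p fun x => (p' x).toReal / (p x).toReal * (w x - mean p w)) =
        mean p' fun x => w x - mean p w := by
      refine Finset.sum_congr rfl fun x _ => ?_
      have := (hp0 x).ne'
      field_simp
    rw [e2, mean_sub, mean_const]
  rw [h1]
  refine (sq_mean_mul_le _ _ _).trans (mul_le_mul_of_nonneg_right ?_
    (mean_nonneg _ fun _ => sq_nonneg _))
  have h2 : (mean p fun x => ((p' x).toReal / (p x).toReal - 1) ^ 2) =
      ∑ x, (p' x).toReal ^ 2 / (p x).toReal - 2 * ∑ x, (p' x).toReal + ∑ x, (p x).toReal := by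
    rw [Finset.mul_sum, ← Finset.sum_sub_distrib, ← Finset.sum_add_distrib]
    refine Finset.sum_congr rfl fun x _ => ?_
    have := (hp0 x).ne'
    field_simp
    ring
  rw [h2, sum_toReal, sum_toReal]
  linarith

end Product

/-! ### Comparison of the Potts model with product measures -/

section Mixture

variable {k : ℕ}

/-- The law on colours with weights `exp (2 β y_c)`. -/
noncomputable def softmax (y : Fin 3 → ℝ) : PMF (Fin 3) :=
  PMF.normalize (fun c => ENNReal.ofReal (Real.exp (2 * betaC * y c)))
    (fun h => (ENNReal.ofReal_pos.mpr (Real.exp_pos _)).ne' (ENNReal.tsum_eq_zero.mp h 0))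
    (by rw [tsum_fintype]; exact ENNReal.sum_ne_top.mpr fun _ _ => ENNReal.ofReal_ne_top)

theorem toReal_softmax (y : Fin 3 → ℝ) (c : Fin 3) :
    (softmax y c).toReal = Real.exp (2 * betaC * y c) / ∑ a, Real.exp (2 * betaC * y a) := by
  rw [softmax, PMF.normalize_apply, tsum_fintype, ENNReal.toReal_mul, ENNReal.toReal_inv,
    ENNReal.toReal_sum fun _ _ => ENNReal.ofReal_ne_top, div_eq_mul_inv]
  simp only [ENNReal.toReal_ofReal (Real.exp_pos _).le]

/-- The product measure on spins with marginals `softmax y`. -/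
noncomputable def prodLaw (k : ℕ) (y : Fin 3 → ℝ) : PMF (Spins k) := indep fun _ => softmax y

/-- The exponential of the free energy of the product measure. -/
noncomputable def freeExp (y : Fin 3 → ℝ) : ℝ :=
  (∑ a, Real.exp (2 * betaC * y a)) * Real.exp (-(betaC * ∑ a, y a ^ 2))

theorem sum_exp_pos (y : Fin 3 → ℝ) : 0 < ∑ a, Real.exp (2 * betaC * y a) :=
  Finset.sum_pos (fun _ _ => Real.exp_pos _) ⟨0, Finset.mem_univ _⟩

theorem freeExp_pos (y : Fin 3 → ℝ) : 0 < freeExp y :=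
  mul_pos (sum_exp_pos y) (Real.exp_pos _)

theorem prodLaw_ne_zero (y : Fin 3 → ℝ) (σ : Spins k) : prodLaw k y σ ≠ 0 := by
  rw [prodLaw, indep, PMF.ofFintype_apply, Finset.prod_ne_zero_iff]
  intro i _ h
  have h1 := toReal_softmax y (σ i)
  rw [h, ENNReal.toReal_zero] at h1
  exact (div_pos (Real.exp_pos _) (sum_exp_pos y)).ne h1

/-- Completing the square: |s|² = |s - y|² + 2 s·y - |y|². The linear term is a product measure, and
the constant goes into `freeExp`. -/
theorem gibbsWeight_eq_prodLaw (y : Fin 3 → ℝ) (σ : Spins k) :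
    gibbsWeight betaC σ = Real.exp (betaC * (k * ∑ a, (ratio σ a - y a) ^ 2)) *
      (prodLaw k y σ).toReal * freeExp y ^ k := by
  have h1 : (prodLaw k y σ).toReal = Real.exp (2 * betaC * (k * ∑ a, ratio σ a * y a)) /
      (∑ a, Real.exp (2 * betaC * y a)) ^ k := by
    rw [prodLaw, toReal_indep]
    simp only [toReal_softmax]
    rw [Finset.prod_div_distrib, Finset.prod_const, Finset.card_univ, Fintype.card_fin,
      ← Real.exp_sum, ← Finset.mul_sum, sum_comp_eq σ y]
  have h2 := (pow_pos (sum_exp_pos y) k).ne'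
  rw [h1, freeExp, mul_pow, ← Real.exp_nat_mul]
  have h3 : ∀ A B C L : ℝ, L ≠ 0 → A * (B / L) * (L * C) = A * B * C := by
    intro A B C L hL
    field_simp
  rw [h3 _ _ _ _ h2, ← Real.exp_add, ← Real.exp_add, gibbsWeight]
  congr 1
  simp only [Fin.sum_univ_three]
  ring

/-- The weight of the product measure in the Potts model. -/
noncomputable def mixWeight (k : ℕ) (y : Fin 3 → ℝ) : ℝ := freeExp y ^ k / partition k

theorem mixWeight_pos (y : Fin 3 → ℝ) : 0 < mixWeight k y :=
  div_pos (pow_pos (freeExp_pos y) k) (partition_pos k)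

theorem toReal_potts_eq (y : Fin 3 → ℝ) (σ : Spins k) :
    (potts betaC k σ).toReal = Real.exp (betaC * (k * ∑ a, (ratio σ a - y a) ^ 2)) *
      (mixWeight k y * (prodLaw k y σ).toReal) := by
  rw [toReal_potts, gibbsWeight_eq_prodLaw y, mixWeight]
  ring

/-- The quadratic exponent is nonnegative, so this side of the comparison holds globally; the
reverse one in `mean_near_le` holds, up to a constant, only where k |s - y|² ≤ R. -/
theorem mixWeight_mul_mean_le (y : Fin 3 → ℝ) {F : Spins k → ℝ} (hF : ∀ σ, 0 ≤ F σ) :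
    mixWeight k y * mean (prodLaw k y) F ≤ mean (potts betaC k) F := by
  rw [mean, Finset.mul_sum]
  refine Finset.sum_le_sum fun σ _ => ?_
  rw [toReal_potts_eq y, ← mul_assoc]
  have hb := betaC_gt
  refine mul_le_mul_of_nonneg_right ?_ (hF σ)
  have h0 : 0 ≤ mixWeight k y * (prodLaw k y σ).toReal :=
    mul_nonneg (mixWeight_pos y).le ENNReal.toReal_nonneg
  have h1 : 0 ≤ ∑ a, (ratio σ a - y a) ^ 2 := Finset.sum_nonneg fun _ _ => sq_nonneg _
  exact le_mul_of_one_le_left h0 (Real.one_le_exp (by positivity))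

open Classical in
theorem mean_near_le (y : Fin 3 → ℝ) {F : Spins k → ℝ} (hF : ∀ σ, 0 ≤ F σ) (R : ℝ) :
    mean (potts betaC k) (fun σ => if k * ∑ a, (ratio σ a - y a) ^ 2 ≤ R then F σ else 0) ≤
      Real.exp (betaC * R) * (mixWeight k y * mean (prodLaw k y) F) := by
  rw [mean, mean, Finset.mul_sum, Finset.mul_sum]
  refine Finset.sum_le_sum fun σ _ => ?_
  have h0 : 0 ≤ mixWeight k y * (prodLaw k y σ).toReal :=
    mul_nonneg (mixWeight_pos y).le ENNReal.toReal_nonneg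
  have hb := betaC_gt
  rw [toReal_potts_eq y, ← mul_assoc (mixWeight k y), ← mul_assoc (Real.exp (betaC * R))]
  split_ifs with h
  · refine mul_le_mul_of_nonneg_right (mul_le_mul_of_nonneg_right ?_ h0) (hF σ)
    exact Real.exp_le_exp.mpr (mul_le_mul_of_nonneg_left h (by linarith))
  · rw [mul_zero]
    exact mul_nonneg (mul_nonneg (Real.exp_pos _).le h0) (hF σ)

/-- The local Poincaré inequality. -/
theorem mixWeight_mul_var_le (y : Fin 3 → ℝ) (w : Spins k → ℝ) :
    mixWeight k y * (mean (prodLaw k y) (fun σ => w σ ^ 2) - mean (prodLaw k y) w ^ 2) ≤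
      dform w := by
  refine (mul_le_mul_of_nonneg_left (efronStein _ _ _) (mixWeight_pos y).le).trans ?_
  refine (mixWeight_mul_mean_le y fun σ => Finset.sum_nonneg fun i _ =>
    mean_nonneg _ fun b => sq_nonneg _).trans (mean_mono _ fun σ => ?_)
  refine Finset.sum_le_sum fun i _ => Finset.sum_le_sum fun b _ => ?_
  refine mul_le_of_le_one_left (sq_nonneg _) ?_
  exact ENNReal.toReal_le_of_le_ofReal zero_le_one (by simpa using PMF.coe_le_one _ _)

/-- Comparison of the means under two product measures. -/
theorem mixWeight_mul_sq_mean_le (y y' : Fin 3 → ℝ) (w : Spins k → ℝ) :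
    mixWeight k y * mean (prodLaw k y) w ^ 2 ≤
      2 * (mixWeight k y * mean (prodLaw k y') w ^ 2) +
      2 * ((∑ c, (softmax y' c).toReal ^ 2 / (softmax y c).toReal) ^ k * dform w) := by
  set X := ∑ c, (softmax y' c).toReal ^ 2 / (softmax y c).toReal
  -- This sum tensorises, so parameters at distance O(k^(-1/2)) will give a bounded factor.
  have hX : ∑ σ : Spins k, (prodLaw k y' σ).toReal ^ 2 / (prodLaw k y σ).toReal = X ^ k := by
    simp only [prodLaw, toReal_indep, ← Finset.prod_pow, ← Finset.prod_div_distrib]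
    rw [← Fintype.prod_sum fun (_ : Fin k) c => (softmax y' c).toReal ^ 2 / (softmax y c).toReal]
    simp [X]
  have h1 := sq_mean_sub_le (prodLaw k y) (prodLaw k y') (prodLaw_ne_zero y) w
  rw [hX] at h1
  have hX0 : 0 ≤ X ^ k := pow_nonneg (Finset.sum_nonneg fun _ _ =>
    div_nonneg (sq_nonneg _) ENNReal.toReal_nonneg) k
  have h2 := mul_le_mul_of_nonneg_left (mixWeight_mul_var_le (k := k) y w) hX0
  have h3 := mul_le_mul_of_nonneg_left h1 (mixWeight_pos (k := k) y).le
  have h4 : mean (prodLaw k y) w ^ 2 ≤ 2 * mean (prodLaw k y') w ^ 2 +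
      2 * (mean (prodLaw k y') w - mean (prodLaw k y) w) ^ 2 := by
    nlinarith [sq_nonneg (mean (prodLaw k y) w - 2 * mean (prodLaw k y') w)]
  have h5 := mul_le_mul_of_nonneg_left h4 (mixWeight_pos (k := k) y).le
  nlinarith

theorem sum_crit_comp (c : Fin 3) (x : ℝ) (F : ℝ → ℝ) :
    ∑ a, F (crit c x a) = F ((1 + 2 * x) / 3) + 2 * F ((1 - x) / 3) := by
  fin_cases c <;> simp [Fin.sum_univ_three, crit] <;> ring

theorem freeExp_crit (c : Fin 3) (x : ℝ) : freeExp (crit c x) =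
    (Real.exp (2 * betaC * x) + 2) * Real.exp (betaC * (1 - 2 * x - 2 * x ^ 2) / 3) := by
  rw [freeExp, sum_crit_comp c x fun t => Real.exp (2 * betaC * t),
    sum_crit_comp c x fun t => t ^ 2]
  have e1 : Real.exp (2 * betaC * ((1 + 2 * x) / 3)) =
      Real.exp (2 * betaC * x) * Real.exp (2 * betaC * ((1 - x) / 3)) := by
    rw [← Real.exp_add]; congr 1; ring
  rw [e1, ← add_mul, mul_assoc, ← Real.exp_add]
  congr 2
  ring

/-- Phase coexistence at the critical temperature: the ordered and disordered wells have exactly the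
same free energy, so no well is exponentially lighter than another. -/
theorem freeExp_crit_half (c c' : Fin 3) : freeExp (crit c (1 / 2)) = freeExp (crit c' 0) := by
  rw [freeExp_crit, freeExp_crit, show 2 * betaC * (1 / 2) = betaC by ring, exp_betaC,
    mul_zero, Real.exp_zero]
  have : Real.exp (betaC * (1 - 2 * 0 - 2 * 0 ^ 2) / 3) =
      Real.exp (betaC * (1 - 2 * (1 / 2) - 2 * (1 / 2) ^ 2) / 3) * Real.exp (betaC / 2) := by
    rw [← Real.exp_add]; congr 1; ring
  rw [this, exp_betaC_half]
  ring

theorem one_add_sq_div_two_le_cosh (x : ℝ) : 1 + x ^ 2 / 2 ≤ Real.cosh x := by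
  have h1 : Real.cosh x = 1 + 2 * Real.sinh (x / 2) ^ 2 := by
    have := Real.cosh_two_mul (x / 2)
    rw [mul_div_cancel₀ _ two_ne_zero, Real.cosh_sq] at this
    linarith
  have h2 : (x / 2) ^ 2 ≤ Real.sinh (x / 2) ^ 2 := by
    rw [sq_le_sq, Real.abs_sinh]
    exact Real.self_le_sinh_iff.mpr (abs_nonneg _)
  rw [h1]
  linarith

/-- Instability of the saddle points. -/
theorem freeExp_saddle (c : Fin 3) {r : ℝ} (h0 : 0 ≤ r) (h1 : r ≤ 1 / 10) :
    freeExp (crit c (1 / 4)) * Real.exp (r ^ 2 / 100) ≤ freeExp (crit c (1 / 4 + r)) := by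
  have hb := betaC_gt
  have hb' := betaC_lt
  rw [freeExp_crit, freeExp_crit, show 2 * betaC * (1 / 4) = betaC / 2 by ring, exp_betaC_half]
  -- The linear terms in `r` cancel because 1/4 is critical, leaving cosh(βr) exp(-2βr²/3). The
  -- saddle is unstable since β²/2 ≈ 0.96 exceeds 2β/3 ≈ 0.924; the constant 1/100 fits in the gap.
  have e1 : Real.exp (2 * betaC * (1 / 4 + r)) + 2 =
      4 * (Real.cosh (betaC * r) * Real.exp (betaC * r)) := by
    rw [show 2 * betaC * (1 / 4 + r) = betaC / 2 + (betaC * r + betaC * r) by ring,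
      Real.exp_add, exp_betaC_half, Real.cosh_eq, Real.exp_add]
    have : Real.exp (-(betaC * r)) * Real.exp (betaC * r) = 1 := by
      rw [← Real.exp_add]; simp
    linear_combination (-2) * this
  have e2 : Real.exp (betaC * (1 - 2 * (1 / 4 + r) - 2 * (1 / 4 + r) ^ 2) / 3) *
      Real.exp (betaC * r) = Real.exp (betaC * (1 - 2 * (1 / 4) - 2 * (1 / 4) ^ 2) / 3) *
        Real.exp (-(2 * betaC / 3 * r ^ 2)) := by
    rw [← Real.exp_add, ← Real.exp_add]; congr 1; ring
  have e3 : Real.exp (r ^ 2 / 100) ≤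
      Real.cosh (betaC * r) * Real.exp (-(2 * betaC / 3 * r ^ 2)) := by
    rw [Real.exp_neg, ← div_eq_mul_inv, le_div_iff₀ (Real.exp_pos _), ← Real.exp_add]
    refine le_trans ?_ (one_add_sq_div_two_le_cosh _)
    set t := r ^ 2 / 100 + 2 * betaC / 3 * r ^ 2 with ht
    have hr2 : r ^ 2 ≤ 1 / 100 := by nlinarith
    have ht0 : 0 ≤ t := by positivity
    have ht1 : t ≤ 0.9343 * r ^ 2 := by rw [ht]; nlinarith [sq_nonneg r]
    have ht2 : t ≤ 1 / 100 := by linarith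
    have h3 := Real.norm_exp_sub_one_sub_id_le (x := t) (by
      rw [Real.norm_of_nonneg ht0]; linarith)
    rw [Real.norm_of_nonneg ht0] at h3
    have h4 := le_of_abs_le h3
    have h5 : t ^ 2 ≤ 1 / 100 * t := by nlinarith
    have h6 : 1.92 * r ^ 2 ≤ (betaC * r) ^ 2 := by rw [mul_pow]; nlinarith [sq_nonneg r]
    linarith
  have h4 := Real.exp_pos (betaC * (1 - 2 * (1 / 4) - 2 * (1 / 4) ^ 2) / 3)
  calc _ = 4 * Real.exp (betaC * (1 - 2 * (1 / 4) - 2 * (1 / 4) ^ 2) / 3) *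
          Real.exp (r ^ 2 / 100) := by ring
    _ ≤ 4 * Real.exp (betaC * (1 - 2 * (1 / 4) - 2 * (1 / 4) ^ 2) / 3) *
          (Real.cosh (betaC * r) * Real.exp (-(2 * betaC / 3 * r ^ 2))) :=
        mul_le_mul_of_nonneg_left e3 (by positivity)
    _ = _ := by rw [e1]; linear_combination (-4 * Real.cosh (betaC * r)) * e2

/-- At the saddle the colour weights are in proportion 2 : 1 : 1, and after the shift 2E : 1 : 1
with E = e^(2βr). The sum then equals 1 + ((E - 1)/(E + 1))², which is 1 + O(r²). -/
theorem softmax_saddle_le (c : Fin 3) {r : ℝ} (h0 : 0 ≤ r) (h1 : r ≤ 1 / 10) :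
    ∑ a, (softmax (crit c (1 / 4 + r)) a).toReal ^ 2 / (softmax (crit c (1 / 4)) a).toReal ≤
      Real.exp (8 * r ^ 2) := by
  have hb := betaC_gt
  have hb' := betaC_lt
  set E := Real.exp (2 * betaC * r) with hE
  have hE1 : 1 ≤ E := Real.one_le_exp (by positivity)
  have hE2 : E - 1 ≤ 4 * betaC * r := by
    have hp : 0 ≤ 2 * betaC * r := by positivity
    have h2 := Real.norm_exp_sub_one_sub_id_le (x := 2 * betaC * r) (by
      rw [Real.norm_of_nonneg hp]; nlinarith)
    rw [Real.norm_of_nonneg hp] at h2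
    have h3 := le_of_abs_le h2
    have h5 : 2 * betaC * r ≤ 1 := by nlinarith
    have h6 : (2 * betaC * r) ^ 2 ≤ 2 * betaC * r := by
      nlinarith
    linarith
  have key : ∑ a, (softmax (crit c (1 / 4 + r)) a).toReal ^ 2 /
      (softmax (crit c (1 / 4)) a).toReal = 1 + ((E - 1) / (E + 1)) ^ 2 := by
    simp only [toReal_softmax]
    have s1 : ∀ x, ∑ a, Real.exp (2 * betaC * crit c x a) =
        Real.exp (2 * betaC * ((1 - x) / 3)) * (Real.exp (2 * betaC * x) + 2) := by
      intro x
      rw [sum_crit_comp c x fun t => Real.exp (2 * betaC * t)]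
      have e1 : Real.exp (2 * betaC * ((1 + 2 * x) / 3)) =
          Real.exp (2 * betaC * x) * Real.exp (2 * betaC * ((1 - x) / 3)) := by
        rw [← Real.exp_add]; congr 1; ring
      rw [e1]; ring
    have s2 : ∀ x a, Real.exp (2 * betaC * crit c x a) =
        Real.exp (2 * betaC * ((1 - x) / 3)) * if a = c then Real.exp (2 * betaC * x) else 1 := by
      intro x a
      unfold crit
      split_ifs
      · rw [← Real.exp_add]; congr 1; ring
      · rw [mul_one]
    have s3 : Real.exp (2 * betaC * (1 / 4)) = 2 := by
      rw [show 2 * betaC * (1 / 4) = betaC / 2 by ring, exp_betaC_half]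
    have s4 : Real.exp (2 * betaC * (1 / 4 + r)) = 2 * E := by
      rw [mul_add, Real.exp_add, s3]
    simp only [s1]
    simp only [s2, s3, s4]
    have p1 := (Real.exp_pos (2 * betaC * ((1 - (1 / 4 + r)) / 3))).ne'
    have p2 := (Real.exp_pos (2 * betaC * ((1 - 1 / 4) / 3))).ne'
    generalize Real.exp (2 * betaC * ((1 - (1 / 4 + r)) / 3)) = q at *
    generalize Real.exp (2 * betaC * ((1 - 1 / 4) / 3)) = q' at *
    have p3 : E + 1 ≠ 0 := by positivity
    have p4 : 2 * E + 2 ≠ 0 := by positivity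
    have s5 : ∀ a, (q * (if a = c then 2 * E else 1) / (q * (2 * E + 2))) ^ 2 /
        (q' * (if a = c then 2 else 1) / (q' * (2 + 2))) =
        if a = c then 2 * E ^ 2 / (E + 1) ^ 2 else 1 / (E + 1) ^ 2 := by
      intro a
      rw [mul_div_mul_left _ _ p1, mul_div_mul_left _ _ p2,
        show 2 * E + 2 = 2 * (E + 1) by ring]
      split_ifs
      · field_simp; ring
      · field_simp; ring
    simp only [s5]
    have s6 : ∀ A B : ℝ, ∑ a, (if a = c then A else B) = A + 2 * B := by
      intro A B
      fin_cases c <;> simp [Fin.sum_univ_three] <;> ring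
    rw [s6]
    field_simp
    ring
  rw [key]
  have h3 : (E - 1) / (E + 1) ≤ 2 * betaC * r := by
    rw [div_le_iff₀ (by linarith)]
    nlinarith [mul_nonneg (by linarith : 0 ≤ betaC) h0]
  have h4 : 0 ≤ (E - 1) / (E + 1) := div_nonneg (by linarith) (by linarith)
  have h5 : ((E - 1) / (E + 1)) ^ 2 ≤ (2 * betaC * r) ^ 2 := by gcongr
  have h6 : (2 * betaC * r) ^ 2 ≤ 8 * r ^ 2 := by
    rw [mul_pow]
    have : (2 * betaC) ^ 2 ≤ 8 := by nlinarith
    nlinarith [sq_nonneg r]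
  linarith [Real.add_one_le_exp (8 * r ^ 2)]

end Mixture

/-! ### The super-Poincaré inequality -/

section SuperPoincare

variable {k : ℕ}

open Classical in
/-- The part of the second moment of `w` near the critical point `crit c x`. -/
noncomputable def localMass (R : ℝ) (w : Spins k → ℝ) (c : Fin 3) (x : ℝ) : ℝ :=
  mean (potts betaC k) fun σ =>
    if k * ∑ a, (ratio σ a - crit c x a) ^ 2 ≤ R then w σ ^ 2 else 0

theorem dform_nonneg (w : Spins k → ℝ) : 0 ≤ dform w :=
  mean_nonneg _ fun _ => Finset.sum_nonneg fun _ _ => Finset.sum_nonneg fun _ _ => sq_nonneg _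

theorem localMass_le (R : ℝ) (w : Spins k → ℝ) (c : Fin 3) (x : ℝ) :
    localMass R w c x ≤ Real.exp (betaC * R) *
      (dform w + mixWeight k (crit c x) * mean (prodLaw k (crit c x)) w ^ 2) := by
  refine (mean_near_le (crit c x) (fun σ => sq_nonneg (w σ)) R).trans ?_
  refine mul_le_mul_of_nonneg_left ?_ (Real.exp_pos _).le
  linarith [mixWeight_mul_var_le (crit c x) w]

/-- The threshold is k · defect = 5120, since 5120/512 - 9 = 1. Above it the Lyapunov estimate
bounds w² itself; below it the configuration is within squared distance 5120 C / k of a critical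
point, and ten times the local mass pays for the negative term -9 w². -/
theorem mean_sq_le_localMass {C : ℝ} (hC0 : 0 < C)
    (hC : ∀ s : Fin 3 → ℝ, (∀ a, 0 ≤ s a) → ∑ a, s a = 1 →
      ∃ c, ∃ x ∈ ({0, 1 / 4, 1 / 2} : Set ℝ), ∑ a, (s a - crit c x a) ^ 2 ≤ C * defect s)
    [NeZero k] (w : Spins k → ℝ) :
    mean (potts betaC k) (fun σ => w σ ^ 2) ≤ 8 * dform w + 10 * ∑ c,
      (localMass (5120 * C) w c 0 + localMass (5120 * C) w c (1 / 4) +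
        localMass (5120 * C) w c (1 / 2)) := by
  classical
  have h1 := mean_sq_mul_defect_le w
  have h2 : mean (potts betaC k) (fun σ => w σ ^ 2) ≤
      mean (potts betaC k) (fun σ => w σ ^ 2 * (1 / 512 * (k * defect (ratio σ)) - 9)) +
      10 * ∑ c, (localMass (5120 * C) w c 0 + localMass (5120 * C) w c (1 / 4) +
        localMass (5120 * C) w c (1 / 2)) := by
    simp only [localMass, ← mean_add, ← mean_sum, ← mean_const_mul]
    refine mean_mono _ fun σ => ?_
    set I : Fin 3 → ℝ → ℝ := fun c x =>
      if k * ∑ a, (ratio σ a - crit c x a) ^ 2 ≤ 5120 * C then w σ ^ 2 else 0 with hI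
    have hI0 : ∀ c x, 0 ≤ I c x := fun c x => by
      simp only [hI]
      split_ifs
      · positivity
      · exact le_rfl
    have hS : ∀ c, 0 ≤ I c 0 + I c (1 / 4) + I c (1 / 2) := fun c =>
      add_nonneg (add_nonneg (hI0 _ _) (hI0 _ _)) (hI0 _ _)
    change w σ ^ 2 ≤ _ + 10 * ∑ c, (I c 0 + I c (1 / 4) + I c (1 / 2))
    have hk : (0 : ℝ) ≤ k := Nat.cast_nonneg k
    by_cases hd : k * defect (ratio σ) ≤ 5120
    · obtain ⟨c, x, hx, h⟩ := hC (ratio σ) (ratio_nonneg σ) (sum_ratio σ)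
      have hIx : I c x = w σ ^ 2 := by
        have : k * ∑ a, (ratio σ a - crit c x a) ^ 2 ≤ 5120 * C :=
          calc k * ∑ a, (ratio σ a - crit c x a) ^ 2 ≤ k * (C * defect (ratio σ)) := by gcongr
            _ = C * (k * defect (ratio σ)) := by ring
            _ ≤ C * 5120 := by gcongr
            _ = 5120 * C := by ring
        simp only [hI, this, if_true]
      have hIc : w σ ^ 2 ≤ I c 0 + I c (1 / 4) + I c (1 / 2) := by
        rw [← hIx]
        rcases hx with rfl | rfl | rfl
        · linarith [hI0 c (1 / 4), hI0 c (1 / 2)]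
        · linarith [hI0 c 0, hI0 c (1 / 2)]
        · linarith [hI0 c 0, hI0 c (1 / 4)]
      have hsum := Finset.single_le_sum (fun c _ => hS c) (Finset.mem_univ c)
      have hd0 : 0 ≤ w σ ^ 2 * (k * defect (ratio σ)) :=
        mul_nonneg (sq_nonneg _) (mul_nonneg hk (defect_nonneg _))
      linarith
    · have hsum := Finset.sum_nonneg fun (c : Fin 3) (_ : c ∈ Finset.univ) => hS c
      push Not at hd
      nlinarith [sq_nonneg (w σ)]
  linarith

/-- The mass near a saddle point is absorbed along the unstable direction. -/
theorem saddle_le [NeZero k] {K : ℝ} (hK0 : 0 ≤ K) (hK : 100 * K ^ 2 ≤ k) (w : Spins k → ℝ)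
    (c : Fin 3) :
    mixWeight k (crit c (1 / 4)) * mean (prodLaw k (crit c (1 / 4))) w ^ 2 ≤
      2 * Real.exp (-(K ^ 2 / 100)) * mean (potts betaC k) (fun σ => w σ ^ 2) +
        2 * Real.exp (8 * K ^ 2) * dform w := by
  have hk : (0 : ℝ) < k := Nat.cast_pos.mpr (Nat.pos_of_ne_zero (NeZero.ne k))
  have hsk : 0 < √(k : ℝ) := Real.sqrt_pos.mpr hk
  have hsq : √(k : ℝ) ^ 2 = k := Real.sq_sqrt hk.le
  -- On this scale the weight gain and the chi-square cost, both k-th powers, become exp(K²/100) and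
  -- exp(8K²), independently of `k`. The lower bound on `k` ensures r ≤ 1/10.
  set r := K / √k with hr
  have hr0 : 0 ≤ r := by positivity
  have hkr : k * r ^ 2 = K ^ 2 := by
    rw [hr, div_pow, hsq]
    field_simp
  have hr1 : r ≤ 1 / 10 := by
    by_contra! h
    have : (1 / 10) ^ 2 < r ^ 2 := by gcongr
    nlinarith
  have h1 := mixWeight_mul_sq_mean_le (k := k) (crit c (1 / 4)) (crit c (1 / 4 + r)) w
  have h2 : (∑ a, (softmax (crit c (1 / 4 + r)) a).toReal ^ 2 /
      (softmax (crit c (1 / 4)) a).toReal) ^ k ≤ Real.exp (8 * K ^ 2) := by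
    refine (pow_le_pow_left₀ (Finset.sum_nonneg fun _ _ =>
      div_nonneg (sq_nonneg _) ENNReal.toReal_nonneg) (softmax_saddle_le c hr0 hr1) k).trans ?_
    rw [← Real.exp_nat_mul, ← hkr]
    exact Real.exp_le_exp.mpr (le_of_eq (by ring))
  have h3 : mixWeight k (crit c (1 / 4)) ≤
      Real.exp (-(K ^ 2 / 100)) * mixWeight k (crit c (1 / 4 + r)) := by
    have e1 := pow_le_pow_left₀ (mul_pos (freeExp_pos _) (Real.exp_pos _)).le
      (freeExp_saddle c hr0 hr1) k
    have e2 : (Real.exp (r ^ 2 / 100)) ^ k = Real.exp (K ^ 2 / 100) := by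
      rw [← Real.exp_nat_mul, ← hkr]
      congr 1
      ring
    rw [mul_pow, e2] at e1
    rw [mixWeight, mixWeight, Real.exp_neg, ← mul_div_assoc]
    refine div_le_div_of_nonneg_right ?_ (partition_pos k).le
    rw [inv_mul_eq_div, le_div_iff₀ (Real.exp_pos _)]
    exact e1
  have h4 : mixWeight k (crit c (1 / 4 + r)) * mean (prodLaw k (crit c (1 / 4 + r))) w ^ 2 ≤
      mean (potts betaC k) fun σ => w σ ^ 2 :=
    (mul_le_mul_of_nonneg_left (sq_mean_le _ _) (mixWeight_pos _).le).trans
      (mixWeight_mul_mean_le _ fun _ => sq_nonneg _)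
  have h5 := mul_le_mul_of_nonneg_right h3 (sq_nonneg (mean (prodLaw k (crit c (1 / 4 + r))) w))
  have h6 := mul_le_mul_of_nonneg_left h4 (Real.exp_pos (-(K ^ 2 / 100))).le
  have h7 := mul_le_mul_of_nonneg_right h2 (dform_nonneg w)
  linarith

theorem exists_superPoincare_of_large : ∃ A B : ℝ, ∃ k₀ : ℕ, 0 ≤ A ∧ 0 ≤ B ∧
    ∀ (k : ℕ) [NeZero k], k₀ ≤ k → ∀ w : Spins k → ℝ,
      mean (potts betaC k) (fun σ => w σ ^ 2) ≤
        A * dform w + B * mean (potts betaC k) (fun σ => |w σ|) ^ 2 := by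
  obtain ⟨C, hC0, hC⟩ := exists_dist_crit_le
  set e := Real.exp (betaC * (5120 * C)) with he
  have he0 : 0 < e := Real.exp_pos _
  have hb := betaC_gt
  have he1 : 1 ≤ e := Real.one_le_exp (by positivity)
  set L := Real.log (120 * e) with hL
  have hL0 : 0 ≤ L := Real.log_nonneg (by linarith)
  -- With this choice each saddle contributes 1/60 of the second moment; three saddles and the
  -- prefactor 10 make 1/2, which is absorbed on the left.
  set K := √(100 * L) with hK
  have hK2 : K ^ 2 = 100 * L := Real.sq_sqrt (by positivity)
  have hexp : e * Real.exp (-(K ^ 2 / 100)) = 1 / 120 := by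
    rw [hK2, mul_div_cancel_left₀ _ (by norm_num : (100 : ℝ) ≠ 0), hL, Real.exp_neg,
      Real.exp_log (by positivity)]
    field_simp
  set A := 2 * (8 + 30 * e * (3 + 2 * Real.exp (8 * K ^ 2))) with hA
  refine ⟨A, 20 * e * 6 * (120 * e), ⌈100 * K ^ 2⌉₊, by positivity, by positivity,
    fun k _ hk w => ?_⟩
  have hk' : 100 * K ^ 2 ≤ k := (Nat.le_ceil _).trans (Nat.cast_le.mpr hk)
  set ζ := mixWeight k (crit 0 0) with hζ
  have hζ0 : 0 < ζ := mixWeight_pos _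
  have hwell : ∀ c, mixWeight k (crit c 0) = ζ ∧ mixWeight k (crit c (1 / 2)) = ζ := by
    intro c
    simp only [hζ, mixWeight, freeExp_crit_half c 0, freeExp_crit c 0, freeExp_crit 0 0]
    trivial
  have main : ∀ w : Spins k → ℝ, mean (potts betaC k) (fun σ => w σ ^ 2) ≤ A * dform w +
      20 * e * ∑ c, (ζ * mean (prodLaw k (crit c 0)) w ^ 2 +
        ζ * mean (prodLaw k (crit c (1 / 2))) w ^ 2) := by
    intro w
    have h1 := mean_sq_le_localMass hC0 hC w
    set T := mean (potts betaC k) fun σ => w σ ^ 2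
    have h2 : ∀ c, localMass (5120 * C) w c 0 + localMass (5120 * C) w c (1 / 4) +
        localMass (5120 * C) w c (1 / 2) ≤ e * (3 + 2 * Real.exp (8 * K ^ 2)) * dform w +
          1 / 60 * T + e * (ζ * mean (prodLaw k (crit c 0)) w ^ 2 +
            ζ * mean (prodLaw k (crit c (1 / 2))) w ^ 2) := by
      intro c
      have a1 := localMass_le (5120 * C) w c 0
      have a2 := localMass_le (5120 * C) w c (1 / 4)
      have a3 := localMass_le (5120 * C) w c (1 / 2)
      have a4 := mul_le_mul_of_nonneg_left
        (saddle_le (Real.sqrt_nonneg (100 * L)) (by rw [← hK]; exact hk') w c) he0.le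
      rw [(hwell c).1] at a1
      rw [(hwell c).2] at a3
      rw [← he] at a1 a2 a3
      rw [← hK] at a4
      have a5 : e * (2 * Real.exp (-(K ^ 2 / 100)) * T) = 1 / 60 * T := by
        linear_combination 2 * T * hexp
      linarith
    have h3 : ∑ c, (localMass (5120 * C) w c 0 + localMass (5120 * C) w c (1 / 4) +
        localMass (5120 * C) w c (1 / 2)) ≤
        3 * (e * (3 + 2 * Real.exp (8 * K ^ 2)) * dform w + 1 / 60 * T) +
          e * ∑ c, (ζ * mean (prodLaw k (crit c 0)) w ^ 2 +
            ζ * mean (prodLaw k (crit c (1 / 2))) w ^ 2) := by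
      refine (Finset.sum_le_sum fun c _ => h2 c).trans (le_of_eq ?_)
      rw [Finset.sum_add_distrib, ← Finset.mul_sum, Finset.sum_const, Finset.card_univ,
        Fintype.card_fin, nsmul_eq_mul]
      push_cast
      ring
    linarith
  -- Testing the inequality on the constant 1 bounds the common weight of the wells from below,
  -- without asymptotics of the partition function.
  have hlow : 1 ≤ 120 * e * ζ := by
    have h := main fun _ => 1
    have hd : dform (fun _ : Spins k => (1 : ℝ)) = 0 := by simp [dform, mean_const]
    simp only [one_pow, mean_const, hd, mul_zero, zero_add, mul_one, Finset.sum_const,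
      Finset.card_univ, Fintype.card_fin, nsmul_eq_mul] at h
    push_cast at h
    linarith
  set m := mean (potts betaC k) fun σ => |w σ| with hm
  -- The lower bound on `ζ` allows one more factor of it: ζ m² ≤ 120 e (ζ m)², and ζ |m| is at most
  -- the mean of |w|.
  have hq : ∀ c x, mixWeight k (crit c x) = ζ →
      ζ * mean (prodLaw k (crit c x)) w ^ 2 ≤ 120 * e * m ^ 2 := by
    intro c x hx
    have h1 := mixWeight_mul_mean_le (k := k) (crit c x) (F := fun σ => |w σ|)
      fun σ => abs_nonneg _
    rw [hx, ← hm] at h1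
    have h2 : |ζ * mean (prodLaw k (crit c x)) w| ≤ m := by
      rw [abs_mul, abs_of_pos hζ0]
      exact (mul_le_mul_of_nonneg_left (abs_mean_le _ _) hζ0.le).trans h1
    have h3 : (ζ * mean (prodLaw k (crit c x)) w) ^ 2 ≤ m ^ 2 :=
      sq_le_sq' (neg_le_of_abs_le h2) (le_of_abs_le h2)
    have h4 : 0 ≤ ζ * mean (prodLaw k (crit c x)) w ^ 2 := mul_nonneg hζ0.le (sq_nonneg _)
    have h5 := mul_le_mul_of_nonneg_right hlow h4
    have h6 := mul_le_mul_of_nonneg_left h3 (by positivity : 0 ≤ 120 * e)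
    linarith
  refine (main w).trans (add_le_add le_rfl ?_)
  have h1 : ∑ c, (ζ * mean (prodLaw k (crit c 0)) w ^ 2 +
      ζ * mean (prodLaw k (crit c (1 / 2))) w ^ 2) ≤
      ∑ _c : Fin 3, (120 * e * m ^ 2 + 120 * e * m ^ 2) :=
    Finset.sum_le_sum fun c _ => add_le_add (hq c 0 (hwell c).1) (hq c _ (hwell c).2)
  rw [Finset.sum_const, Finset.card_univ, Fintype.card_fin, nsmul_eq_mul] at h1
  push_cast at h1
  have h2 := mul_le_mul_of_nonneg_left h1 (by positivity : 0 ≤ 20 * e)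
  linarith

theorem mean_sq_le_of_le {E : Type} [Fintype E] {p : PMF E} {b : ℝ} (hb : 0 < b)
    (hp : ∀ x, b ≤ (p x).toReal) (w : E → ℝ) :
    mean p (fun x => w x ^ 2) ≤ 1 / b * mean p (fun x => |w x|) ^ 2 := by
  have h1 : ∀ x, |w x| ≤ 1 / b * mean p fun x => |w x| := by
    intro x
    have h2 : (p x).toReal * |w x| ≤ mean p fun x => |w x| :=
      Finset.single_le_sum (f := fun x => (p x).toReal * |w x|)
        (fun _ _ => mul_nonneg ENNReal.toReal_nonneg (abs_nonneg _)) (Finset.mem_univ x)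
    have h3 := (mul_le_mul_of_nonneg_right (hp x) (abs_nonneg (w x))).trans h2
    rw [one_div, inv_mul_eq_div, le_div_iff₀ hb]
    linarith
  have h4 : mean p (fun x => w x ^ 2) ≤
      mean p fun x => 1 / b * mean p (fun x => |w x|) * |w x| := by
    refine mean_mono _ fun x => ?_
    rw [← sq_abs, sq]
    exact mul_le_mul_of_nonneg_right (h1 x) (abs_nonneg _)
  refine h4.trans (le_of_eq ?_)
  rw [mean_const_mul]
  ring

/-- The finitely many small `k` need no Dirichlet form: on a finite space with full support, second
moments are at most a constant times squared first moments. -/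
theorem exists_superPoincare : ∃ A B : ℝ, 0 < A ∧ 0 ≤ B ∧
    ∀ (k : ℕ) [NeZero k] (w : Spins k → ℝ), mean (potts betaC k) (fun σ => w σ ^ 2) ≤
      A * dform w + B * mean (potts betaC k) (fun σ => |w σ|) ^ 2 := by
  obtain ⟨A, B, k₀, hA, hB, h⟩ := exists_superPoincare_of_large
  have hmin : ∀ k : ℕ, ∃ b : ℝ, 0 < b ∧ ∀ σ : Spins k, b ≤ (potts betaC k σ).toReal := by
    intro k
    obtain ⟨σ, -, hσ⟩ := Finset.exists_min_image Finset.univ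
      (fun σ : Spins k => (potts betaC k σ).toReal) ⟨fun _ => 0, Finset.mem_univ _⟩
    exact ⟨_, ENNReal.toReal_pos (potts_ne_zero _ _ _) (PMF.apply_ne_top _ _),
      fun τ => hσ τ (Finset.mem_univ _)⟩
  choose b hb0 hb using hmin
  have hsum : 0 ≤ ∑ j ∈ Finset.range k₀, 1 / b j :=
    Finset.sum_nonneg fun j _ => (one_div_pos.mpr (hb0 j)).le
  refine ⟨A + 1, B + ∑ j ∈ Finset.range k₀, 1 / b j, by positivity, by positivity,
    fun k _ w => ?_⟩
  have hd := dform_nonneg w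
  have hm := sq_nonneg (mean (potts betaC k) fun σ => |w σ|)
  rcases le_or_gt k₀ k with hk | hk
  · have h1 := h k hk w
    have h2 := mul_nonneg hsum hm
    linarith
  · have h1 := mean_sq_le_of_le (hb0 k) (hb k) w
    have h2 : 1 / b k ≤ B + ∑ j ∈ Finset.range k₀, 1 / b j := by
      have := Finset.single_le_sum (f := fun j => 1 / b j)
        (fun j _ => (one_div_pos.mpr (hb0 j)).le) (Finset.mem_range.mpr hk)
      linarith
    have h3 := mul_le_mul_of_nonneg_right h2 hm
    have h4 := mul_nonneg (by positivity : 0 ≤ A + 1) hd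
    linarith

end SuperPoincare

/-! ### The Glauber dynamics -/

section Glauber

variable {k : ℕ}

/-- The conditional expectation given all the spins but the spin `i`. -/
noncomputable def condMean (i : Fin k) (w : Spins k → ℝ) (σ : Spins k) : ℝ :=
  mean (softmax (others σ i)) fun b => w (Function.update σ i b)

theorem condMean_update (i : Fin k) (w : Spins k → ℝ) (σ : Spins k) (b : Fin 3) :
    condMean i w (Function.update σ i b) = condMean i w σ := by
  have : others (Function.update σ i b) i = others σ i := funext fun c => others_update σ i b c
  simp only [condMean, this, Function.update_idem]

/-- The configurations agreeing with `σ` off `i` are its three updates; `restWeight` and the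
partition function cancel in the conditional law. -/
theorem mean_filter_eq [NeZero k] (i : Fin k) (w : Spins k → ℝ) (σ : Spins k)
    (h : ∃ τ ∈ {τ : Spins k | ∀ j, j ≠ i → τ j = σ j}, τ ∈ (potts betaC k).support) :
    mean ((potts betaC k).filter {τ | ∀ j, j ≠ i → τ j = σ j} h) w = condMean i w σ := by
  classical
  have hsum : ∀ F : Spins k → ℝ,
      ∑ τ, ({τ : Spins k | ∀ j, j ≠ i → τ j = σ j}.indicator F τ) =
        ∑ b, F (Function.update σ i b) := by
    intro F
    rw [Finset.sum_indicator_eq_sum_filter, eq_comm]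
    refine Finset.sum_bij (fun b _ => Function.update σ i b) ?_ ?_ ?_ ?_
    · intro b _
      simp only [Finset.mem_filter, Finset.mem_univ, true_and, Set.mem_ofPred_eq]
      intro j hj
      exact Function.update_of_ne hj _ _
    · intro b _ b' _ hbb
      simpa using congrFun hbb i
    · intro τ hτ
      simp only [Finset.mem_filter, Finset.mem_univ, true_and, Set.mem_ofPred_eq] at hτ
      refine ⟨τ i, Finset.mem_univ _, funext fun j => ?_⟩
      by_cases hj : j = i
      · subst hj; simp
      · rw [Function.update_of_ne hj, hτ j hj]
    · intro b _
      rfl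
  have hind : ∀ τ, ({τ : Spins k | ∀ j, j ≠ i → τ j = σ j}.indicator (potts betaC k) τ).toReal =
      {τ : Spins k | ∀ j, j ≠ i → τ j = σ j}.indicator (fun τ => (potts betaC k τ).toReal) τ := by
    intro τ
    simp only [Set.indicator]
    split_ifs <;> simp
  have hpot : ∀ b, (potts betaC k (Function.update σ i b)).toReal =
      restWeight σ i / partition k * Real.exp (2 * betaC * others σ i b) := by
    intro b
    rw [toReal_potts, gibbsWeight_eq _ i, others_update, restWeight_update, Function.update_self]
    ring
  have hne : restWeight σ i / partition k ≠ 0 :=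
    (div_pos (Real.exp_pos _) (partition_pos k)).ne'
  have hden : (∑' τ, {τ : Spins k | ∀ j, j ≠ i → τ j = σ j}.indicator (potts betaC k) τ).toReal =
      restWeight σ i / partition k * ∑ b, Real.exp (2 * betaC * others σ i b) := by
    rw [tsum_fintype, ENNReal.toReal_sum]
    · simp only [hind]
      rw [hsum, Finset.mul_sum]
      exact Finset.sum_congr rfl fun b _ => hpot b
    · intro τ _
      refine ne_top_of_le_ne_top (PMF.apply_ne_top (potts betaC k) τ)
        (Set.indicator_le_self _ _ _)
  have h1 : mean ((potts betaC k).filter {τ | ∀ j, j ≠ i → τ j = σ j} h) w =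
      (∑ τ, {τ : Spins k | ∀ j, j ≠ i → τ j = σ j}.indicator
        (fun τ => (potts betaC k τ).toReal * w τ) τ) *
      (restWeight σ i / partition k * ∑ b, Real.exp (2 * betaC * others σ i b))⁻¹ := by
    rw [mean, Finset.sum_mul]
    refine Finset.sum_congr rfl fun τ _ => ?_
    rw [PMF.filter_apply, ENNReal.toReal_mul, ENNReal.toReal_inv, hden, hind]
    simp only [Set.indicator]
    split_ifs <;> ring
  rw [h1, hsum, condMean, mean, Finset.sum_mul]
  refine Finset.sum_congr rfl fun b _ => ?_
  rw [hpot, toReal_softmax]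
  have := (sum_exp_pos (others σ i)).ne'
  generalize restWeight σ i / partition k = c at *
  field_simp

theorem mean_uniform {E : Type} [Fintype E] [Nonempty E] (F : E → ℝ) :
    mean (PMF.uniformOfFintype E) F = (∑ x, F x) / Fintype.card E := by
  simp only [mean, PMF.uniformOfFintype_apply, ENNReal.toReal_inv, ENNReal.toReal_natCast,
    ← Finset.mul_sum]
  rw [inv_mul_eq_div]

/-- The Glauber operator. -/
noncomputable def glauberOp [NeZero k] (w : Spins k → ℝ) (σ : Spins k) : ℝ :=
  mean (glauber betaC k σ) w

theorem glauberOp_eq [NeZero k] (w : Spins k → ℝ) (σ : Spins k) :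
    glauberOp w σ = mean (PMF.uniformOfFintype (Fin k)) fun i => condMean i w σ := by
  rw [glauberOp, glauber, mean_bind]
  simp only [mean_filter_eq]

/-- The Gibbs measure is stationary for the update of the spin `i`. -/
theorem mean_condMean [NeZero k] (i : Fin k) (w : Spins k → ℝ) :
    mean (potts betaC k) (condMean i w) = mean (potts betaC k) w := by
  set H : Spins k → Fin 3 → ℝ := fun σ b =>
    (potts betaC k σ).toReal * ((softmax (others σ i) b).toReal * w (Function.update σ i b)) with hH
  have h1 : mean (potts betaC k) (condMean i w) = ∑ σ : Spins k, ∑ b, H σ b := by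
    simp only [mean, condMean, hH, Finset.mul_sum]
  rw [h1, ← sum_update_comm i H]
  refine Finset.sum_congr rfl fun σ _ => ?_
  have h2 : ∀ b, H (Function.update σ i b) (σ i) =
      (softmax (others σ i) b).toReal * ((potts betaC k σ).toReal * w σ) := by
    intro b
    have h3 : others (Function.update σ i b) i = others σ i := funext fun c => others_update σ i b c
    simp only [hH, h3, Function.update_idem, Function.update_eq_self, toReal_potts,
      gibbsWeight_eq _ i, restWeight_update, Function.update_self, toReal_softmax]
    ring
  simp only [h2]
  rw [← Finset.sum_mul, sum_toReal, one_mul]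

theorem condMean_mul (i : Fin k) (u w : Spins k → ℝ)
    (hu : ∀ σ b, u (Function.update σ i b) = u σ) (σ : Spins k) :
    condMean i (fun τ => u τ * w τ) σ = u σ * condMean i w σ := by
  simp only [condMean, hu, mean_const_mul]

theorem mean_mul_condMean [NeZero k] (i : Fin k) (w : Spins k → ℝ) :
    mean (potts betaC k) (fun σ => w σ * condMean i w σ) =
      mean (potts betaC k) fun σ => condMean i w σ ^ 2 := by
  rw [← mean_condMean i]
  congr 1
  funext σ
  simp only [mul_comm (w _)]
  rw [condMean_mul i (condMean i w) w (condMean_update i w), sq]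

theorem mean_glauberOp [NeZero k] (w : Spins k → ℝ) :
    mean (potts betaC k) (glauberOp w) = mean (potts betaC k) w := by
  have : glauberOp w = fun σ => mean (PMF.uniformOfFintype (Fin k)) fun i => condMean i w σ :=
    funext fun σ => glauberOp_eq w σ
  rw [this, mean_comm]
  simp only [mean_condMean, mean_const]

theorem mean_mul_glauberOp [NeZero k] (w : Spins k → ℝ) :
    mean (potts betaC k) (fun σ => w σ * glauberOp w σ) =
      mean (PMF.uniformOfFintype (Fin k)) fun i =>
        mean (potts betaC k) fun σ => condMean i w σ ^ 2 := by
  simp only [glauberOp_eq, ← mean_const_mul, ← mean_mul_condMean]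
  rw [mean_comm]

/-- The Glauber operator is an average of the orthogonal projections `condMean`; Jensen then gives
P² ≤ P as quadratic forms. -/
theorem mean_glauberOp_sq_le [NeZero k] (w : Spins k → ℝ) :
    mean (potts betaC k) (fun σ => glauberOp w σ ^ 2) ≤
      mean (potts betaC k) fun σ => w σ * glauberOp w σ := by
  rw [mean_mul_glauberOp, ← mean_comm]
  refine mean_mono _ fun σ => ?_
  rw [glauberOp_eq]
  exact sq_mean_le _ _

theorem mean_abs_glauberOp_le [NeZero k] (w : Spins k → ℝ) :
    mean (potts betaC k) (fun σ => |glauberOp w σ|) ≤ mean (potts betaC k) fun σ => |w σ| := by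
  rw [← mean_glauberOp fun σ => |w σ|]
  exact mean_mono _ fun σ => abs_mean_le _ _

theorem softmax_others_ge [NeZero k] (σ : Spins k) (i : Fin k) (b : Fin 3) :
    1 / 48 ≤ (softmax (others σ i) b).toReal := by
  have hb := betaC_gt
  rw [toReal_softmax, div_le_div_iff₀ (by norm_num) (sum_exp_pos _)]
  have h1 : ∑ a, Real.exp (2 * betaC * others σ i a) ≤ ∑ _a : Fin 3, 16 :=
    Finset.sum_le_sum fun a _ => exp_two_betaC_mul_le (others_le_one σ i a)
  have h2 : 1 ≤ Real.exp (2 * betaC * others σ i b) :=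
    Real.one_le_exp (by have := others_nonneg σ i b; positivity)
  simp at h1
  linarith

/-- The right side sums the conditional variances over the spins. All conditional probabilities are
at least 1/48, and the mean squared difference of two independent draws is twice the variance, which
makes 96. -/
theorem dform_le [NeZero k] (w : Spins k → ℝ) :
    dform w ≤ 96 * k * (mean (potts betaC k) (fun σ => w σ ^ 2) -
      mean (potts betaC k) fun σ => w σ * glauberOp w σ) := by
  have hk : (k : ℝ) ≠ 0 := Nat.cast_ne_zero.mpr (NeZero.ne k)
  rw [mean_mul_glauberOp, mean_uniform, Fintype.card_fin]
  have h1 : 96 * k * (mean (potts betaC k) (fun σ => w σ ^ 2) -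
      (∑ i : Fin k, mean (potts betaC k) fun σ => condMean i w σ ^ 2) / k) =
      ∑ i : Fin k, 96 * (mean (potts betaC k) (fun σ => w σ ^ 2) -
        mean (potts betaC k) fun σ => condMean i w σ ^ 2) := by
    rw [← Finset.mul_sum, Finset.sum_sub_distrib, Finset.sum_const, Finset.card_univ,
      Fintype.card_fin, nsmul_eq_mul]
    field_simp
  rw [h1, dform, mean_sum]
  refine Finset.sum_le_sum fun i _ => ?_
  rw [← mean_condMean i, ← mean_condMean i fun σ => w σ ^ 2, ← mean_sub, ← mean_const_mul]
  refine mean_mono _ fun σ => ?_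
  have h2 : condMean i (fun τ => ∑ b, (w τ - w (Function.update τ i b)) ^ 2) σ =
      mean (softmax (others σ i)) fun b' =>
        ∑ b, (w (Function.update σ i b') - w (Function.update σ i b)) ^ 2 := by
    simp only [condMean, Function.update_idem]
  rw [h2]
  simp only [condMean]
  set q := softmax (others σ i)
  set g : Fin 3 → ℝ := fun b => w (Function.update σ i b)
  have h3 : ∀ b', ∑ b, (g b' - g b) ^ 2 ≤ 48 * mean q fun b => (g b' - g b) ^ 2 := by
    intro b'
    rw [mean, Finset.mul_sum]
    refine Finset.sum_le_sum fun b _ => ?_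
    have := softmax_others_ge σ i b
    nlinarith [sq_nonneg (g b' - g b)]
  refine (mean_mono _ h3).trans (le_of_eq ?_)
  have e : ∀ a b, (g a - g b) ^ 2 = g a ^ 2 - 2 * g a * g b + g b ^ 2 := fun a b => by ring
  simp only [e, mean_add, mean_sub, mean_const, mean_const_mul, mean_mul_const]
  ring

/-- The contraction of the iterates of the Glauber operator. -/
theorem exists_mean_iterate_glauberOp_sq_le : ∃ A B : ℝ, 1 ≤ A ∧ 0 ≤ B ∧
    ∀ (k : ℕ) [NeZero k] (w : Spins k → ℝ) (t : ℕ),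
      mean (potts betaC k) (fun σ => (glauberOp^[t] w) σ ^ 2) ≤
        B * mean (potts betaC k) (fun σ => |w σ|) ^ 2 +
          Real.exp (-(t / (A * k))) * mean (potts betaC k) fun σ => w σ ^ 2 := by
  obtain ⟨A₀, B, hA₀, hB, h⟩ := exists_superPoincare
  -- The 96 comes from `dform_le`; the 1 guarantees D ≥ 1, so that 1 - 1/D ≥ 0.
  set A := 96 * A₀ + 1 with hA
  refine ⟨A, B, by linarith, hB, fun k _ w t => ?_⟩
  have hk : (1 : ℝ) ≤ k := Nat.one_le_cast.mpr (Nat.one_le_iff_ne_zero.mpr (NeZero.ne k))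
  set D := A * k with hD
  have hD1 : 1 ≤ D := by nlinarith
  have hD0 : 0 < D := by linarith
  set m := mean (potts betaC k) fun σ => |w σ|
  have hm0 : 0 ≤ m := mean_nonneg _ fun _ => abs_nonneg _
  suffices H : mean (potts betaC k) (fun σ => |(glauberOp^[t] w) σ|) ≤ m ∧
      mean (potts betaC k) (fun σ => (glauberOp^[t] w) σ ^ 2) ≤ B * m ^ 2 +
        Real.exp (-(t / D)) * mean (potts betaC k) fun σ => w σ ^ 2 from H.2
  induction t with
  | zero =>
    have := mul_nonneg hB (sq_nonneg m)
    simp only [Function.iterate_zero, id, Nat.cast_zero, zero_div, neg_zero, Real.exp_zero]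
    exact ⟨le_rfl, by linarith⟩
  | succ t ih =>
    rw [Function.iterate_succ_apply']
    set v := glauberOp^[t] w
    refine ⟨(mean_abs_glauberOp_le v).trans ih.1, ?_⟩
    set T := mean (potts betaC k) fun σ => w σ ^ 2
    set a := mean (potts betaC k) fun σ => v σ ^ 2
    set a' := mean (potts betaC k) fun σ => glauberOp v σ ^ 2
    set c := mean (potts betaC k) fun σ => v σ * glauberOp v σ
    have h1 : a' ≤ c := mean_glauberOp_sq_le v
    have h2 : dform v ≤ 96 * k * (a - c) := dform_le v
    have h3 : a ≤ A₀ * dform v + B * mean (potts betaC k) (fun σ => |v σ|) ^ 2 := h k v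
    have h4 : mean (potts betaC k) (fun σ => |v σ|) ^ 2 ≤ m ^ 2 :=
      pow_le_pow_left₀ (mean_nonneg _ fun _ => abs_nonneg _) ih.1 2
    have h5 : 0 ≤ a - c := by
      by_contra! hneg
      nlinarith [dform_nonneg v]
    have h6 : a ≤ D * (a - a') + B * m ^ 2 := by
      have e1 := mul_le_mul_of_nonneg_left h2 hA₀.le
      have e2 := mul_le_mul_of_nonneg_left h4 hB
      have e3 : A₀ * (96 * k * (a - c)) ≤ D * (a - c) := by
        rw [hD, hA]
        nlinarith [mul_nonneg (by linarith : (0 : ℝ) ≤ k) h5]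
      have e4 := mul_le_mul_of_nonneg_left (sub_le_sub_left h1 a) hD0.le
      linarith
    -- The excess over B m² contracts at each step; `m` can be kept fixed because the operator does
    -- not increase the first absolute moment.
    have h7 : a' - B * m ^ 2 ≤ (1 - 1 / D) * (a - B * m ^ 2) := by
      have e1 : (a - B * m ^ 2) / D ≤ a - a' := by
        rw [div_le_iff₀ hD0]
        linarith
      have e2 : (1 - 1 / D) * (a - B * m ^ 2) = a - B * m ^ 2 - (a - B * m ^ 2) / D := by ring
      linarith
    have h8 : 0 ≤ 1 - 1 / D := sub_nonneg.mpr ((div_le_one hD0).mpr hD1)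
    have h9 : 1 - 1 / D ≤ Real.exp (-(1 / D)) := Real.one_sub_le_exp_neg _
    have h10 : (1 - 1 / D) * (a - B * m ^ 2) ≤ (1 - 1 / D) * (Real.exp (-(t / D)) * T) :=
      mul_le_mul_of_nonneg_left (by linarith [ih.2]) h8
    have hT : 0 ≤ Real.exp (-(t / D)) * T :=
      mul_nonneg (Real.exp_pos _).le (mean_nonneg _ fun _ => sq_nonneg _)
    have h11 := mul_le_mul_of_nonneg_right h9 hT
    have h12 : Real.exp (-(((t + 1 : ℕ) : ℝ) / D)) = Real.exp (-(1 / D)) * Real.exp (-(t / D)) := by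
      rw [← Real.exp_add]
      congr 1
      push_cast
      ring
    rw [h12, mul_assoc]
    linarith

end Glauber

/-! ### The interpolation sequence and the kernels of its stages -/

section Interpolation

variable {M k : ℕ}

/-- The average over the spins after the first `k` ones. -/
noncomputable def avg (k : ℕ) (w : Spins M → ℝ) (a : Spins k) : ℝ :=
  mean (PMF.uniformOfFintype (Spins M)) fun b => w (glue a b)

theorem mean_extend (p : PMF (Spins k)) (w : Spins M → ℝ) :
    mean (extend M p) w = mean p (avg k w) := by
  simp only [extend, mean_bind, mean_map]
  rfl

theorem head_glue (hk : k ≤ M) (a : Spins k) (b : Spins M) : head k (glue a b) = a := by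
  funext i
  have : (i : ℕ) < M := i.2.trans_le hk
  simp [head, glue, this]

theorem avg_comp_head (hk : k ≤ M) (F : Spins k → ℝ) :
    avg k (fun x : Spins M => F (head k x)) = F := by
  funext a
  simp only [avg, head_glue hk, mean_const]

theorem sq_avg_le (w : Spins M → ℝ) (a : Spins k) : avg k w a ^ 2 ≤ avg k (fun x => w x ^ 2) a :=
  sq_mean_le _ _

theorem avg_nonneg {w : Spins M → ℝ} (hw : ∀ x, 0 ≤ w x) (a : Spins k) : 0 ≤ avg k w a :=
  mean_nonneg _ fun _ => hw _

theorem mean_interp (w : Spins M → ℝ) :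
    mean (interp betaC M k) w = mean (potts betaC k) (avg k w) :=
  mean_extend _ _

theorem mean_interp_comp_head (hk : k ≤ M) (F : Spins k → ℝ) :
    mean (interp betaC M k) (fun x => F (head k x)) = mean (potts betaC k) F := by
  rw [mean_interp, avg_comp_head hk]

theorem mean_move [NeZero k] (w : Spins M → ℝ) (x : Spins M) :
    mean (move betaC M k x) w = glauberOp (avg k w) (head k x) :=
  mean_extend _ _

/-- At least one step is required: only after it are the spins beyond `k` fresh and uniform, so that
the dynamics reduces to the first `k` spins. -/
theorem mean_iterKernel_move [NeZero k] (hk : k ≤ M) (t : ℕ) (w : Spins M → ℝ) (x : Spins M) :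
    mean (iterKernel (move betaC M k) (t + 1) x) w =
      (glauberOp^[t + 1] (avg k w)) (head k x) := by
  induction t generalizing x with
  | zero => simp [iterKernel, mean_move]
  | succ t ih =>
    rw [iterKernel, mean_bind]
    simp only [ih]
    rw [mean_move, avg_comp_head hk, Function.iterate_succ_apply' _ (t + 1)]

theorem mean_iterate_glauberOp [NeZero k] (t : ℕ) (w : Spins k → ℝ) :
    mean (potts betaC k) (glauberOp^[t] w) = mean (potts betaC k) w := by
  induction t with
  | zero => rfl
  | succ t ih => rw [Function.iterate_succ_apply', mean_glauberOp, ih]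

/-- The distribution at stage `k` is stationary for the kernel of this stage. -/
theorem mean_stageKernel (C : ℝ) (hk : k < M) (w : Spins M → ℝ) :
    mean (interp betaC M (k + 1)) (fun x => mean (stageKernel betaC C M (k + 1) x) w) =
      mean (interp betaC M (k + 1)) w := by
  rw [stageKernel]
  rcases numSteps C (k + 1) with _ | t
  · simp only [iterKernel, mean_pure]
  · simp only [mean_iterKernel_move (Nat.succ_le_of_lt hk)]
    rw [mean_interp_comp_head (Nat.succ_le_of_lt hk), mean_iterate_glauberOp, mean_interp]

end Interpolation

/-! ### Bounds on the densities between consecutive stages -/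

section Density

variable {M k : ℕ}

theorem sum_ratio_sq_le_one (σ : Spins k) : ∑ c, ratio σ c ^ 2 ≤ 1 := by
  rcases Nat.eq_zero_or_pos k with rfl | hk
  · simp [ratio]
  · have : NeZero k := ⟨hk.ne'⟩
    rw [← sum_ratio σ]
    refine Finset.sum_le_sum fun c _ => ?_
    have h0 := ratio_nonneg σ c
    have h1 := ratio_le_one σ c
    nlinarith

theorem mul_ratio_succ (τ : Spins (k + 1)) (c : Fin 3) :
    ((k : ℝ) + 1) * ratio τ c =
      k * ratio (Fin.init τ : Spins k) c + if τ (Fin.last k) = c then 1 else 0 := by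
  have hk : (k : ℝ) + 1 ≠ 0 := by positivity
  rw [ratio_eq_sum, ratio_eq_sum, Fin.sum_univ_castSucc]
  push_cast
  rw [mul_div_cancel₀ _ hk]
  rcases Nat.eq_zero_or_pos k with rfl | h
  · simp
  · have : (k : ℝ) ≠ 0 := by positivity
    rw [mul_div_cancel₀ _ this]
    rfl

theorem energy_succ (τ : Spins (k + 1)) :
    ((k : ℝ) + 1) * (((k : ℝ) + 1) * ∑ c, ratio τ c ^ 2) =
      k ^ 2 * ∑ c, ratio (Fin.init τ : Spins k) c ^ 2 +
        2 * k * ratio (Fin.init τ : Spins k) (τ (Fin.last k)) + 1 := by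
  have h : ∀ c, (((k : ℝ) + 1) * ratio τ c) ^ 2 = k ^ 2 * ratio (Fin.init τ : Spins k) c ^ 2 +
      if τ (Fin.last k) = c then 2 * k * ratio (Fin.init τ : Spins k) c + 1 else 0 := by
    intro c
    rw [mul_ratio_succ]
    split_ifs <;> ring
  have h2 : ((k : ℝ) + 1) * (((k : ℝ) + 1) * ∑ c, ratio τ c ^ 2) =
      ∑ c, (((k : ℝ) + 1) * ratio τ c) ^ 2 := by
    simp only [mul_pow, ← Finset.mul_sum]
    ring
  rw [h2]
  simp only [h, Finset.sum_add_distrib, ← Finset.mul_sum, Finset.sum_ite_eq, Finset.mem_univ,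
    if_true]
  ring

/-- Adding a spin raises k Σ s_c² by at most 2, and exp(2β) = 16. In `gibbsWeight_le_succ` it lowers
it by at most 1, and exp(β) = 4. -/
theorem gibbsWeight_succ_le (τ : Spins (k + 1)) :
    gibbsWeight betaC τ ≤ 16 * gibbsWeight betaC (Fin.init τ : Spins k) := by
  have hb := betaC_gt
  rw [← exp_two_betaC, gibbsWeight, gibbsWeight, ← Real.exp_add]
  refine Real.exp_le_exp.mpr ?_
  have h := energy_succ τ
  set Q := ∑ c, ratio (Fin.init τ : Spins k) c ^ 2
  set r := ratio (Fin.init τ : Spins k) (τ (Fin.last k))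
  have hr : r ≤ 1 := ratio_le_one _ _
  have hQ : 0 ≤ Q := Finset.sum_nonneg fun _ _ => sq_nonneg _
  have hk : (0 : ℝ) ≤ k := Nat.cast_nonneg k
  have key : ((k : ℝ) + 1) * ∑ c, ratio τ c ^ 2 ≤ k * Q + 2 := by
    refine le_of_mul_le_mul_left ?_ (by positivity : (0 : ℝ) < k + 1)
    rw [h]
    nlinarith [mul_nonneg hk hQ, mul_nonneg hk (sub_nonneg.mpr hr)]
  push_cast
  nlinarith

theorem gibbsWeight_le_succ (τ : Spins (k + 1)) :
    gibbsWeight betaC (Fin.init τ : Spins k) ≤ 4 * gibbsWeight betaC τ := by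
  have hb := betaC_gt
  rw [← exp_betaC, gibbsWeight, gibbsWeight, ← Real.exp_add]
  refine Real.exp_le_exp.mpr ?_
  have h := energy_succ τ
  have hQ1 := sum_ratio_sq_le_one (Fin.init τ : Spins k)
  set Q := ∑ c, ratio (Fin.init τ : Spins k) c ^ 2
  set r := ratio (Fin.init τ : Spins k) (τ (Fin.last k))
  have hr : 0 ≤ r := ratio_nonneg _ _
  have hk : (0 : ℝ) ≤ k := Nat.cast_nonneg k
  have key : k * Q - 1 ≤ ((k : ℝ) + 1) * ∑ c, ratio τ c ^ 2 := by
    refine le_of_mul_le_mul_left ?_ (by positivity : (0 : ℝ) < k + 1)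
    rw [h]
    nlinarith [mul_nonneg hk hr, mul_nonneg hk (sub_nonneg.mpr hQ1)]
  push_cast
  nlinarith

theorem partition_le_succ (k : ℕ) : 3 * partition k ≤ 4 * partition (k + 1) := by
  have h : partition (k + 1) = ∑ σ : Spins k, ∑ a : Fin 3,
      gibbsWeight betaC (Fin.snoc σ a : Spins (k + 1)) := by
    rw [Finset.sum_comm, ← Fintype.sum_prod_type', partition]
    exact (Equiv.sum_comp (Fin.snocEquiv fun _ => Fin 3)
      fun τ : Spins (k + 1) => gibbsWeight betaC τ).symm
  rw [h, partition, Finset.mul_sum, Finset.mul_sum]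
  refine Finset.sum_le_sum fun σ _ => ?_
  rw [Finset.mul_sum]
  have : (3 : ℝ) * gibbsWeight betaC σ = ∑ _a : Fin 3, gibbsWeight betaC σ := by simp
  rw [this]
  refine Finset.sum_le_sum fun a _ => ?_
  have := gibbsWeight_le_succ (Fin.snoc σ a : Spins (k + 1))
  rwa [Fin.init_snoc] at this

theorem toReal_interp (hk : k ≤ M) (x : Spins M) :
    (interp betaC M k x).toReal = (potts betaC k (head k x)).toReal *
      ((∏ i : Fin M, if (i : ℕ) < k then (3 : ℝ) else 1) / Fintype.card (Spins M)) := by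
  classical
  have h1 : (interp betaC M k x).toReal =
      mean (interp betaC M k) fun y => if y = x then 1 else 0 := by simp [mean]
  have h2 : ∀ a : Spins k, avg k (fun y : Spins M => if y = x then (1 : ℝ) else 0) a =
      if a = head k x then
        (∏ i : Fin M, if (i : ℕ) < k then (3 : ℝ) else 1) / Fintype.card (Spins M) else 0 := by
    intro a
    rw [avg, mean_uniform]
    split_ifs with ha
    · congr 1
      have h3 : ∀ b : Spins M, (if glue a b = x then (1 : ℝ) else 0) =
          ∏ i : Fin M, if (i : ℕ) < k ∨ b i = x i then 1 else 0 := by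
        intro b
        have h4 : glue a b = x ↔ ∀ i : Fin M, (i : ℕ) < k ∨ b i = x i := by
          rw [funext_iff]
          refine forall_congr' fun i => ?_
          by_cases hi : (i : ℕ) < k <;> simp [glue, hi, ha, head]
        split_ifs with h
        · exact (Finset.prod_eq_one fun i _ => if_pos (h4.mp h i)).symm
        · obtain ⟨i, hi⟩ := not_forall.mp (mt h4.mpr h)
          exact (Finset.prod_eq_zero (Finset.mem_univ i) (if_neg hi)).symm
      simp only [h3]
      rw [← Fintype.prod_sum fun (i : Fin M) (c : Fin 3) =>
        if (i : ℕ) < k ∨ c = x i then (1 : ℝ) else 0]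
      refine Finset.prod_congr rfl fun i _ => ?_
      by_cases hi : (i : ℕ) < k <;> simp [hi]
    · rw [Finset.sum_eq_zero, zero_div]
      intro b _
      rw [if_neg]
      rintro rfl
      exact ha (head_glue hk a b).symm
  rw [h1, mean_interp]
  simp only [mean, h2, mul_ite, mul_zero, Finset.sum_ite_eq', Finset.mem_univ, if_true]

/-- 64 = 16 · 3 · (4/3): the Gibbs weight ratio, the uniform spin which is replaced, and the ratio
of partition functions. -/
theorem toReal_density_le (hk : k < M) (x : Spins M) :
    (density (interp betaC M) k x).toReal ≤ 64 := by
  have hc : (∏ i : Fin M, if (i : ℕ) < k + 1 then (3 : ℝ) else 1) =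
      3 * ∏ i : Fin M, if (i : ℕ) < k then (3 : ℝ) else 1 := by
    have : ∀ i : Fin M, (if (i : ℕ) < k + 1 then (3 : ℝ) else 1) =
        (if i = ⟨k, hk⟩ then 3 else 1) * if (i : ℕ) < k then (3 : ℝ) else 1 := by
      intro i
      rcases lt_trichotomy (i : ℕ) k with h | h | h
      · simp [h, h.trans (Nat.lt_succ_self k), Fin.ext_iff, h.ne]
      · simp [h, Fin.ext_iff]
      · simp [Fin.ext_iff, h.ne', not_lt.mpr h.le, not_lt.mpr (Nat.succ_le_of_lt h)]
    simp only [this, Finset.prod_mul_distrib, Finset.prod_ite_eq', Finset.mem_univ, if_true]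
  rw [density, ENNReal.toReal_div, toReal_interp (Nat.succ_le_of_lt hk), toReal_interp hk.le, hc,
    toReal_potts, toReal_potts]
  set c := ∏ i : Fin M, if (i : ℕ) < k then (3 : ℝ) else 1 with hcdef
  have hc0 : 0 < c := Finset.prod_pos fun i _ => by split_ifs <;> norm_num
  have hcard : (0 : ℝ) < Fintype.card (Spins M) := Nat.cast_pos.mpr Fintype.card_pos
  have hZ := partition_pos k
  have hZ' := partition_pos (k + 1)
  have hw : 0 < gibbsWeight betaC (head k x) := Real.exp_pos _
  have h1 : gibbsWeight betaC (head (k + 1) x) ≤ 16 * gibbsWeight betaC (head k x) :=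
    gibbsWeight_succ_le (head (k + 1) x)
  have h2 := partition_le_succ k
  rw [div_le_iff₀ (by positivity), mul_div_assoc', mul_div_assoc', mul_div_assoc',
    div_le_div_iff_of_pos_right hcard, div_mul_eq_mul_div, div_mul_eq_mul_div,
    mul_div_assoc', div_le_div_iff₀ hZ' hZ]
  have := mul_le_mul h1 h2 (by positivity) (by positivity)
  nlinarith [mul_le_mul_of_nonneg_left this hc0.le]

end Density

/-! ### Moments of the Feynman–Kac semigroup -/

section Semigroup

variable {E : Type} [Fintype E] {μ : ℕ → PMF E} (K : ℕ → E → PMF E)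

theorem semigroup_one_nonneg (k m : ℕ) (x : E) : 0 ≤ semigroup μ K (fun _ => 1) k m x := by
  induction m generalizing k x with
  | zero => exact zero_le_one
  | succ m ih => exact mul_nonneg ENNReal.toReal_nonneg (mean_nonneg _ fun y => ih (k + 1) y)

theorem abs_semigroup_le {φ : E → ℝ} {c : ℝ} (hφ : ∀ x, |φ x| ≤ c) (k m : ℕ) (x : E) :
    |semigroup μ K φ k m x| ≤ c * semigroup μ K (fun _ => 1) k m x := by
  induction m generalizing k x with
  | zero => simpa [semigroup] using hφ x
  | succ m ih =>
    rw [semigroup, semigroup, abs_mul, abs_of_nonneg ENNReal.toReal_nonneg, mul_left_comm c]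
    refine mul_le_mul_of_nonneg_left ?_ ENNReal.toReal_nonneg
    rw [← mean_const_mul]
    exact (abs_mean_le _ _).trans (mean_mono _ fun y => ih (k + 1) y)

/-- The weights carry each μ_k to μ_{k+1} and the kernels preserve it. For the constant 1 this fixes
the first moment in the second moment recursion. -/
theorem mean_semigroup (hμ : ∀ k x, μ k x ≠ 0) {M : ℕ}
    (hK : ∀ k < M, ∀ f, mean (μ (k + 1)) (fun x => mean (K (k + 1) x) f) = mean (μ (k + 1)) f)
    (φ : E → ℝ) {k m : ℕ} (h : k + m ≤ M) :
    mean (μ k) (semigroup μ K φ k m) = mean (μ (k + m)) φ := by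
  induction m generalizing k with
  | zero => rfl
  | succ m ih =>
    have := mean_pull hμ K hK (k := k) (by omega) (semigroup μ K φ (k + 1) m)
    refine this.trans ?_
    rw [ih (by omega), show k + 1 + m = k + (m + 1) by omega]

/-- A recursive bound for the second moments of the semigroup. -/
theorem mean_sq_semigroup_succ_le (hμ : ∀ k x, μ k x ≠ 0) {k : ℕ} {D : ℝ}
    (hD : ∀ x, (density μ k x).toReal ≤ D) (φ : E → ℝ) (m : ℕ) :
    mean (μ k) (fun x => semigroup μ K φ k (m + 1) x ^ 2) ≤
      D * mean (μ (k + 1)) fun x => mean (K (k + 1) x) (semigroup μ K φ (k + 1) m) ^ 2 := by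
  rw [← mean_density_mul hμ, ← mean_const_mul]
  refine mean_mono _ fun x => ?_
  rw [semigroup, mul_pow, sq (density μ k x).toReal, mul_assoc]
  exact mul_le_mul_of_nonneg_right (hD x)
    (mul_nonneg ENNReal.toReal_nonneg (sq_nonneg _))

/-- The centred function is bounded by 2c, and the semigroup is positive, so only its value on the
constant 1 matters. -/
theorem asympVar_le {M : ℕ} {S : ℝ}
    (hS : ∀ k ≤ M, mean (μ k) (fun x => semigroup μ K (fun _ => 1) k (M - k) x ^ 2) ≤ S)
    {f : E → ℝ} {c : ℝ} (hf : ∀ x, |f x| ≤ c) :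
    asympVar μ K M f ≤ (M + 1) * ((2 * c) ^ 2 * S) := by
  have hφ : ∀ x, |f x - mean (μ M) f| ≤ 2 * c := fun x => by
    have := (abs_mean_le (μ M) f).trans (mean_le_of_le _ hf)
    exact (abs_sub _ _).trans (by linarith [hf x])
  have : asympVar μ K M f ≤ ∑ _k ∈ Finset.range (M + 1), (2 * c) ^ 2 * S := by
    refine Finset.sum_le_sum fun k hk => ?_
    refine le_trans ?_ (mul_le_mul_of_nonneg_left
      (hS k (Nat.lt_succ_iff.mp (Finset.mem_range.mp hk))) (sq_nonneg _))
    rw [← mean_const_mul]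
    refine mean_mono _ fun x => ?_
    rw [← mul_pow, ← sq_abs]
    exact pow_le_pow_left₀ (abs_nonneg _) (abs_semigroup_le K hφ _ _ x) 2
  refine this.trans_eq ?_
  rw [Finset.sum_const, Finset.card_range, nsmul_eq_mul]
  push_cast
  ring

end Semigroup

/-! ### Uniform second moment bound and the number of steps -/

section Bound

variable {M : ℕ}

theorem numSteps_pos {C : ℝ} (hC : 0 < C) {k : ℕ} (hk : 2 ≤ k) : 0 < numSteps C k := by
  have h : (1 : ℝ) < k := Nat.one_lt_cast.mpr hk
  have := Real.log_pos h
  exact Nat.ceil_pos.mpr (by positivity)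

/-- Only log k ≥ log 2 is used: a number of steps linear in `k`, with a large enough constant,
already beats the density bound 64. -/
theorem exp_numSteps_le {A C : ℝ} (hA : 0 < A) (hC : 0 < C)
    (hAC : A * Real.log 128 ≤ C * Real.log 2 ^ 2) {k : ℕ} (hk : 2 ≤ k) :
    64 * Real.exp (-(numSteps C k / (A * k))) ≤ 1 / 2 := by
  have hk2 : (2 : ℝ) ≤ k := Nat.ofNat_le_cast.mpr hk
  have hl : Real.log 2 ≤ Real.log k := Real.log_le_log two_pos hk2
  have hl0 : 0 < Real.log 2 := Real.log_pos one_lt_two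
  have h1 : C * k * Real.log k ^ 2 ≤ numSteps C k := Nat.le_ceil _
  have h2 : Real.log 128 ≤ numSteps C k / (A * k) := by
    rw [le_div_iff₀ (by positivity)]
    calc Real.log 128 * (A * k) = A * Real.log 128 * k := by ring
      _ ≤ C * Real.log 2 ^ 2 * k := by gcongr
      _ ≤ C * Real.log k ^ 2 * k := by gcongr
      _ = C * k * Real.log k ^ 2 := by ring
      _ ≤ _ := h1
  have h3 : Real.exp (-(numSteps C k / (A * k))) ≤ 1 / 128 := by
    refine (Real.exp_le_exp.mpr (neg_le_neg h2)).trans_eq ?_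
    rw [Real.exp_neg, Real.exp_log (by norm_num)]
    norm_num
  linarith

/-- One stage of the sampler contracts the second moment up to the square of the first moment. -/
theorem mean_stageKernel_sq_le {A B C : ℝ} (hA : 0 < A) (hC : 0 < C)
    (hAC : A * Real.log 128 ≤ C * Real.log 2 ^ 2)
    (h : ∀ (k : ℕ) [NeZero k] (w : Spins k → ℝ) (t : ℕ),
      mean (potts betaC k) (fun σ => (glauberOp^[t] w) σ ^ 2) ≤
        B * mean (potts betaC k) (fun σ => |w σ|) ^ 2 +
          Real.exp (-(t / (A * k))) * mean (potts betaC k) fun σ => w σ ^ 2)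
    {k : ℕ} (hk1 : 1 ≤ k) (hk : k < M) {w : Spins M → ℝ} (hw : ∀ x, 0 ≤ w x) :
    64 * mean (interp betaC M (k + 1)) (fun x => mean (stageKernel betaC C M (k + 1) x) w ^ 2) ≤
      64 * B * mean (interp betaC M (k + 1)) w ^ 2 +
        1 / 2 * mean (interp betaC M (k + 1)) fun x => w x ^ 2 := by
  have he := exp_numSteps_le hA hC hAC (Nat.succ_le_succ hk1)
  rw [stageKernel]
  obtain ⟨t, ht⟩ := Nat.exists_eq_succ_of_ne_zero (numSteps_pos hC (Nat.succ_le_succ hk1)).ne'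
  rw [ht] at he ⊢
  simp only [Nat.succ_eq_add_one, mean_iterKernel_move (Nat.succ_le_of_lt hk)] at he ⊢
  rw [mean_interp_comp_head (Nat.succ_le_of_lt hk)
    (fun σ => (glauberOp^[t + 1] (avg (k + 1) w)) σ ^ 2)]
  have h1 := h (k + 1) (avg (k + 1) w) (t + 1)
  simp only [abs_of_nonneg (avg_nonneg hw _)] at h1
  rw [mean_interp, mean_interp]
  have h2 := mean_mono (potts betaC (k + 1)) fun a => sq_avg_le (k := k + 1) w a
  have h3 := mean_nonneg (potts betaC (k + 1)) fun a => sq_nonneg (avg (k + 1) w a)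
  nlinarith [mul_le_mul_of_nonneg_right he h3]

theorem exists_mean_sq_semigroup_le : ∃ C₁ S : ℝ, 0 < C₁ ∧ 0 < S ∧ ∀ M : ℕ, 1 ≤ M → ∀ k ≤ M,
    mean (interp betaC M k) (fun x =>
      semigroup (interp betaC M) (stageKernel betaC C₁ M) (fun _ => 1) k (M - k) x ^ 2) ≤ S := by
  obtain ⟨A, B, hA, hB, h⟩ := exists_mean_iterate_glauberOp_sq_le
  have hA0 : 0 < A := by linarith
  have hl : 0 < Real.log 2 := Real.log_pos one_lt_two
  have hl' : 0 < Real.log 128 := Real.log_pos (by norm_num)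
  set C₁ := A * Real.log 128 / Real.log 2 ^ 2 with hC₁
  have hC0 : 0 < C₁ := by positivity
  have hAC : A * Real.log 128 ≤ C₁ * Real.log 2 ^ 2 := by
    rw [hC₁, div_mul_cancel₀ _ (by positivity)]
  refine ⟨C₁, 64 * (128 * B + 1), hC0, by positivity, fun M hM => ?_⟩
  set μ := interp betaC M
  set K := stageKernel betaC C₁ M
  have hμ : ∀ k x, μ k x ≠ 0 := interp_ne_zero betaC M
  have hK : ∀ k < M, ∀ f, mean (μ (k + 1)) (fun x => mean (K (k + 1) x) f) = mean (μ (k + 1)) f :=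
    fun k hk f => mean_stageKernel C₁ hk f
  have hu : ∀ m ≤ M, mean (μ (M - m)) (semigroup μ K (fun _ => 1) (M - m) m) = 1 := fun m hm => by
    rw [mean_semigroup K hμ hK _ (by omega), mean_const]
  -- Backward induction down to stage 1; 128 B + 1 is preserved by x ↦ 64 B + x/2 in the sense of an
  -- upper bound.
  have hpos : ∀ m < M,
      mean (μ (M - m)) (fun x => semigroup μ K (fun _ => 1) (M - m) m x ^ 2) ≤ 128 * B + 1 := by
    intro m
    induction m with
    | zero =>
      intro _
      simp only [semigroup, one_pow, mean_const]
      linarith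
    | succ m ih =>
      intro hm
      have ih' := ih (Nat.lt_of_succ_lt hm)
      obtain ⟨k, hk1, hk, hkm⟩ : ∃ k, 1 ≤ k ∧ k < M ∧ M - m = k + 1 :=
        ⟨M - (m + 1), by omega, by omega, by omega⟩
      have hu' := hu m (by omega)
      rw [hkm] at ih' hu'
      rw [show M - (m + 1) = k by omega]
      have h1 := mean_sq_semigroup_succ_le K hμ (toReal_density_le hk) (fun _ => 1) m
      have h2 := mean_stageKernel_sq_le hA0 hC0 hAC h hk1 hk
        (semigroup_one_nonneg (μ := μ) K (k + 1) m)
      rw [hu'] at h2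
      linarith
  intro k hk
  -- The kernel of stage 1 makes no step, as log 1 = 0, so it does not contract. Jensen and
  -- stationarity suffice there, at the price of one extra factor 64.
  rcases Nat.eq_zero_or_pos k with rfl | hk0
  · obtain ⟨m, rfl⟩ := Nat.exists_eq_add_of_le' hM
    have h1 := mean_sq_semigroup_succ_le K hμ (toReal_density_le (Nat.succ_pos m)) (fun _ => 1) m
    have h2 := hpos m (Nat.lt_succ_self m)
    rw [show m + 1 - m = 0 + 1 by omega] at h2
    have h3 : mean (μ (0 + 1)) (fun x => mean (K (0 + 1) x)
        (semigroup μ K (fun _ => 1) (0 + 1) m) ^ 2) ≤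
        mean (μ (0 + 1)) fun x => semigroup μ K (fun _ => 1) (0 + 1) m x ^ 2 :=
      (mean_mono _ fun x => sq_mean_le _ _).trans_eq (hK 0 (Nat.succ_pos m) _)
    refine h1.trans (mul_le_mul_of_nonneg_left (h3.trans h2) (by norm_num))
  · have := hpos (M - k) (by omega)
    rw [show M - (M - k) = k by omega] at this
    linarith

theorem totalSteps_le {C D : ℝ} (hC : 0 < C) (hD : 0 < D) (hM : 1 ≤ M) :
    (totalSteps C M ⌈D * M⌉₊ : ℝ) ≤ (D + 1) * (C + 2) * (M : ℝ) ^ 3 * Real.log M ^ 2 := by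
  -- For M = 1 both sides vanish. For M ≥ 2 one has log M ≥ 1/2, which lets M log² M absorb the
  -- rounding up.
  rcases Nat.eq_or_lt_of_le hM with rfl | hM2
  · simp [totalSteps, numSteps]
  have hM2' : (2 : ℝ) ≤ M := Nat.ofNat_le_cast.mpr hM2
  have hl : 1 / 2 ≤ Real.log M :=
    (by linarith [Real.log_two_gt_d9] : (1 : ℝ) / 2 ≤ Real.log 2).trans
      (Real.log_le_log two_pos hM2')
  have h0 : 1 ≤ 2 * (M * Real.log M ^ 2) := by nlinarith
  have h1 : ∀ k ∈ Finset.Icc 1 M, (numSteps C k : ℝ) ≤ (C + 2) * (M * Real.log M ^ 2) := by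
    intro k hk
    rw [Finset.mem_Icc] at hk
    have hk1 : (1 : ℝ) ≤ k := Nat.one_le_cast.mpr hk.1
    have hkM : (k : ℝ) ≤ M := Nat.cast_le.mpr hk.2
    have hlk : 0 ≤ Real.log k := Real.log_nonneg hk1
    have hlM : Real.log k ≤ Real.log M := Real.log_le_log (by linarith) hkM
    have h2 : C * k * Real.log k ^ 2 ≤ C * M * Real.log M ^ 2 := by gcongr
    have h3 : (numSteps C k : ℝ) ≤ C * k * Real.log k ^ 2 + 1 :=
      (Nat.ceil_lt_add_one (by positivity)).le
    linarith
  have h2 : (⌈D * M⌉₊ : ℝ) ≤ (D + 1) * M := by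
    have := (Nat.ceil_lt_add_one (by positivity : 0 ≤ D * (M : ℝ))).le
    linarith
  rw [totalSteps]
  push_cast
  have h3 := Finset.sum_le_sum h1
  rw [Finset.sum_const, Nat.card_Icc, nsmul_eq_mul, Nat.add_sub_cancel] at h3
  refine (mul_le_mul h2 h3 (Finset.sum_nonneg fun _ _ => Nat.cast_nonneg _)
    (by positivity)).trans_eq ?_
  ring

end Bound

end PottsSMC

/-! ### Conclusion -/

open PottsSMC in
theorem mainTheorem1 :
    ∃ C₁ C₂ C₃ : ℝ, 0 < C₁ ∧ 0 < C₂ ∧ 0 < C₃ ∧ ∀ M : ℕ, 1 ≤ M →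
      (∀ f : Spins M → ℝ,
        HasCLT (interp betaC M) (interp_ne_zero betaC M) (stageKernel betaC C₁ M) M f
            (asympVar (interp betaC M) (stageKernel betaC C₁ M) M f).toNNReal ∧
          asympVar (interp betaC M) (stageKernel betaC C₁ M) M f ≤ C₂ * M * ‖f‖ ^ 2) ∧
      ∃ N : ℕ, 1 ≤ N ∧
        (∀ f : Spins M → ℝ, ‖f‖ ≤ 1 →
          asympVar (interp betaC M) (stageKernel betaC C₁ M) M f / N ≤ 1) ∧
        (totalSteps C₁ M N : ℝ) ≤ C₃ * (M : ℝ) ^ 3 * Real.log M ^ 2 := by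
  obtain ⟨C₁, S, hC₁, hS, h⟩ := exists_mean_sq_semigroup_le
  -- The variance is a sum of M + 1 ≤ 2M terms, each at most 4 S ‖f‖²; this gives the 8.
  refine ⟨C₁, 8 * S, (8 * S + 1) * (C₁ + 2), hC₁, by positivity, by positivity, fun M hM => ?_⟩
  have hM1 : (1 : ℝ) ≤ M := Nat.one_le_cast.mpr hM
  have hV : ∀ f : Spins M → ℝ,
      asympVar (interp betaC M) (stageKernel betaC C₁ M) M f ≤ 8 * S * M * ‖f‖ ^ 2 := by
    intro f
    refine (asympVar_le _ (h M hM) fun x => norm_le_pi_norm f x).trans ?_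
    have : 0 ≤ S * ‖f‖ ^ 2 := by positivity
    nlinarith
  refine ⟨fun f => ⟨hasCLT _ _ (fun k hk g => mean_stageKernel C₁ hk g) le_rfl f, hV f⟩,
    ⌈8 * S * M⌉₊, Nat.ceil_pos.mpr (by positivity), fun f hf => ?_,
    totalSteps_le hC₁ (by positivity) hM⟩
  have hN : (0 : ℝ) < ⌈8 * S * M⌉₊ := Nat.cast_pos.mpr (Nat.ceil_pos.mpr (by positivity))
  rw [div_le_one hN]
  refine (hV f).trans (le_trans ?_ (Nat.le_ceil _))
  exact mul_le_of_le_one_right (by positivity) (pow_le_one₀ (norm_nonneg f) hf)
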